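/- **B-systems.** A *B-frame* consists of sets $B_n$ ($n\ge 0$) and $\tilde B_{n+1}$ ($n\ge 0$) with maps $\mathrm{ft}\colon B_{n+1}\to B_n$ and $\partial\colon\tilde B_{n+1}\to B_{n+1}$, such that $B_0$ is a singleton. Homomorphisms are families of maps commuting with $\mathrm{ft}$ and $\partial$. For $X\in B_n$, the slice $\mathbb B/X$ has $(B/X)_m=\{Y\in B_{n+m}\mid \mathrm{ft}^mY=X\}$ and $(\tilde B/X)_{m+1}=\{y\in\tilde B_{n+m+1}\mid \mathrm{ft}^{m+1}\partial y=X\}$; one identifies $(\mathbb B/X)/Y$ with $\mathbb B/Y$; a homomorphism $H$ induces $H/X\colon \mathbb A/X\to\mathbb B/H(X)$. A *pre-B-system* is a B-frame with homomorphisms of B-frames $S_x\colon\mathbb B/\partial x\to\mathbb B/\mathrm{ft}\,\partial x$ for $x\in\tilde B_{n+1}$ and $W_X\colon\mathbb B/\mathrm{ft}X\to\mathbb B/X$ for $X\in B_{n+1}$, and elements $\delta(X)\in\tilde B_{n+2}$ for $X\in B_{n+1}$ with $\partial\delta(X)=W_X(X)$. A homomorphism of pre-B-systems is a homomorphism $H$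 of B-frames with $H/\mathrm{ft}\,\partial x\circ S_x=S_{H(x)}\circ H/\partial x$, $H/X\circ W_X=W_{H(X)}\circ H/\mathrm{ft}X$ and $H(\delta(X))=\delta(H(X))$. A *B-system* is a pre-B-system such that all $S_x$ and $W_X$ are homomorphisms of pre-B-systems and $$S_x\circ W_{\partial x}=\mathrm{id},\qquad S_x(\delta(\partial x))=x,\qquad S_{\delta(X)}\circ W_X/X=\mathrm{id}.$$ With the homomorphisms of pre-B-systems between them, B-systems form a category $\mathbf{Bsys}$. **Stratified E-systems.** A *strict category with term structure* $(\mathcal F,T)$ is a small category (objects form a set and are compared by equality) with a set $T(f)$ for each arrow $f$; a functor with term structure also maps $T(f)$ to $T'(Ff)$. The slice $(\mathcal F,T)/\Gamma$ has the term structure $T(f)$ for $f\colon P\to Q$ over $\Gamma$; one identifies $(\mathcal F/\Gamma)/P$ with $\mathcal F/\mathrm{dom}(P)$. A *pre-E-system* is a strict category with term structure and a chosen terminal object $1$, with, for every $A\colon\Delta\to\Gamma$, functors with term structure $W_A\colon\mathcal F/\Gamma\to\mathcal F/\Delta$ and $S_x\colon\mathcal F/\Delta\to\mathcal F/\Gamma$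 for $x\in T(A)$, both mapping the identity arrow to the identity arrow, with $W_{\mathrm{id}}=\mathrm{id}$ and $W_{A\circ P}=W_P\circ W_A$, and elements $\mathrm{idtm}_A\in T(W_A(A))$. A homomorphism of pre-E-systems is a functor with term structure $F$ with $F(1)=1$, $F/\Gamma\circ S_x=S_{F(x)}\circ F/\Delta$, $F/\Delta\circ W_A=W_{F(A)}\circ F/\Gamma$ and $F(\mathrm{idtm}_A)=\mathrm{idtm}_{F(A)}$. An *E-system* is a pre-E-system such that all $S_x$ and $W_A$ are homomorphisms of pre-E-systems between slices and $$S_x\circ W_A=\mathrm{id},\qquad S_x(\mathrm{idtm}_A)=x,\qquad S_{\mathrm{idtm}_A}\circ W_A/A=\mathrm{id}.$$ A *stratification* of a strict category with chosen terminal object $1$ is a functor $L\colon\mathcal F\to(\mathbb N,\ge)$ such that $L(X)=0$ iff $X=1$; for $f\colon X\to Y$, $L(X)=L(Y)$ iff $X=Y$ and $f=\mathrm{id}$; and each $f\colon X\to Y$ with $L(X)=n+m+1$, $L(Y)=n$ has a unique factorization $X=X_{m+1}\to X_m\to\dots\to X_0=Y$ with $L(X_i)=n+i$. An arrow $X\to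 Y$ is *individual* if $L(X)=L(Y)+1$. A *stratified E-system* is an E-system whose category is stratified and such that all $W_A$ and $S_x$ preserve the length $L(\mathrm{dom}P)-L(\Gamma)$ of objects $P$ of slices $\mathcal F/\Gamma$. Stratified E-homomorphisms are the homomorphisms of pre-E-systems that preserve $L$; they are the morphisms of a category $\mathbf{Esys}_s$. **The functor $\mathrm{B2E}\colon\mathbf{Bsys}\to\mathbf{Esys}_s$.** Let $\mathbb B$ be a B-system. The category of $\mathrm{B2E}(\mathbb B)$ is freely generated by the graph with vertices $(n,X)$, $X\in B_n$, and edges $(n+1,X)\to(n,\mathrm{ft}X)$; its arrows are $(X,k)\colon(n+k,X)\to(n,\mathrm{ft}^kX)$, and $L(n,X)=n$. The term sets and the iterated substitutions $S_t\colon\mathbb B/X\to\mathbb B/\mathrm{ft}^kX$ for $t\in T(X,k)$ are defined by $T(X,0)=\{*\}$, $S_*=\mathrm{id}$, $T(X,k+1)=\{(t,x)\mid t\in T(\mathrm{ft}X,k),\ \partial x=S_t(X)\}$ and $S_{(t,x)}=S_x\circ S_t/X$. With $W_X^0=\mathrm{id}$ and $W_X^{k+1}=W_X\circ W_{\mathrm{ft}X}^k$,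 the functors $S_t$ and $W_{(X,k)}$ are given by $S_t$ and $W_X^k$ on objects and, componentwise, on terms; $\mathrm{idtm}_{(X,0)}=*$ and $\mathrm{idtm}_{(X,k+1)}=(W_X(\mathrm{idtm}_{(\mathrm{ft}X,k)}),\delta(X))$. A homomorphism $H$ acts as $H$ on objects and componentwise on terms. **The functor $\mathrm{E2B}\colon\mathbf{Esys}_s\to\mathbf{Bsys}$.** Let $\mathbb E$ be a stratified E-system. For $X$ with $L(X)>0$ let $\overline X$ be the unique individual arrow with domain $X$. Put $B_n=\{X\mid L(X)=n\}$, $\tilde B_{n+1}=\coprod_{X\in B_{n+1}}T(\overline X)$, $\mathrm{ft}(X)=\mathrm{cod}(\overline X)$ and $\partial(X,x)=X$. The homomorphisms $S_{(X,x)}$ and $W_X$ are those induced on objects and terms by $S_x$ and $W_{\overline X}$, and $\delta(X)=(W_X(X),\mathrm{idtm}_{\overline X})$. A homomorphism acts as its underlying functor with term structure. **Theorem.** These constructions define functors $\mathrm{B2E}\colon\mathbf{Bsys}\to\mathbf{Esys}_s$ and $\mathrm{E2B}\colon\mathbf{Esys}_s\to\mathbf{Bsys}$. The functor $\mathrm{B2E}$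 is full and faithful, $\mathrm{E2B}$ is an essential section of it, i.e. there is a natural isomorphism $\mathrm{B2E}\circ\mathrm{E2B}\cong\mathrm{id}_{\mathbf{Esys}_s}$, and $\mathrm{B2E}$ and $\mathrm{E2B}$ form an equivalence of categories $\mathbf{Bsys}\simeq\mathbf{Esys}_s$. -/

import Mathlib

open CategoryTheory

universe u

/-! ## B-frames and B-systems -/

/-- A B-frame: sets `B n` and `Bt n`, the latter standing for `B̃_{n+1}`, with maps
`ft : B_{n+1} → B_n` and `bd : B̃_{n+1} → B_{n+1}`, such that `B_0` is a singleton. -/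
structure BFrame where
  B : ℕ → Type u
  Bt : ℕ → Type u
  ft : ∀ {n : ℕ}, B (n + 1) → B n
  bd : ∀ {n : ℕ}, Bt n → B (n + 1)
  root : B 0
  eq_root : ∀ X : B 0, X = root

namespace BFrame

/-- The iterated map `ft^m : B_{n+m} → B_n`. -/
def ftn (F : BFrame.{u}) {n : ℕ} : (m : ℕ) → F.B (n + m) → F.B n
  | 0, Y => Y
  | m + 1, Y => F.ftn m (F.ft Y)

/-- Homomorphisms of B-frames. -/
structure Hom (F G : BFrame.{u}) where
  ob : ∀ {n : ℕ}, F.B n → G.B n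
  tm : ∀ {n : ℕ}, F.Bt n → G.Bt n
  ft_ob : ∀ {n : ℕ} (X : F.B (n + 1)), G.ft (ob X) = ob (F.ft X)
  bd_tm : ∀ {n : ℕ} (x : F.Bt n), G.bd (tm x) = ob (F.bd x)

/-- The identity homomorphism. -/
def Hom.id (F : BFrame.{u}) : Hom F F where
  ob X := X
  tm x := x
  ft_ob _ := rfl
  bd_tm _ := rfl

/-- Composition of homomorphisms, in diagrammatic order. -/
def Hom.comp {F G K : BFrame.{u}} (f : Hom F G) (g : Hom G K) : Hom F K where
  ob X := g.ob (f.ob X)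
  tm x := g.tm (f.tm x)
  ft_ob X := by rw [g.ft_ob, f.ft_ob]
  bd_tm x := by rw [g.bd_tm, f.bd_tm]

/-- The slice `F/X`, for `X ∈ B_n`: `(F/X)_m` consists of the `Y ∈ B_{n+m}` with `ft^m Y = X`, and
`(F̃/X)_{m+1}` of the `y ∈ B̃_{n+m+1}` with `ft^{m+1} (bd y) = X`. -/
def slice (F : BFrame.{u}) {n : ℕ} (X : F.B n) : BFrame.{u} where
  B m := {Y : F.B (n + m) // F.ftn m Y = X}
  Bt m := {y : F.Bt (n + m) // F.ftn (m + 1) (F.bd y) = X}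
  ft Y := ⟨F.ft Y.1, Y.2⟩
  bd y := ⟨F.bd y.1, y.2⟩
  root := ⟨X, rfl⟩
  eq_root Y := Subtype.ext Y.2

theorem Hom.ob_ftn {F G : BFrame.{u}} (H : Hom F G) {n : ℕ} (m : ℕ) (Y : F.B (n + m)) :
    G.ftn m (H.ob Y) = H.ob (F.ftn m Y) := by
  induction m with
  | zero => rfl
  | succ m ih => exact (congrArg (G.ftn m) (H.ft_ob Y)).trans (ih (F.ft Y))

/-- The homomorphism `H/X : F/X → G/H(X)`. -/
def Hom.slice {F G : BFrame.{u}} (H : Hom F G) {n : ℕ} (X : F.B n) :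
    Hom (F.slice X) (G.slice (H.ob X)) where
  ob {m} Y := ⟨H.ob Y.1, (H.ob_ftn m Y.1).trans (congrArg H.ob Y.2)⟩
  tm {m} y := ⟨H.tm y.1, (congrArg (G.ftn (m + 1)) (H.bd_tm y.1)).trans
    ((H.ob_ftn (m + 1) _).trans (congrArg H.ob y.2))⟩
  ft_ob Y := Subtype.ext (H.ft_ob Y.1)
  bd_tm y := Subtype.ext (H.bd_tm y.1)

/-- The identification of `F/X` with `F/X'` when `X = X'`. -/
def sliceCongr (F : BFrame.{u}) {n : ℕ} {X X' : F.B n} (h : X = X') :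
    Hom (F.slice X) (F.slice X') where
  ob Y := ⟨Y.1, Y.2.trans h⟩
  tm y := ⟨y.1, y.2.trans h⟩
  ft_ob _ := rfl
  bd_tm _ := rfl

/-- Transport in the family `B` along an equality of indices. -/
def castB (F : BFrame.{u}) {a b : ℕ} (h : a = b) (X : F.B a) : F.B b := h ▸ X

/-- Transport in the family `Bt` along an equality of indices. -/
def castBt (F : BFrame.{u}) {a b : ℕ} (h : a = b) (x : F.Bt a) : F.Bt b := h ▸ x

theorem ft_castB (F : BFrame.{u}) {a b : ℕ} (h : a = b) (X : F.B (a + 1)) :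
    F.ft (F.castB (congrArg (· + 1) h) X) = F.castB h (F.ft X) := by
  subst h; rfl

theorem bd_castBt (F : BFrame.{u}) {a b : ℕ} (h : a = b) (x : F.Bt a) :
    F.bd (F.castBt h x) = F.castB (congrArg (· + 1) h) (F.bd x) := by
  subst h; rfl

theorem slice_ftn_val (F : BFrame.{u}) {n : ℕ} (X : F.B n) {m : ℕ} (j : ℕ)
    (Z : (F.slice X).B (m + j)) :
    ((F.slice X).ftn j Z).1 = F.ftn j (F.castB (Nat.add_assoc n m j).symm Z.1) := by
  induction j with
  | zero => rfl
  | succ j ih =>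
    refine (ih ((F.slice X).ft Z)).trans ?_
    exact congrArg (F.ftn j) (F.ft_castB (Nat.add_assoc n m j).symm Z.1).symm

theorem ftn_ftn (F : BFrame.{u}) {n m : ℕ} (j : ℕ) (Z : F.B (n + m + j)) :
    F.ftn (m + j) (F.castB (Nat.add_assoc n m j) Z) = F.ftn m (F.ftn j Z) := by
  induction j with
  | zero => rfl
  | succ j ih =>
    refine Eq.trans ?_ (ih (F.ft Z))
    exact congrArg (F.ftn (m + j)) (F.ft_castB (Nat.add_assoc n m j) Z)

theorem castB_castB (F : BFrame.{u}) {a b c : ℕ} (h : a = b) (h' : b = c) (X : F.B a) :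
    F.castB h' (F.castB h X) = F.castB (h.trans h') X := by
  subst h; subst h'; rfl

/-- The isomorphism `(F/X)/Y → F/Y`, which is the identity on elements. -/
def sliceDown (F : BFrame.{u}) {n : ℕ} {X : F.B n} {m : ℕ} (Y : (F.slice X).B m) :
    Hom ((F.slice X).slice Y) (F.slice Y.1) where
  ob {j} Z := ⟨F.castB (Nat.add_assoc n m j).symm Z.1.1,
    (F.slice_ftn_val X j Z.1).symm.trans (congrArg Subtype.val Z.2)⟩
  tm {j} z := ⟨F.castBt (Nat.add_assoc n m j).symm z.1.1,
    (congrArg (F.ftn (j + 1)) (F.bd_castBt (Nat.add_assoc n m j).symm z.1.1)).trans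
      ((F.slice_ftn_val X (j + 1) ((F.slice X).bd z.1)).symm.trans (congrArg Subtype.val z.2))⟩
  ft_ob {j} Z := Subtype.ext (F.ft_castB (Nat.add_assoc n m j).symm Z.1.1)
  bd_tm {j} z := Subtype.ext (F.bd_castBt (Nat.add_assoc n m j).symm z.1.1)

/-- The inverse isomorphism `F/Y → (F/X)/Y`. -/
def sliceUp (F : BFrame.{u}) {n : ℕ} {X : F.B n} {m : ℕ} (Y : (F.slice X).B m) :
    Hom (F.slice Y.1) ((F.slice X).slice Y) where
  ob {j} Z := ⟨⟨F.castB (Nat.add_assoc n m j) Z.1,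
      (F.ftn_ftn j Z.1).trans ((congrArg (F.ftn m) Z.2).trans Y.2)⟩,
    Subtype.ext ((F.slice_ftn_val X j _).trans
      ((congrArg (F.ftn j) (F.castB_castB _ _ Z.1)).trans Z.2))⟩
  tm {j} z := ⟨⟨F.castBt (Nat.add_assoc n m j) z.1,
      (congrArg (F.ftn (m + j + 1)) (F.bd_castBt (Nat.add_assoc n m j) z.1)).trans
        ((F.ftn_ftn (j + 1) (F.bd z.1)).trans ((congrArg (F.ftn m) z.2).trans Y.2))⟩,
    Subtype.ext ((F.slice_ftn_val X (j + 1) _).trans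
      ((congrArg (F.ftn (j + 1)) ((congrArg (F.castB _)
        (F.bd_castBt (Nat.add_assoc n m j) z.1)).trans (F.castB_castB _ _ (F.bd z.1)))).trans
          z.2))⟩
  ft_ob {j} Z := Subtype.ext (Subtype.ext (F.ft_castB (Nat.add_assoc n m j) Z.1))
  bd_tm {j} z := Subtype.ext (Subtype.ext (F.bd_castBt (Nat.add_assoc n m j) z.1))

end BFrame

/-- A pre-B-system: a B-frame with a substitution structure `S`, a weakening structure `W` and
generic elements `δ`. -/
structure PreBSystem extends BFrame.{u} where
  S : ∀ {n : ℕ} (x : Bt n), BFrame.Hom (toBFrame.slice (bd x)) (toBFrame.slice (ft (bd x)))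
  W : ∀ {n : ℕ} (X : B (n + 1)), BFrame.Hom (toBFrame.slice (ft X)) (toBFrame.slice X)
  δ : ∀ {n : ℕ}, B (n + 1) → Bt (n + 1)
  bd_δ : ∀ {n : ℕ} (X : B (n + 1)),
    bd (δ X) = ((W X).ob (n := 1) (⟨X, rfl⟩ : (toBFrame.slice (ft X)).B 1)).1

namespace PreBSystem

open BFrame

theorem ft_bd_δ (F : PreBSystem.{u}) {n : ℕ} (X : F.B (n + 1)) : F.ft (F.bd (F.δ X)) = X :=
  (congrArg F.ft (F.bd_δ X)).trans
    ((F.W X).ob (n := 1) (⟨X, rfl⟩ : (F.toBFrame.slice (F.ft X)).B 1)).2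

/-- The slice of a pre-B-system, via the isomorphisms `(F/X)/Y ≅ F/Y`. -/
abbrev slice (F : PreBSystem.{u}) {n : ℕ} (X : F.B n) : PreBSystem.{u} where
  toBFrame := F.toBFrame.slice X
  S x := ((F.sliceDown _).comp (F.S x.1)).comp (F.sliceUp ((F.toBFrame.slice X).ft
    ((F.toBFrame.slice X).bd x)))
  W Y := ((F.sliceDown _).comp (F.W Y.1)).comp (F.sliceUp Y)
  δ {m} Y := ⟨F.δ Y.1, (congrArg (F.ftn (m + 1)) (F.ft_bd_δ Y.1)).trans Y.2⟩
  bd_δ Y := Subtype.ext (F.bd_δ Y.1)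

/-- `H` preserves the substitution structure: for all `x`, the square formed by `S_x`, `S_{H(x)}`,
`H/bd(x)` and `H/ft(bd(x))` commutes. -/
def PreservesSub {F G : PreBSystem.{u}} (H : Hom F.toBFrame G.toBFrame) : Prop :=
  ∀ {n : ℕ} (x : F.Bt n),
    ((H.slice (F.bd x)).comp (G.sliceCongr (H.bd_tm x).symm)).comp (G.S (H.tm x)) =
      ((F.S x).comp (H.slice (F.ft (F.bd x)))).comp
        (G.sliceCongr ((H.ft_ob (F.bd x)).symm.trans (congrArg G.ft (H.bd_tm x).symm)))

/-- `H` preserves the weakening structure: for all `X`, the square formed by `W_X`, `W_{H(X)}`,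
`H/ft(X)` and `H/X` commutes. -/
def PreservesWk {F G : PreBSystem.{u}} (H : Hom F.toBFrame G.toBFrame) : Prop :=
  ∀ {n : ℕ} (X : F.B (n + 1)),
    ((H.slice (F.ft X)).comp (G.sliceCongr (H.ft_ob X).symm)).comp (G.W (H.ob X)) =
      (F.W X).comp (H.slice X)

/-- `H` preserves the generic elements. -/
def PreservesGen {F G : PreBSystem.{u}} (H : Hom F.toBFrame G.toBFrame) : Prop :=
  ∀ {n : ℕ} (X : F.B (n + 1)), H.tm (F.δ X) = G.δ (H.ob X)

/-- Pre-B-homomorphisms. -/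
structure IsHom {F G : PreBSystem.{u}} (H : Hom F.toBFrame G.toBFrame) : Prop where
  sub : PreservesSub H
  wk : PreservesWk H
  gen : PreservesGen H

end PreBSystem

open BFrame in
/-- A B-system: a pre-B-system in which all `S_x` and `W_X` are pre-B-homomorphisms, and which
satisfies `S_x ∘ W_{bd(x)} = id`, `S_x(δ(bd(x))) = x` and `S_{δ(X)} ∘ W_X/X = id`. -/
structure BSystem extends PreBSystem.{u} where
  S_isHom : ∀ {n : ℕ} (x : Bt n), PreBSystem.IsHom (F := toPreBSystem.slice (bd x))
    (G := toPreBSystem.slice (ft (bd x))) (S x)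
  W_isHom : ∀ {n : ℕ} (X : B (n + 1)), PreBSystem.IsHom (F := toPreBSystem.slice (ft X))
    (G := toPreBSystem.slice X) (W X)
  W_comp_S : ∀ {n : ℕ} (x : Bt n), (W (bd x)).comp (S x) = Hom.id (toBFrame.slice (ft (bd x)))
  S_δ : ∀ {n : ℕ} (x : Bt n), ((S x).tm (n := 0)
    (⟨δ (bd x), toPreBSystem.ft_bd_δ (bd x)⟩ : (toBFrame.slice (bd x)).Bt 0)).1 = x
  W_slice_comp_S_δ : ∀ {n : ℕ} (X : B (n + 1)),
    (((((toBFrame.sliceUp (X := ft X) (m := 1) ⟨X, rfl⟩).comp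
      ((W X).slice (n := 1) ⟨X, rfl⟩)).comp (toBFrame.sliceDown _)).comp
        (toBFrame.sliceCongr (bd_δ X).symm)).comp (S (δ X))).comp
          (toBFrame.sliceCongr (toPreBSystem.ft_bd_δ X)) = Hom.id (toBFrame.slice X)

namespace BFrame

/-! ### The total spaces of a B-frame -/

/-- The disjoint union of the sets `B_n`; this is the set of nodes of the underlying rooted tree. -/
abbrev Ob (F : BFrame.{u}) : Type u := Σ n : ℕ, F.B n

/-- The disjoint union of the sets `B̃_{n+1}`. -/
abbrev Tm (F : BFrame.{u}) : Type u := Σ n : ℕ, F.Bt n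

variable {F G K : BFrame.{u}}

def Hom.total (H : Hom F G) (Z : F.Ob) : G.Ob := ⟨Z.1, H.ob Z.2⟩
def Hom.totalT (H : Hom F G) (z : F.Tm) : G.Tm := ⟨z.1, H.tm z.2⟩

theorem Hom.ext_total {H L : Hom F G} (h : ∀ Z, H.total Z = L.total Z)
    (h' : ∀ z, H.totalT z = L.totalT z) : H = L := by
  cases H with | mk a b c d =>
  cases L with | mk a' b' c' d' =>
  have e : @a = @a' := by
    funext n X; exact eq_of_heq (Sigma.mk.inj (h ⟨n, X⟩)).2
  have e' : @b = @b' := by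
    funext n X; exact eq_of_heq (Sigma.mk.inj (h' ⟨n, X⟩)).2
  subst e; subst e'; rfl

/-- The parent of a node (the root is its own parent). -/
def par : F.Ob → F.Ob
  | ⟨0, X⟩ => ⟨0, X⟩
  | ⟨n + 1, X⟩ => ⟨n, F.ft X⟩

def bdT (z : F.Tm) : F.Ob := ⟨z.1 + 1, F.bd z.2⟩

/-- `Z` lies over `X` in the tree. -/
def Ov (X Z : F.Ob) : Prop := X.1 ≤ Z.1 ∧ par^[Z.1 - X.1] Z = X

theorem par_fst (Z : F.Ob) : (par Z).1 = Z.1 - 1 := by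
  rcases Z with ⟨_ | n, X⟩ <;> rfl

theorem par_iter_fst (Z : F.Ob) (m : ℕ) : (par^[m] Z).1 = Z.1 - m := by
  induction m generalizing Z with
  | zero => rfl
  | succ m ih => rw [Function.iterate_succ_apply, ih, par_fst]; omega

theorem ov_refl (X : F.Ob) : Ov X X := ⟨le_rfl, by simp⟩

theorem ov_iff {X Z : F.Ob} : Ov X Z ↔ ∃ m, m ≤ Z.1 ∧ par^[m] Z = X := by
  constructor
  · exact fun h => ⟨_, Nat.sub_le _ _, h.2⟩
  · rintro ⟨m, hm, rfl⟩
    refine ⟨by rw [par_iter_fst]; omega, ?_⟩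
    rw [par_iter_fst]; congr 1; omega

theorem Ov.trans {X Y Z : F.Ob} (h : Ov X Y) (h' : Ov Y Z) : Ov X Z := by
  rw [ov_iff] at *
  obtain ⟨m, hm, rfl⟩ := h'
  obtain ⟨k, hk, rfl⟩ := h
  rw [par_iter_fst] at hk
  exact ⟨k + m, by omega, by rw [Function.iterate_add_apply]⟩

theorem ov_par (X : F.Ob) (h : 0 < X.1) : Ov (par X) X := ov_iff.2 ⟨1, h, rfl⟩

theorem Ov.eq {X Z : F.Ob} (h : Ov X Z) (h' : Z.1 ≤ X.1) : Z = X := by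
  obtain ⟨h1, h2⟩ := h
  rw [Nat.sub_eq_zero_of_le h'] at h2
  exact h2

/-- `Z` lies strictly over `X`. -/
def SOv (X Z : F.Ob) : Prop := 0 < Z.1 ∧ Ov X (par Z)

theorem SOv.ov {X Z : F.Ob} (h : SOv X Z) : Ov X Z := h.2.trans (ov_par Z h.1)

theorem SOv.lt {X Z : F.Ob} (h : SOv X Z) : X.1 < Z.1 := by
  have := h.2.1; have := h.1; rw [par_fst] at *; omega

theorem Ov.sov {X Z : F.Ob} (h : Ov X Z) (h' : X.1 < Z.1) : SOv X Z := by
  refine ⟨by omega, ?_⟩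
  obtain ⟨h1, h2⟩ := h
  refine ov_iff.2 ⟨Z.1 - X.1 - 1, by rw [par_fst]; omega, ?_⟩
  rw [← Function.iterate_succ_apply]
  rw [show (Z.1 - X.1 - 1).succ = Z.1 - X.1 by omega]; exact h2

theorem SOv.trans {X Y Z : F.Ob} (h : Ov X Y) (h' : SOv Y Z) : SOv X Z := ⟨h'.1, h.trans h'.2⟩
theorem SOv.trans' {X Y Z : F.Ob} (h : SOv X Y) (h' : Ov Y Z) : SOv X Z :=
  (h.ov.trans h').sov (lt_of_lt_of_le h.lt h'.1)

theorem par_iter_mk {n : ℕ} (m : ℕ) (Y : F.B (n + m)) :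
    par^[m] (⟨n + m, Y⟩ : F.Ob) = ⟨n, F.ftn m Y⟩ := by
  induction m with
  | zero => rfl
  | succ m ih => exact ih (F.ft Y)

/-- The inclusion of the nodes of a slice. -/
def inc {n : ℕ} {X : F.B n} (Z : (F.slice X).Ob) : F.Ob := ⟨n + Z.1, Z.2.1⟩
def incT {n : ℕ} {X : F.B n} (z : (F.slice X).Tm) : F.Tm := ⟨n + z.1, z.2.1⟩

theorem inc_injective {n : ℕ} {X : F.B n} : Function.Injective (inc (X := X)) := by
  rintro ⟨m, Y⟩ ⟨m', Y'⟩ h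
  have h1 : m = m' := Nat.add_left_cancel (congrArg Sigma.fst h)
  subst h1
  have h2 := eq_of_heq (Sigma.mk.inj h).2
  exact congrArg (Sigma.mk m) (Subtype.ext h2)

theorem incT_injective {n : ℕ} {X : F.B n} : Function.Injective (incT (X := X)) := by
  rintro ⟨m, Y⟩ ⟨m', Y'⟩ h
  have h1 : m = m' := Nat.add_left_cancel (congrArg Sigma.fst h)
  subst h1
  have h2 := eq_of_heq (Sigma.mk.inj h).2
  exact congrArg (Sigma.mk m) (Subtype.ext h2)

theorem ov_inc {n : ℕ} {X : F.B n} (Z : (F.slice X).Ob) : Ov ⟨n, X⟩ (inc Z) := by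
  refine ov_iff.2 ⟨Z.1, Nat.le_add_left _ _, ?_⟩
  exact (par_iter_mk _ _).trans (by rw [Z.2.2])

theorem exists_inc {n : ℕ} {X : F.B n} {Z : F.Ob} (h : Ov ⟨n, X⟩ Z) :
    ∃ Z' : (F.slice X).Ob, inc Z' = Z := by
  obtain ⟨k, Z⟩ := Z
  obtain ⟨h1, h2⟩ := h
  obtain ⟨m, rfl⟩ := Nat.exists_eq_add_of_le h1
  dsimp only at h2
  rw [Nat.add_sub_cancel_left, par_iter_mk] at h2
  exact ⟨⟨m, Z, eq_of_heq (Sigma.mk.inj h2).2⟩, rfl⟩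

theorem exists_incT {n : ℕ} {X : F.B n} {z : F.Tm} (h : SOv ⟨n, X⟩ (bdT z)) :
    ∃ z' : (F.slice X).Tm, incT z' = z := by
  obtain ⟨k, z⟩ := z
  have h0 := h.lt
  obtain ⟨h1, h2⟩ := h.2
  obtain ⟨m, rfl⟩ := Nat.exists_eq_add_of_le h1
  change par^[n + m - n] (⟨n + m, F.ft (F.bd z)⟩ : F.Ob) = _ at h2
  rw [Nat.add_sub_cancel_left, par_iter_mk] at h2
  exact ⟨⟨m, z, eq_of_heq (Sigma.mk.inj h2).2⟩, rfl⟩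

theorem bdT_incT {n : ℕ} {X : F.B n} (z : (F.slice X).Tm) : bdT (incT z) = inc (bdT z) := rfl

theorem sov_incT {n : ℕ} {X : F.B n} (z : (F.slice X).Tm) : SOv ⟨n, X⟩ (bdT (incT z)) :=
  (ov_inc (bdT z)).sov (by change n < n + z.1 + 1; omega)

theorem par_inc {n : ℕ} {X : F.B n} (Z : (F.slice X).Ob) (h : 0 < Z.1) :
    inc (par Z) = par (inc Z) := by
  rcases Z with ⟨_ | m, Z⟩
  · exact absurd h (lt_irrefl _)
  · rfl

theorem total_par (H : Hom F G) (Z : F.Ob) : H.total (par Z) = par (H.total Z) := by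
  rcases Z with ⟨_ | m, Z⟩
  · rfl
  · exact congrArg (Sigma.mk m) (H.ft_ob Z).symm

theorem total_bdT (H : Hom F G) (z : F.Tm) : H.total (bdT z) = bdT (H.totalT z) :=
  congrArg (Sigma.mk (z.1 + 1)) (H.bd_tm z.2).symm

@[simp] theorem total_comp (H : Hom F G) (L : Hom G K) (Z : F.Ob) :
    (H.comp L).total Z = L.total (H.total Z) := rfl
@[simp] theorem totalT_comp (H : Hom F G) (L : Hom G K) (Z : F.Tm) :
    (H.comp L).totalT Z = L.totalT (H.totalT Z) := rfl
@[simp] theorem total_id (Z : F.Ob) : (Hom.id F).total Z = Z := rfl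
@[simp] theorem totalT_id (Z : F.Tm) : (Hom.id F).totalT Z = Z := rfl
@[simp] theorem inc_slice (H : Hom F G) {n : ℕ} (X : F.B n) (Z : (F.slice X).Ob) :
    inc ((H.slice X).total Z) = H.total (inc Z) := rfl
@[simp] theorem incT_slice (H : Hom F G) {n : ℕ} (X : F.B n) (Z : (F.slice X).Tm) :
    incT ((H.slice X).totalT Z) = H.totalT (incT Z) := rfl
@[simp] theorem inc_sliceCongr {n : ℕ} {X X' : F.B n} (h : X = X') (Z : (F.slice X).Ob) :
    inc ((F.sliceCongr h).total Z) = inc Z := rfl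
@[simp] theorem incT_sliceCongr {n : ℕ} {X X' : F.B n} (h : X = X') (Z : (F.slice X).Tm) :
    incT ((F.sliceCongr h).totalT Z) = incT Z := rfl

theorem mk_castB {a b : ℕ} (h : a = b) (X : F.B a) : (⟨b, F.castB h X⟩ : F.Ob) = ⟨a, X⟩ := by
  subst h; rfl
theorem mk_castBt {a b : ℕ} (h : a = b) (X : F.Bt a) : (⟨b, F.castBt h X⟩ : F.Tm) = ⟨a, X⟩ := by
  subst h; rfl

@[simp] theorem inc_sliceDown {n : ℕ} {X : F.B n} {m : ℕ} (Y : (F.slice X).B m)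
    (Z : ((F.slice X).slice Y).Ob) : inc ((F.sliceDown Y).total Z) = inc (inc Z) := mk_castB _ _
@[simp] theorem incT_sliceDown {n : ℕ} {X : F.B n} {m : ℕ} (Y : (F.slice X).B m)
    (Z : ((F.slice X).slice Y).Tm) : incT ((F.sliceDown Y).totalT Z) = incT (incT Z) :=
  mk_castBt _ _
@[simp] theorem inc_sliceUp {n : ℕ} {X : F.B n} {m : ℕ} (Y : (F.slice X).B m)
    (Z : (F.slice Y.1).Ob) : inc (inc ((F.sliceUp Y).total Z)) = inc Z := mk_castB _ _
@[simp] theorem incT_sliceUp {n : ℕ} {X : F.B n} {m : ℕ} (Y : (F.slice X).B m)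
    (Z : (F.slice Y.1).Tm) : incT (incT ((F.sliceUp Y).totalT Z)) = incT Z := mk_castBt _ _

open Classical in
/-- The action on nodes of a homomorphism between slices, extended by the identity. -/
noncomputable def act {n k : ℕ} {X : F.B n} {Y : F.B k} (H : Hom (F.slice X) (F.slice Y))
    (Z : F.Ob) : F.Ob :=
  if h : ∃ Z' : (F.slice X).Ob, inc Z' = Z then inc (H.total h.choose) else Z

open Classical in
/-- The action on terms of a homomorphism between slices, extended by the identity. -/
noncomputable def actT {n k : ℕ} {X : F.B n} {Y : F.B k} (H : Hom (F.slice X) (F.slice Y))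
    (z : F.Tm) : F.Tm :=
  if h : ∃ z' : (F.slice X).Tm, incT z' = z then incT (H.totalT h.choose) else z

theorem act_inc {n k : ℕ} {X : F.B n} {Y : F.B k} (H : Hom (F.slice X) (F.slice Y))
    (Z : (F.slice X).Ob) : act H (inc Z) = inc (H.total Z) := by
  have h : ∃ Z' : (F.slice X).Ob, inc Z' = inc Z := ⟨Z, rfl⟩
  rw [act, dif_pos h, inc_injective h.choose_spec]

theorem actT_incT {n k : ℕ} {X : F.B n} {Y : F.B k} (H : Hom (F.slice X) (F.slice Y))
    (Z : (F.slice X).Tm) : actT H (incT Z) = incT (H.totalT Z) := by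
  have h : ∃ Z' : (F.slice X).Tm, incT Z' = incT Z := ⟨Z, rfl⟩
  rw [actT, dif_pos h, incT_injective h.choose_spec]

end BFrame

namespace PreBSystem

open BFrame

/-- `S_x` on nodes; meaningful on the nodes over `bd(x)`. -/
noncomputable def sub (B : PreBSystem.{u}) (x : B.Tm) (Z : B.Ob) : B.Ob := act (B.S x.2) Z

/-- `S_x` on terms. -/
noncomputable def subT (B : PreBSystem.{u}) (x : B.Tm) (z : B.Tm) : B.Tm := actT (B.S x.2) z

/-- `W_X` on nodes; meaningful on the nodes over `ft(X)`. -/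
noncomputable def wk (B : PreBSystem.{u}) : B.Ob → B.Ob → B.Ob
  | ⟨0, _⟩, Z => Z
  | ⟨_ + 1, X⟩, Z => act (B.W X) Z

/-- `W_X` on terms. -/
noncomputable def wkT (B : PreBSystem.{u}) : B.Ob → B.Tm → B.Tm
  | ⟨0, _⟩, z => z
  | ⟨_ + 1, X⟩, z => actT (B.W X) z

/-- The generic element `δ(X)` of a node `X` different from the root. -/
def gen (B : PreBSystem.{u}) : (X : B.Ob) → 0 < X.1 → B.Tm
  | ⟨0, _⟩, h => absurd h (lt_irrefl 0)
  | ⟨n + 1, X⟩, _ => ⟨n + 1, B.δ X⟩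

/-- The elementwise form of the assertion that the maps `f` and `g` define a pre-B-homomorphism
from the slice over `X` to the slice over `Y`. -/
structure IsOp {A B : PreBSystem.{u}} (X : A.Ob) (Y : B.Ob) (f : A.Ob → B.Ob) (g : A.Tm → B.Tm) :
    Prop where
  ov : ∀ {Z}, Ov X Z → Ov Y (f Z)
  lvl : ∀ {Z}, Ov X Z → (f Z).1 + X.1 = Z.1 + Y.1
  par : ∀ {Z}, SOv X Z → f (par Z) = par (f Z)
  bd : ∀ {z}, SOv X (bdT z) → bdT (g z) = f (bdT z)
  sub : ∀ {x Z}, SOv X (bdT x) → Ov (bdT x) Z → f (A.sub x Z) = B.sub (g x) (f Z)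
  subT : ∀ {x z}, SOv X (bdT x) → SOv (bdT x) (bdT z) → g (A.subT x z) = B.subT (g x) (g z)
  wk : ∀ {U Z}, SOv X U → Ov (BFrame.par U) Z → f (A.wk U Z) = B.wk (f U) (f Z)
  wkT : ∀ {U z}, SOv X U → SOv (BFrame.par U) (bdT z) → g (A.wkT U z) = B.wkT (f U) (g z)
  gen : ∀ {U} (h : SOv X U) (h' : 0 < (f U).1), g (A.gen U h.1) = B.gen (f U) h'

section

variable {A B C : PreBSystem.{u}}

theorem sub_inc {n : ℕ} (x : B.Bt n) (Z : (B.toBFrame.slice (B.bd x)).Ob) :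
    B.sub ⟨n, x⟩ (inc Z) = inc ((B.S x).total Z) := act_inc _ _
theorem subT_incT {n : ℕ} (x : B.Bt n) (z : (B.toBFrame.slice (B.bd x)).Tm) :
    B.subT ⟨n, x⟩ (incT z) = incT ((B.S x).totalT z) := actT_incT _ _
theorem wk_inc {n : ℕ} (X : B.B (n + 1)) (Z : (B.toBFrame.slice (B.ft X)).Ob) :
    B.wk ⟨n + 1, X⟩ (inc Z) = inc ((B.W X).total Z) := act_inc _ _
theorem wkT_incT {n : ℕ} (X : B.B (n + 1)) (z : (B.toBFrame.slice (B.ft X)).Tm) :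
    B.wkT ⟨n + 1, X⟩ (incT z) = incT ((B.W X).totalT z) := actT_incT _ _

theorem slice_sub {n : ℕ} {X : B.B n} {m : ℕ} (x : (B.slice X).Bt m)
    (Z : ((B.slice X).toBFrame.slice ((B.slice X).bd x)).Ob) :
    inc (inc (((B.slice X).S x).total Z)) = B.sub (incT ⟨m, x⟩) (inc (inc Z)) := by
  refine (inc_sliceUp ((B.toBFrame.slice X).ft ((B.toBFrame.slice X).bd x))
    ((B.S x.1).total ((B.sliceDown ((B.toBFrame.slice X).bd x)).total Z))).trans ?_
  refine (sub_inc x.1 _).symm.trans ?_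
  exact congrArg (B.sub _) (inc_sliceDown _ _)

theorem slice_subT {n : ℕ} {X : B.B n} {m : ℕ} (x : (B.slice X).Bt m)
    (z : ((B.slice X).toBFrame.slice ((B.slice X).bd x)).Tm) :
    incT (incT (((B.slice X).S x).totalT z)) = B.subT (incT ⟨m, x⟩) (incT (incT z)) := by
  refine (incT_sliceUp ((B.toBFrame.slice X).ft ((B.toBFrame.slice X).bd x))
    ((B.S x.1).totalT ((B.sliceDown ((B.toBFrame.slice X).bd x)).totalT z))).trans ?_
  refine (subT_incT x.1 _).symm.trans ?_
  exact congrArg (B.subT _) (incT_sliceDown _ _)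

theorem slice_wk {n : ℕ} {X : B.B n} {m : ℕ} (U : (B.slice X).B (m + 1))
    (Z : ((B.slice X).toBFrame.slice ((B.slice X).ft U)).Ob) :
    inc (inc (((B.slice X).W U).total Z)) = B.wk (inc ⟨m + 1, U⟩) (inc (inc Z)) := by
  refine (inc_sliceUp U
    ((B.W (n := n + m) U.1).total ((B.sliceDown ((B.toBFrame.slice X).ft U)).total Z))).trans ?_
  refine (wk_inc (n := n + m) U.1 _).symm.trans ?_
  exact congrArg (B.wk _) (inc_sliceDown _ _)

theorem slice_wkT {n : ℕ} {X : B.B n} {m : ℕ} (U : (B.slice X).B (m + 1))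
    (z : ((B.slice X).toBFrame.slice ((B.slice X).ft U)).Tm) :
    incT (incT (((B.slice X).W U).totalT z)) = B.wkT (inc ⟨m + 1, U⟩) (incT (incT z)) := by
  refine (incT_sliceUp U
    ((B.W (n := n + m) U.1).totalT ((B.sliceDown ((B.toBFrame.slice X).ft U)).totalT z))).trans ?_
  refine (wkT_incT (n := n + m) U.1 _).symm.trans ?_
  exact congrArg (B.wkT _) (incT_sliceDown _ _)

theorem slice_gen {n : ℕ} {X : B.B n} {m : ℕ} (U : (B.slice X).B (m + 1)) :
    incT ⟨m + 1, (B.slice X).δ U⟩ = B.gen (inc ⟨m + 1, U⟩) (Nat.succ_pos _) := rfl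

theorem exists_inc_inc {n : ℕ} {X : B.B n} (U : (B.slice X).Ob) {Z : B.Ob} (h : Ov (inc U) Z) :
    ∃ Z' : ((B.slice X).toBFrame.slice U.2).Ob, inc (inc Z') = Z := by
  obtain ⟨Z', rfl⟩ := exists_inc h
  exact ⟨(B.sliceUp U.2).total Z', inc_sliceUp _ _⟩

theorem exists_incT_incT {n : ℕ} {X : B.B n} (U : (B.slice X).Ob) {z : B.Tm}
    (h : SOv (inc U) (bdT z)) :
    ∃ z' : ((B.slice X).toBFrame.slice U.2).Tm, incT (incT z') = z := by
  obtain ⟨z', rfl⟩ := exists_incT h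
  exact ⟨(B.sliceUp U.2).totalT z', incT_sliceUp _ _⟩

/-- A pre-B-homomorphism between slices satisfies the elementwise conditions. -/
theorem IsHom.isOp_slice {n k : ℕ} {X : A.B n} {Y : B.B k}
    {H : Hom (A.slice X).toBFrame (B.slice Y).toBFrame}
    (hH : IsHom H) {f : A.Ob → B.Ob} {g : A.Tm → B.Tm}
    (hf : ∀ Z : (A.slice X).Ob, f (inc Z) = inc (H.total Z))
    (hg : ∀ z : (A.slice X).Tm, g (incT z) = incT (H.totalT z)) :
    IsOp (A := A) (B := B) ⟨n, X⟩ ⟨k, Y⟩ f g where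
  ov {Z} h := by
    obtain ⟨Z, rfl⟩ := exists_inc h
    rw [hf]; exact ov_inc _
  lvl {Z} h := by
    obtain ⟨Z, rfl⟩ := exists_inc h
    rw [hf]; change k + Z.1 + n = n + Z.1 + k; omega
  par {Z} h := by
    obtain ⟨Z, rfl⟩ := exists_inc h.ov
    have hZ : 0 < Z.1 := by have := h.lt; change n < n + Z.1 at this; omega
    rw [← par_inc Z hZ, hf, hf, total_par, par_inc]; exact hZ
  bd {z} h := by
    obtain ⟨z, rfl⟩ := exists_incT h
    rw [bdT_incT, hf, hg, bdT_incT, total_bdT]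
  sub {x Z} h h' := by
    obtain ⟨x, rfl⟩ := exists_incT h
    obtain ⟨Z, rfl⟩ := exists_inc_inc (bdT x) h'
    have := congrArg (fun K => inc (inc (K.total Z))) (hH.sub x.2)
    refine Eq.trans ?_ (this.symm.trans ?_)
    · refine (congrArg f (slice_sub x.2 Z).symm).trans (hf _)
    · refine (slice_sub (H.tm x.2) (((H.slice _).comp
        ((B.slice Y).sliceCongr (H.bd_tm x.2).symm)).total Z)).trans ?_
      rw [hf, hg]; rfl
  subT {x Z} h h' := by
    obtain ⟨x, rfl⟩ := exists_incT h
    obtain ⟨Z, rfl⟩ := exists_incT_incT (bdT x) h'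
    have := congrArg (fun K => incT (incT (K.totalT Z))) (hH.sub x.2)
    refine Eq.trans ?_ (this.symm.trans ?_)
    · refine (congrArg g (slice_subT x.2 Z).symm).trans (hg _)
    · refine (slice_subT (H.tm x.2) (((H.slice _).comp
        ((B.slice Y).sliceCongr (H.bd_tm x.2).symm)).totalT Z)).trans ?_
      rw [hg, hg]; rfl
  wk {U Z} h h' := by
    obtain ⟨⟨m, U⟩, rfl⟩ := exists_inc h.ov
    obtain _ | m := m
    · exact absurd h.lt (lt_irrefl _)
    obtain ⟨Z, rfl⟩ := exists_inc_inc (BFrame.par ⟨m + 1, U⟩) h'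
    have := congrArg (fun K => inc (inc (K.total Z))) (hH.wk U)
    refine Eq.trans ?_ (this.symm.trans ?_)
    · refine (congrArg f (slice_wk U Z).symm).trans (hf _)
    · refine (slice_wk (H.ob U) (((H.slice _).comp
        ((B.slice Y).sliceCongr (H.ft_ob U).symm)).total Z)).trans ?_
      rw [hf, hf]; rfl
  wkT {U Z} h h' := by
    obtain ⟨⟨m, U⟩, rfl⟩ := exists_inc h.ov
    obtain _ | m := m
    · exact absurd h.lt (lt_irrefl _)
    obtain ⟨Z, rfl⟩ := exists_incT_incT (BFrame.par ⟨m + 1, U⟩) h'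
    have := congrArg (fun K => incT (incT (K.totalT Z))) (hH.wk U)
    refine Eq.trans ?_ (this.symm.trans ?_)
    · refine (congrArg g (slice_wkT U Z).symm).trans (hg _)
    · refine (slice_wkT (H.ob U) (((H.slice _).comp
        ((B.slice Y).sliceCongr (H.ft_ob U).symm)).totalT Z)).trans ?_
      rw [hf, hg]; rfl
  gen {U} h h' := by
    obtain ⟨⟨m, U⟩, rfl⟩ := exists_inc h.ov
    obtain _ | m := m
    · exact absurd h.lt (lt_irrefl _)
    have e : f (inc ⟨m + 1, U⟩) = inc ⟨m + 1, H.ob U⟩ := hf _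
    have e2 : B.gen (f (inc ⟨m + 1, U⟩)) h' = B.gen (inc ⟨m + 1, H.ob U⟩) (Nat.succ_pos _) := by
      congr 1
    refine Eq.trans ?_ e2.symm
    exact (hg ⟨m + 1, (A.slice X).δ U⟩).trans (congrArg (fun w => incT ⟨m + 1, w⟩) (hH.gen U))

/-- A pre-B-homomorphism satisfies the elementwise conditions. -/
theorem IsHom.isOp {H : Hom A.toBFrame B.toBFrame} (hH : IsHom H) :
    IsOp (A := A) (B := B) ⟨0, A.root⟩ ⟨0, B.root⟩ H.total H.totalT where
  ov {Z} _ := by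
    refine ov_iff.2 ⟨Z.1, le_rfl, ?_⟩
    have : (BFrame.par^[Z.1] (H.total Z)).1 = 0 := by rw [par_iter_fst]; exact Nat.sub_self _
    generalize BFrame.par^[Z.1] (H.total Z) = V at this
    obtain ⟨n, V⟩ := V
    obtain rfl : n = 0 := this
    rw [B.eq_root V]
  lvl _ := rfl
  par _ := total_par _ _
  bd _ := (total_bdT _ _).symm
  sub {x Z} h h' := by
    obtain ⟨Z, rfl⟩ := exists_inc h'
    have := congrArg (fun K => inc (K.total Z)) (hH.sub x.2)
    refine Eq.trans ?_ (this.symm.trans ?_)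
    · exact congrArg H.total (sub_inc x.2 Z)
    · exact (sub_inc (H.tm x.2) (((H.slice _).comp
        (B.sliceCongr (H.bd_tm x.2).symm)).total Z)).symm
  subT {x Z} h h' := by
    obtain ⟨Z, rfl⟩ := exists_incT h'
    have := congrArg (fun K => incT (K.totalT Z)) (hH.sub x.2)
    refine Eq.trans ?_ (this.symm.trans ?_)
    · exact congrArg H.totalT (subT_incT x.2 Z)
    · exact (subT_incT (H.tm x.2) (((H.slice _).comp
        (B.sliceCongr (H.bd_tm x.2).symm)).totalT Z)).symm
  wk {U Z} h h' := by
    obtain ⟨_ | m, U⟩ := U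
    · exact absurd h.1 (lt_irrefl _)
    obtain ⟨Z, rfl⟩ := exists_inc h'
    have := congrArg (fun K => inc (K.total Z)) (hH.wk U)
    refine Eq.trans ?_ (this.symm.trans ?_)
    · exact congrArg H.total (wk_inc U Z)
    · exact (wk_inc (H.ob U) (((H.slice _).comp
        (B.sliceCongr (H.ft_ob U).symm)).total Z)).symm
  wkT {U Z} h h' := by
    obtain ⟨_ | m, U⟩ := U
    · exact absurd h.1 (lt_irrefl _)
    obtain ⟨Z, rfl⟩ := exists_incT h'
    have := congrArg (fun K => incT (K.totalT Z)) (hH.wk U)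
    refine Eq.trans ?_ (this.symm.trans ?_)
    · exact congrArg H.totalT (wkT_incT U Z)
    · exact (wkT_incT (H.ob U) (((H.slice _).comp
        (B.sliceCongr (H.ft_ob U).symm)).totalT Z)).symm
  gen {U} h h' := by
    obtain ⟨_ | m, U⟩ := U
    · exact absurd h.1 (lt_irrefl _)
    exact congrArg (Sigma.mk _) (hH.gen U)

end

end PreBSystem

namespace PreBSystem

open BFrame

variable {A B C : PreBSystem.{u}}

namespace IsOp

variable {X : A.Ob} {Y : B.Ob} {V : C.Ob} {f : A.Ob → B.Ob} {g : A.Tm → B.Tm}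
  {f' : B.Ob → C.Ob} {g' : B.Tm → C.Tm}

theorem base (h : IsOp X Y f g) : f X = Y :=
  (h.ov (ov_refl X)).eq (by have := h.lvl (ov_refl X); omega)

theorem sov (h : IsOp X Y f g) {Z : A.Ob} (hZ : SOv X Z) : SOv Y (f Z) :=
  (h.ov hZ.ov).sov (by have := h.lvl hZ.ov; have := hZ.lt; omega)

theorem sov' (h : IsOp X Y f g) {z : A.Tm} (hz : SOv X (bdT z)) : SOv Y (bdT (g z)) := by
  rw [h.bd hz]; exact h.sov hz

theorem iter (h : IsOp X Y f g) {Z : A.Ob} (m : ℕ) (hZ : Ov X (BFrame.par^[m] Z)) (hm : m ≤ Z.1) :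
    f (BFrame.par^[m] Z) = BFrame.par^[m] (f Z) := by
  induction m generalizing Z with
  | zero => rfl
  | succ m ih =>
    rw [Function.iterate_succ_apply] at *
    have h1 : SOv X Z := by
      refine ⟨by omega, hZ.trans (ov_iff.2 ⟨m, by rw [par_fst]; omega, rfl⟩)⟩
    rw [ih hZ (by rw [par_fst]; omega), h.par h1]
    rfl

/-- Compatibility with the relation of lying over. -/
theorem ov_ov (h : IsOp X Y f g) {Z Z' : A.Ob} (hZ : Ov X Z) (hZ' : Ov Z Z') : Ov (f Z) (f Z') := by
  obtain ⟨m, hm, rfl⟩ := ov_iff.1 hZ'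
  refine ov_iff.2 ⟨m, ?_, (h.iter m hZ hm).symm⟩
  have e1 := h.lvl hZ
  have e2 := h.lvl (hZ.trans hZ')
  have := hZ.1
  rw [par_iter_fst] at *
  omega

theorem sov_sov (h : IsOp X Y f g) {Z Z' : A.Ob} (hZ : Ov X Z) (hZ' : SOv Z Z') :
    SOv (f Z) (f Z') := by
  refine (h.ov_ov hZ hZ'.ov).sov ?_
  have e1 := h.lvl hZ
  have e2 := h.lvl (hZ.trans hZ'.ov)
  have := hZ'.lt
  omega

theorem lvl_lvl (h : IsOp X Y f g) {Z Z' : A.Ob} (hZ : Ov X Z) (hZ' : Ov X Z') :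
    (f Z').1 + Z.1 = Z'.1 + (f Z).1 := by
  have e1 := h.lvl hZ
  have e2 := h.lvl hZ'
  omega

theorem restrict (h : IsOp X Y f g) {U : A.Ob} (hU : Ov X U) : IsOp U (f U) f g where
  ov hZ := h.ov_ov hU hZ
  lvl hZ := h.lvl_lvl hU (hU.trans hZ)
  par hZ := h.par (.trans hU hZ)
  bd hz := h.bd (.trans hU hz)
  sub hx hZ := h.sub (.trans hU hx) hZ
  subT hx hZ := h.subT (.trans hU hx) hZ
  wk hx hZ := h.wk (.trans hU hx) hZ
  wkT hx hZ := h.wkT (.trans hU hx) hZ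
  gen hV h' := h.gen (.trans hU hV) h'

theorem id (X : A.Ob) : IsOp X X (fun Z => Z) (fun z => z) where
  ov hZ := hZ
  lvl _ := rfl
  par _ := rfl
  bd _ := rfl
  sub _ _ := rfl
  subT _ _ := rfl
  wk _ _ := rfl
  wkT _ _ := rfl
  gen _ _ := rfl

theorem comp (h : IsOp X Y f g) (h' : IsOp Y V f' g') :
    IsOp X V (fun Z => f' (f Z)) (fun z => g' (g z)) where
  ov hZ := h'.ov (h.ov hZ)
  lvl hZ := by have e1 := h'.lvl (h.ov hZ); have e2 := h.lvl hZ; omega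
  par hZ := by rw [h.par hZ, h'.par (h.sov hZ)]
  bd hz := by rw [h'.bd (h.sov' hz), h.bd hz]
  sub hx hZ := by
    rw [h.sub hx hZ, h'.sub (h.sov' hx)]
    rw [h.bd hx]; exact h.ov_ov hx.ov hZ
  subT {x z} hx hz := by
    have e : bdT (g z) = f (bdT z) := h.bd (.trans hx.ov hz)
    rw [h.subT hx hz, h'.subT (h.sov' hx)]
    rw [h.bd hx, e]; exact h.sov_sov hx.ov hz
  wk hx hZ := by
    rw [h.wk hx hZ, h'.wk (h.sov hx)]
    rw [← h.par hx]; exact h.ov_ov hx.2 hZ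
  wkT {U z} hx hz := by
    have e : bdT (g z) = f (bdT z) := h.bd (.trans hx.2 hz)
    rw [h.wkT hx hz, h'.wkT (h.sov hx)]
    rw [← h.par hx, e]; exact h.sov_sov hx.2 hz
  gen hV h'' := by
    rw [h.gen hV (h.sov hV).1, h'.gen (h.sov hV) h'']

end IsOp

end PreBSystem

namespace BSystem

open BFrame PreBSystem

section

variable (B : BSystem.{u})

theorem isOp_sub (x : B.Tm) : IsOp (A := B.toPreBSystem) (B := B.toPreBSystem) (bdT x) (par (bdT x))
    (B.sub x) (B.subT x) :=
  (B.S_isHom x.2).isOp_slice (fun Z => sub_inc x.2 Z) (fun Z => subT_incT x.2 Z)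

theorem isOp_wk (X : B.Ob) (h : 0 < X.1) : IsOp (A := B.toPreBSystem) (B := B.toPreBSystem)
    (par X) X (B.wk X) (B.wkT X) := by
  obtain ⟨_ | n, X⟩ := X
  · exact absurd h (lt_irrefl 0)
  exact (B.W_isHom X).isOp_slice (fun Z => wk_inc X Z) (fun Z => wkT_incT X Z)

theorem sub_wk (x : B.Tm) {Z : B.Ob} (h : Ov (par (bdT x)) Z) :
    B.sub x (B.wk (bdT x) Z) = Z := by
  obtain ⟨Z, rfl⟩ := exists_inc h
  refine (congrArg (B.sub x) (wk_inc (B.bd x.2) Z)).trans ?_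
  refine (sub_inc x.2 _).trans ?_
  exact congrArg (fun K => inc (K.total Z)) (B.W_comp_S x.2)

theorem subT_wkT (x : B.Tm) {z : B.Tm} (h : SOv (par (bdT x)) (bdT z)) :
    B.subT x (B.wkT (bdT x) z) = z := by
  obtain ⟨z, rfl⟩ := exists_incT h
  refine (congrArg (B.subT x) (wkT_incT (B.bd x.2) z)).trans ?_
  refine (subT_incT x.2 _).trans ?_
  exact congrArg (fun K => incT (K.totalT z)) (B.W_comp_S x.2)

theorem subT_gen (x : B.Tm) : B.subT x (B.gen (bdT x) (Nat.succ_pos _)) = x := by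
  refine (subT_incT x.2 ⟨0, ⟨B.δ (B.bd x.2), B.ft_bd_δ _⟩⟩).trans ?_
  exact congrArg (Sigma.mk x.1) (B.S_δ x.2)

theorem bdT_gen (X : B.Ob) (h : 0 < X.1) : bdT (B.gen X h) = B.wk X X := by
  obtain ⟨_ | n, X⟩ := X
  · exact absurd h (lt_irrefl 0)
  refine Eq.trans ?_ (wk_inc X ⟨1, ⟨X, rfl⟩⟩).symm
  exact congrArg (Sigma.mk (n + 2)) (B.bd_δ X)

theorem par_bdT_gen (X : B.Ob) (h : 0 < X.1) : par (bdT (B.gen X h)) = X := by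
  rw [bdT_gen]
  have hw := B.isOp_wk X h
  have hX : SOv (par X) X := ⟨h, ov_refl _⟩
  rw [← hw.par hX, hw.base]

theorem sub_gen_wk (X : B.Ob) (h : 0 < X.1) {Z : B.Ob} (hZ : Ov X Z) :
    B.sub (B.gen X h) (B.wk X Z) = Z := by
  obtain ⟨_ | n, X⟩ := X
  · exact absurd h (lt_irrefl 0)
  obtain ⟨Z, rfl⟩ := exists_inc hZ
  have e := congrArg (fun K => inc (K.total Z)) (B.W_slice_comp_S_δ X)
  refine Eq.trans ?_ e
  let Y : (B.toBFrame.slice (B.ft X)).B 1 := ⟨X, rfl⟩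
  let Z1 := (((B.W X).slice (n := 1) Y)).total ((B.toBFrame.sliceUp Y).total Z)
  let Z2 := (B.toBFrame.sliceCongr (B.bd_δ X).symm).total ((B.toBFrame.sliceDown _).total Z1)
  change _ = inc ((B.S (B.δ X)).total Z2)
  refine Eq.trans ?_ (sub_inc (B.δ X) Z2)
  refine congrArg (B.sub _) ?_
  have e1 : inc Z2 = inc (inc Z1) := inc_sliceDown _ _
  rw [e1]
  refine Eq.trans ?_ (wk_inc X (inc ((B.toBFrame.sliceUp Y).total Z)))
  exact congrArg (B.wk _) (inc_sliceUp Y Z).symm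

theorem subT_gen_wkT (X : B.Ob) (h : 0 < X.1) {z : B.Tm} (hz : SOv X (bdT z)) :
    B.subT (B.gen X h) (B.wkT X z) = z := by
  obtain ⟨_ | n, X⟩ := X
  · exact absurd h (lt_irrefl 0)
  obtain ⟨Z, rfl⟩ := exists_incT hz
  have e := congrArg (fun K => incT (K.totalT Z)) (B.W_slice_comp_S_δ X)
  refine Eq.trans ?_ e
  let Y : (B.toBFrame.slice (B.ft X)).B 1 := ⟨X, rfl⟩
  let Z1 := (((B.W X).slice (n := 1) Y)).totalT ((B.toBFrame.sliceUp Y).totalT Z)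
  let Z2 := (B.toBFrame.sliceCongr (B.bd_δ X).symm).totalT ((B.toBFrame.sliceDown _).totalT Z1)
  change _ = incT ((B.S (B.δ X)).totalT Z2)
  refine Eq.trans ?_ (subT_incT (B.δ X) Z2)
  refine congrArg (B.subT _) ?_
  have e1 : incT Z2 = incT (incT Z1) := incT_sliceDown _ _
  rw [e1]
  refine Eq.trans ?_ (wkT_incT X (incT ((B.toBFrame.sliceUp Y).totalT Z)))
  exact congrArg (B.wkT _) (incT_sliceUp Y Z).symm

end

/-! ### Iterated terms, substitution, weakening and generic elements -/

section

variable (B : BSystem.{u})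

/-- Iterated substitution: `S_{(t, x)} = S_x ∘ S_t`, where the list `x :: t` stands for `(t, x)`. -/
noncomputable def subs : List B.Tm → B.Ob → B.Ob
  | [], Z => Z
  | x :: t, Z => B.sub x (subs t Z)

/-- Iterated substitution on terms. -/
noncomputable def subsT : List B.Tm → B.Tm → B.Tm
  | [], z => z
  | x :: t, z => B.subT x (subsT t z)

/-- `B.IsTm X k t` says that the list `t` is an element of the set `T(X, k)`, where `T(X, 0)` has
only the empty list and `T(X, k + 1)` consists of the pairs `(t, x)`, written `x :: t`, of some
`t ∈ T(ft(X), k)` and some `x` with `bd(x) = S_t(X)`. -/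
def IsTm : B.Ob → ℕ → List B.Tm → Prop
  | _, 0, t => t = []
  | X, k + 1, t => ∃ (x : B.Tm) (t' : List B.Tm), t = x :: t' ∧ IsTm (par X) k t' ∧
      bdT x = B.subs t' X

/-- Iterated weakening: `W_X^{k+1} = W_X ∘ W_{ft(X)}^k`. -/
noncomputable def wks : B.Ob → ℕ → B.Ob → B.Ob
  | _, 0, Z => Z
  | X, k + 1, Z => B.wk X (wks (par X) k Z)

/-- Iterated weakening on terms. -/
noncomputable def wksT : B.Ob → ℕ → B.Tm → B.Tm
  | _, 0, z => z
  | X, k + 1, z => B.wkT X (wksT (par X) k z)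

/-- The list of generic elements of `(X, k)`: `id_{(X, k+1)} = (W_X(id_{(ft(X), k)}), δ(X))`. -/
noncomputable def gens : B.Ob → ℕ → List B.Tm
  | _, 0 => []
  | ⟨0, _⟩, _ + 1 => []
  | ⟨n + 1, X⟩, k + 1 => ⟨n + 1, B.δ X⟩ :: (gens ⟨n, B.ft X⟩ k).map (B.wkT ⟨n + 1, X⟩)

theorem gens_succ (X : B.Ob) (h : 0 < X.1) (k : ℕ) :
    B.gens X (k + 1) = B.gen X h :: (B.gens (par X) k).map (B.wkT X) := by
  obtain ⟨_ | n, X⟩ := X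
  · exact absurd h (lt_irrefl 0)
  rfl

variable {B}

/-- The operation of iterated substitution is elementwise a pre-B-homomorphism. -/
theorem isOp_subs {X : B.Ob} {k : ℕ} (hk : k ≤ X.1) {t : List B.Tm} (ht : B.IsTm X k t) :
    IsOp (A := B.toPreBSystem) (B := B.toPreBSystem) X (par^[k] X) (B.subs t) (B.subsT t) := by
  induction k generalizing X t with
  | zero => obtain rfl : t = [] := ht; exact IsOp.id X
  | succ k ih =>
    obtain ⟨x, t, rfl, ht', hx⟩ := ht
    have h1 := ih (by rw [par_fst]; omega) ht'
    have hX : SOv (par X) X := ⟨by omega, ov_refl _⟩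
    have h2 := h1.restrict (U := X) hX.ov
    have e : par (bdT x) = par^[k] (par X) := by rw [hx, ← h1.par hX, h1.base]
    have h3 := B.isOp_sub x
    rw [e, hx] at h3
    exact h2.comp h3

theorem isOp_wks {X : B.Ob} {k : ℕ} (hk : k ≤ X.1) :
    IsOp (A := B.toPreBSystem) (B := B.toPreBSystem) (par^[k] X) X (B.wks X k) (B.wksT X k) := by
  induction k generalizing X with
  | zero => exact IsOp.id X
  | succ k ih =>
    exact (ih (X := par X) (by rw [par_fst]; omega)).comp (B.isOp_wk X (by omega))

theorem IsTm.mem {X : B.Ob} {k : ℕ} (hk : k ≤ X.1) {t : List B.Tm} (ht : B.IsTm X k t) :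
    ∀ x ∈ t, SOv (par^[k] X) (bdT x) := by
  induction k generalizing X t with
  | zero => obtain rfl : t = [] := ht; simp
  | succ k ih =>
    have hs := isOp_subs hk ht
    obtain ⟨x, t, rfl, ht', hx⟩ := ht
    intro y hy
    have hk' : k ≤ (par X).1 := by rw [par_fst]; omega
    rcases List.mem_cons.1 hy with rfl | hy
    · have hX : SOv (par X) X := ⟨by omega, ov_refl _⟩
      have h1 := isOp_subs hk' ht'
      rw [hx]; exact h1.sov hX
    · exact ih hk' ht' y hy

theorem IsTm.length {X : B.Ob} {k : ℕ} {t : List B.Tm} (ht : B.IsTm X k t) : t.length = k := by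
  induction k generalizing X t with
  | zero => obtain rfl : t = [] := ht; rfl
  | succ k ih => obtain ⟨x, t, rfl, ht', hx⟩ := ht; simp [ih ht']

section

variable {A : BSystem.{u}} {X : A.Ob} {Y : B.Ob} {f : A.Ob → B.Ob} {g : A.Tm → B.Tm}

theorem op_subs (h : IsOp (A := A.toPreBSystem) (B := B.toPreBSystem) X Y f g)
    {U : A.Ob} {k : ℕ} (hk : k ≤ U.1) {t : List A.Tm} (ht : A.IsTm U k t)
    (hU : Ov X (par^[k] U)) {Z : A.Ob} (hZ : Ov U Z) :
    f (A.subs t Z) = B.subs (t.map g) (f Z) := by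
  induction k generalizing U t with
  | zero => obtain rfl : t = [] := ht; rfl
  | succ k ih =>
    have hm := ht.mem hk
    obtain ⟨x, t, rfl, ht', hx⟩ := ht
    have hk' : k ≤ (par U).1 := by rw [par_fst]; omega
    have hZ' : Ov (par U) Z := (ov_par U (by omega)).trans hZ
    have h1 := isOp_subs hk' ht'
    change f (A.sub x (A.subs t Z)) = B.sub (g x) (B.subs (t.map g) (f Z))
    rw [← ih hk' ht' hU hZ', h.sub (.trans hU (hm x (by simp)))]
    rw [hx]; exact h1.ov_ov (ov_par U (by omega)) hZ

theorem op_subsT (h : IsOp (A := A.toPreBSystem) (B := B.toPreBSystem) X Y f g)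
    {U : A.Ob} {k : ℕ} (hk : k ≤ U.1) {t : List A.Tm} (ht : A.IsTm U k t)
    (hU : Ov X (par^[k] U)) {z : A.Tm} (hZ : SOv U (bdT z)) :
    g (A.subsT t z) = B.subsT (t.map g) (g z) := by
  induction k generalizing U t with
  | zero => obtain rfl : t = [] := ht; rfl
  | succ k ih =>
    have hm := ht.mem hk
    obtain ⟨x, t, rfl, ht', hx⟩ := ht
    have hk' : k ≤ (par U).1 := by rw [par_fst]; omega
    have hZ' : SOv (par U) (bdT z) := .trans (ov_par U (by omega)) hZ
    have h1 := isOp_subs hk' ht'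
    change g (A.subT x (A.subsT t z)) = B.subT (g x) (B.subsT (t.map g) (g z))
    rw [← ih hk' ht' hU hZ', h.subT (.trans hU (hm x (by simp)))]
    rw [hx, h1.bd hZ']; exact h1.sov_sov (ov_par U (by omega)) hZ

theorem op_isTm (h : IsOp (A := A.toPreBSystem) (B := B.toPreBSystem) X Y f g)
    {U : A.Ob} {k : ℕ} (hk : k ≤ U.1) {t : List A.Tm} (ht : A.IsTm U k t)
    (hU : Ov X (par^[k] U)) : B.IsTm (f U) k (t.map g) := by
  induction k generalizing U t with
  | zero => obtain rfl : t = [] := ht; rfl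
  | succ k ih =>
    have hm := ht.mem hk
    obtain ⟨x, t, rfl, ht', hx⟩ := ht
    have hk' : k ≤ (par U).1 := by rw [par_fst]; omega
    have hXU : SOv X U := ⟨by omega, hU.trans (ov_iff.2 ⟨k, hk', rfl⟩)⟩
    refine ⟨g x, t.map g, rfl, ?_, ?_⟩
    · rw [← h.par hXU]; exact ih hk' ht' hU
    · rw [h.bd (.trans hU (hm x (by simp))), hx]
      exact op_subs h hk' ht' hU (ov_par U (by omega))

theorem op_wks (h : IsOp (A := A.toPreBSystem) (B := B.toPreBSystem) X Y f g)
    {U : A.Ob} {k : ℕ} (hk : k ≤ U.1) (hU : Ov X (par^[k] U)) {Z : A.Ob} (hZ : Ov (par^[k] U) Z) :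
    f (A.wks U k Z) = B.wks (f U) k (f Z) := by
  induction k generalizing U with
  | zero => rfl
  | succ k ih =>
    have hk' : k ≤ (par U).1 := by rw [par_fst]; omega
    have hXU : SOv X U := ⟨by omega, hU.trans (ov_iff.2 ⟨k, hk', rfl⟩)⟩
    change f (A.wk U (A.wks (par U) k Z)) = B.wk (f U) (B.wks (par (f U)) k (f Z))
    rw [h.wk hXU ((isOp_wks hk').ov hZ), ih hk' hU hZ, h.par hXU]

theorem op_wksT (h : IsOp (A := A.toPreBSystem) (B := B.toPreBSystem) X Y f g)
    {U : A.Ob} {k : ℕ} (hk : k ≤ U.1) (hU : Ov X (par^[k] U)) {z : A.Tm}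
    (hZ : SOv (par^[k] U) (bdT z)) :
    g (A.wksT U k z) = B.wksT (f U) k (g z) := by
  induction k generalizing U with
  | zero => rfl
  | succ k ih =>
    have hk' : k ≤ (par U).1 := by rw [par_fst]; omega
    have hXU : SOv X U := ⟨by omega, hU.trans (ov_iff.2 ⟨k, hk', rfl⟩)⟩
    change g (A.wkT U (A.wksT (par U) k z)) = B.wkT (f U) (B.wksT (par (f U)) k (g z))
    rw [h.wkT hXU ((isOp_wks hk').sov' hZ), ih hk' hU hZ, h.par hXU]

end

theorem subs_wks {X : B.Ob} {k : ℕ} (hk : k ≤ X.1) {t : List B.Tm} (ht : B.IsTm X k t) {Z : B.Ob}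
    (hZ : Ov (par^[k] X) Z) : B.subs t (B.wks X k Z) = Z := by
  induction k generalizing X t with
  | zero => obtain rfl : t = [] := ht; rfl
  | succ k ih =>
    obtain ⟨x, t, rfl, ht', hx⟩ := ht
    have hk' : k ≤ (par X).1 := by rw [par_fst]; omega
    have hX : SOv (par X) X := ⟨by omega, ov_refl _⟩
    have h1 := isOp_subs hk' ht'
    change B.sub x (B.subs t (B.wk X (B.wks (par X) k Z))) = Z
    rw [h1.wk hX ((isOp_wks hk').ov hZ), ih hk' ht' hZ, ← hx, B.sub_wk]
    rw [hx, ← h1.par hX, h1.base]; exact hZ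

theorem subsT_wksT {X : B.Ob} {k : ℕ} (hk : k ≤ X.1) {t : List B.Tm} (ht : B.IsTm X k t) {z : B.Tm}
    (hZ : SOv (par^[k] X) (bdT z)) : B.subsT t (B.wksT X k z) = z := by
  induction k generalizing X t with
  | zero => obtain rfl : t = [] := ht; rfl
  | succ k ih =>
    obtain ⟨x, t, rfl, ht', hx⟩ := ht
    have hk' : k ≤ (par X).1 := by rw [par_fst]; omega
    have hX : SOv (par X) X := ⟨by omega, ov_refl _⟩
    have h1 := isOp_subs hk' ht'
    change B.subT x (B.subsT t (B.wkT X (B.wksT (par X) k z))) = z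
    rw [h1.wkT hX ((isOp_wks hk').sov' hZ), ih hk' ht' hZ, ← hx, B.subT_wkT]
    rw [hx, ← h1.par hX, h1.base]; exact hZ

theorem par_iter_wks {X : B.Ob} {k : ℕ} (hk : k ≤ X.1) : par^[k] (B.wks X k X) = X := by
  have hw := isOp_wks hk
  have hkX : Ov (par^[k] X) X := ov_iff.2 ⟨k, hk, rfl⟩
  have e := hw.lvl_lvl (ov_refl _) hkX
  rw [hw.base, par_iter_fst] at e
  have e2 := (hw.ov hkX).2
  rwa [show (B.wks X k X).1 - X.1 = k by omega] at e2

/-- Simultaneous construction of the generic elements of `(X, k)`, together with the identity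
`S_{id_{(X,k)}} ∘ W_X^k/X = id`. -/
theorem gens_spec {X : B.Ob} {k : ℕ} (hk : k ≤ X.1) :
    B.IsTm (B.wks X k X) k (B.gens X k) ∧
      (∀ {Z}, Ov X Z → B.subs (B.gens X k) (B.wks X k Z) = Z) ∧
      (∀ {z}, SOv X (bdT z) → B.subsT (B.gens X k) (B.wksT X k z) = z) := by
  induction k generalizing X with
  | zero => exact ⟨rfl, fun _ => rfl, fun _ => rfl⟩
  | succ k ih =>
    have hk' : k ≤ (par X).1 := by rw [par_fst]; omega
    have h0 : 0 < X.1 := by omega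
    have hX : SOv (par X) X := ⟨h0, ov_refl _⟩
    obtain ⟨i1, i2, i3⟩ := ih hk'
    have hw := isOp_wks hk'
    have hkX : Ov (par^[k] (par X)) (par X) := ov_iff.2 ⟨k, hk', rfl⟩
    have hs1 := hw.sov (Z := X) (.trans hkX hX)
    have hw1 := hw.ov hkX
    have hW := B.isOp_wk X h0
    have hkP : k ≤ (B.wks (par X) k (par X)).1 := hk'.trans hw1.1
    have hit : par^[k] (B.wks (par X) k (par X)) = par X := par_iter_wks hk'
    have e1 : ∀ {Z}, Ov (par X) Z →
        B.subs ((B.gens (par X) k).map (B.wkT X)) (B.wks X (k + 1) Z) = B.wk X Z := by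
      intro Z hZ
      change B.subs ((B.gens (par X) k).map (B.wkT X)) (B.wk X (B.wks (par X) k Z)) = B.wk X Z
      rw [← op_subs hW hkP i1 (by rw [hit]; exact ov_refl _) (hw.ov_ov hkX hZ), i2 hZ]
    have e2 : ∀ {z}, SOv (par X) (bdT z) →
        B.subsT ((B.gens (par X) k).map (B.wkT X)) (B.wksT X (k + 1) z) = B.wkT X z := by
      intro z hz
      change B.subsT ((B.gens (par X) k).map (B.wkT X)) (B.wkT X (B.wksT (par X) k z)) = B.wkT X z
      rw [← op_subsT hW hkP i1 (by rw [hit]; exact ov_refl _), i3 hz]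
      rw [hw.bd (.trans hkX hz)]; exact hw.sov_sov hkX hz
    refine ⟨⟨B.gen X h0, (B.gens (par X) k).map (B.wkT X), B.gens_succ X h0 k, ?_, ?_⟩, ?_, ?_⟩
    · change B.IsTm (par (B.wk X (B.wks (par X) k X))) k _
      rw [← hW.par hs1, ← hw.par (.trans hkX hX)]
      exact op_isTm hW hkP i1 (by rw [hit]; exact ov_refl _)
    · rw [e1 hX.ov, bdT_gen]
    · intro Z hZ
      rw [B.gens_succ X h0 k]
      change B.sub _ (B.subs ((B.gens (par X) k).map (B.wkT X)) (B.wks X (k + 1) Z)) = Z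
      rw [e1 (hX.ov.trans hZ), B.sub_gen_wk X h0 hZ]
    · intro z hz
      rw [B.gens_succ X h0 k]
      change B.subT _ (B.subsT ((B.gens (par X) k).map (B.wkT X)) (B.wksT X (k + 1) z)) = z
      rw [e2 (.trans hX.ov hz), B.subT_gen_wkT X h0 hz]

theorem op_gens {A : BSystem.{u}} {X : A.Ob} {Y : B.Ob} {f : A.Ob → B.Ob} {g : A.Tm → B.Tm}
    (h : IsOp (A := A.toPreBSystem) (B := B.toPreBSystem) X Y f g)
    {U : A.Ob} {k : ℕ} (hk : k ≤ U.1) (hU : Ov X (par^[k] U)) :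
    (A.gens U k).map g = B.gens (f U) k := by
  induction k generalizing U with
  | zero => rfl
  | succ k ih =>
    have hk' : k ≤ (par U).1 := by rw [par_fst]; omega
    have hXU : SOv X U := ⟨by omega, hU.trans (ov_iff.2 ⟨k, hk', rfl⟩)⟩
    have h0 := (h.sov hXU).1
    have hw := isOp_wks hk'
    have hkU : Ov (par^[k] (par U)) (par U) := ov_iff.2 ⟨k, hk', rfl⟩
    have hkP : k ≤ (A.wks (par U) k (par U)).1 := hk'.trans (hw.ov hkU).1
    have hit : par^[k] (A.wks (par U) k (par U)) = par U := par_iter_wks hk'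
    rw [A.gens_succ U hXU.1, B.gens_succ (f U) h0, List.map_cons, h.gen hXU h0, ← h.par hXU,
      ← ih hk' hU, List.map_map, List.map_map]
    congr 1
    refine List.map_congr_left fun y hy => ?_
    have := (gens_spec hk').1.mem hkP y hy
    rw [hit] at this
    exact h.wkT hXU this

theorem subsT_gens {X : B.Ob} {k : ℕ} (hk : k ≤ X.1) {t : List B.Tm} (ht : B.IsTm X k t) :
    (B.gens X k).map (B.subsT t) = t := by
  induction k generalizing X t with
  | zero => obtain rfl : t = [] := ht; rfl
  | succ k ih =>
    obtain ⟨x, t, rfl, ht', hx⟩ := ht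
    have hk' : k ≤ (par X).1 := by rw [par_fst]; omega
    have hX : SOv (par X) X := ⟨by omega, ov_refl _⟩
    have h1 := isOp_subs hk' ht'
    have hw := isOp_wks hk'
    have hkU : Ov (par^[k] (par X)) (par X) := ov_iff.2 ⟨k, hk', rfl⟩
    have hkP : k ≤ (B.wks (par X) k (par X)).1 := hk'.trans (hw.ov hkU).1
    have hit : par^[k] (B.wks (par X) k (par X)) = par X := par_iter_wks hk'
    rw [B.gens_succ X hX.1, List.map_cons, List.map_map]
    congr 1
    · change B.subT x (B.subsT t _) = x
      rw [h1.gen hX (h1.sov hX).1]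
      refine Eq.trans ?_ (B.subT_gen x)
      congr 2
      exact hx.symm
    · conv_rhs => rw [← ih hk' ht']
      refine List.map_congr_left fun y hy => ?_
      have hy' := (gens_spec hk').1.mem hkP y hy
      rw [hit] at hy'
      change B.subT x (B.subsT t (B.wkT X y)) = B.subsT t y
      rw [h1.wkT hX hy', ← hx, B.subT_wkT]
      rw [hx, ← h1.par hX, h1.base]
      exact h1.sov' hy'

end

end BSystem

/-! ## E-systems -/

/-- A strict category with term structure: a family of sets `T f` indexed by its morphisms. -/
structure TermCat where
  Ob : Type u
  [cat : SmallCategory.{u} Ob]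
  T : ∀ {X Y : Ob}, (X ⟶ Y) → Type u

attribute [instance] TermCat.cat

/-- A functor with term structure. -/
structure TermFunctor (C D : TermCat.{u}) extends C.Ob ⥤ D.Ob where
  tm : ∀ {X Y : C.Ob} {f : X ⟶ Y}, C.T f → D.T (map f)

namespace TermCat

/-- The slice term structure on the strict slice category. -/
abbrev slice (C : TermCat.{u}) (Γ : C.Ob) : TermCat.{u} where
  Ob := Over Γ
  T {P Q : Over Γ} (f : P ⟶ Q) := C.T f.left

/-- The disjoint union of all the sets `T f`. -/
abbrev Term (C : TermCat.{u}) : Type u := Σ f : Arrow C.Ob, C.T f.hom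

/-- A term, as an element of the disjoint union. -/
abbrev mkTerm (C : TermCat.{u}) {X Y : C.Ob} (f : X ⟶ Y) (x : C.T f) : C.Term := ⟨Arrow.mk f, x⟩

end TermCat

namespace TermFunctor

variable {C D E : TermCat.{u}}

/-- The identity functor with term structure. -/
abbrev id (C : TermCat.{u}) : TermFunctor C C where
  toFunctor := 𝟭 C.Ob
  tm x := x

/-- Composition of functors with term structure, in diagrammatic order. -/
abbrev comp (F : TermFunctor C D) (G : TermFunctor D E) : TermFunctor C E where
  toFunctor := F.toFunctor ⋙ G.toFunctor
  tm x := G.tm (F.tm x)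

/-- The functor with term structure `F/Γ : C/Γ → D/F(Γ)`. -/
abbrev slice (F : TermFunctor C D) (Γ : C.Ob) :
    TermFunctor (C.slice Γ) (D.slice (F.obj Γ)) where
  toFunctor := Over.post F.toFunctor
  tm x := F.tm x

/-- The isomorphism `(C/Γ)/P → C/(Γ.P)`, which is the identity on terms. -/
abbrev sliceDown {Γ : C.Ob} (P : Over Γ) :
    TermFunctor ((C.slice Γ).slice P) (C.slice P.left) where
  toFunctor := Over.iteratedSliceForward P
  tm x := x

/-- The inverse isomorphism `C/(Γ.P) → (C/Γ)/P`. -/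
abbrev sliceUp {Γ : C.Ob} (P : Over Γ) :
    TermFunctor (C.slice P.left) ((C.slice Γ).slice P) where
  toFunctor := Over.iteratedSliceBackward P
  tm x := x

theorem sliceUp_comp_sliceDown {Γ : C.Ob} (P : Over Γ) :
    (sliceUp P).comp (sliceDown P) = TermFunctor.id (C.slice P.left) := rfl

theorem ext_arrow {F G : TermFunctor C D}
    (h : ∀ {X Y : C.Ob} (f : X ⟶ Y), Arrow.mk (F.map f) = Arrow.mk (G.map f))
    (h' : ∀ {X Y : C.Ob} (f : X ⟶ Y) (x : C.T f),
      D.mkTerm (F.map f) (F.tm x) = D.mkTerm (G.map f) (G.tm x)) : F = G := by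
  cases F with | mk F t =>
  cases G with | mk G t' =>
  obtain rfl : F = G := by
    refine CategoryTheory.Functor.ext (fun X => congrArg Comma.left (h (𝟙 X))) (fun X Y f => ?_)
    obtain ⟨_, _, e⟩ := (Arrow.mk_eq_mk_iff _ _).1 (h f)
    exact e
  congr 1
  funext X Y f x
  exact eq_of_heq (Sigma.mk.inj (h' f x)).2

theorem sliceUp_obj {Γ : C.Ob} (P : Over Γ) {L : C.Ob} (h : L ⟶ Γ) (l : L ⟶ P.left)
    (w : l ≫ P.hom = h) : (Over.iteratedSliceBackward P).obj (Over.mk l) =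
      Over.mk (Over.homMk l w : Over.mk h ⟶ P) := by
  subst w; rfl

theorem sliceUp_surj {Γ : C.Ob} (P : Over Γ) (X : Over P) :
    ∃ Y : Over P.left, (Over.iteratedSliceBackward P).obj Y = X :=
  ⟨Over.mk X.hom.left, sliceUp_obj P X.left.hom X.hom.left (Over.w X.hom)⟩

theorem sliceUp_one {Γ : C.Ob} (P : Over Γ) :
    (Over.iteratedSliceBackward P).obj (Over.mk (𝟙 P.left)) = Over.mk (𝟙 P) :=
  sliceUp_obj P P.hom (𝟙 P.left) (Category.id_comp _)

theorem sliceDown_comp_sliceUp {Γ : C.Ob} (P : Over Γ) :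
    (sliceDown P).comp (sliceUp P) = TermFunctor.id ((C.slice Γ).slice P) := by
  refine ext_arrow (fun {X Y} f => ?_) (fun {X Y} f x => ?_) <;>
  · obtain ⟨X, rfl⟩ := sliceUp_surj P X
    obtain ⟨Y, rfl⟩ := sliceUp_surj P Y
    rfl

end TermFunctor

/-- A pre-E-system: a strict category with term structure, equipped with a chosen terminal object,
a pre-substitution structure `S`, a pre-weakening structure `W`, and elements
`idt A ∈ T (W_A(A))`. -/
structure PreESystem extends TermCat.{u} where
  root : Ob
  root_isTerminal : Nonempty (Limits.IsTerminal root)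
  S : ∀ {Γ Δ : Ob} {A : Δ ⟶ Γ} (_ : T A), TermFunctor (toTermCat.slice Δ) (toTermCat.slice Γ)
  S_id : ∀ {Γ Δ : Ob} {A : Δ ⟶ Γ} (x : T A), (S x).obj (Over.mk (𝟙 Δ)) = Over.mk (𝟙 Γ)
  W : ∀ {Γ Δ : Ob} (_ : Δ ⟶ Γ), TermFunctor (toTermCat.slice Γ) (toTermCat.slice Δ)
  W_one : ∀ Γ : Ob, W (𝟙 Γ) = TermFunctor.id (toTermCat.slice Γ)
  W_comp : ∀ {Γ Δ Θ : Ob} (A : Δ ⟶ Γ) (P : Θ ⟶ Δ), W (P ≫ A) = (W A).comp (W P)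
  W_id : ∀ {Γ Δ : Ob} (A : Δ ⟶ Γ), (W A).obj (Over.mk (𝟙 Γ)) = Over.mk (𝟙 Δ)
  idt : ∀ {Γ Δ : Ob} (A : Δ ⟶ Γ), T ((W A).obj (Over.mk A)).hom

namespace PreESystem

open TermFunctor

/-- The slice of a pre-E-system, via the isomorphisms `(E/Γ)/P ≅ E/(Γ.P)`. -/
abbrev slice (E : PreESystem.{u}) (Γ : E.Ob) : PreESystem.{u} where
  toTermCat := E.toTermCat.slice Γ
  root := Over.mk (𝟙 Γ)
  root_isTerminal := ⟨Over.mkIdTerminal⟩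
  S {Q P A} x := ((sliceDown P).comp (E.S x)).comp (sliceUp Q)
  S_id {Q P A} x := by
    refine Eq.trans ?_ (sliceUp_one Q)
    exact congrArg (Over.iteratedSliceBackward Q).obj (E.S_id (A := A.left) x)
  W {Q P} A := ((sliceDown Q).comp (E.W A.left)).comp (sliceUp P)
  W_one Q := by
    refine Eq.trans ?_ (sliceDown_comp_sliceUp Q)
    exact congrArg (fun K => ((sliceDown Q).comp K).comp (sliceUp Q)) (E.W_one Q.left)
  W_comp {Q P R} A B := by
    exact congrArg (fun K => ((sliceDown Q).comp K).comp (sliceUp R)) (E.W_comp A.left B.left)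
  W_id {Q P} A := by
    refine Eq.trans ?_ (sliceUp_one P)
    exact congrArg (Over.iteratedSliceBackward P).obj (E.W_id A.left)
  idt A := E.idt A.left

variable {E D : PreESystem.{u}}

/-- Pre-substitution homomorphisms: `F/Γ ∘ S_x = S_{F(x)} ∘ F/(Γ.A)` for all `x ∈ T(A)`. -/
def PreservesSub (F : TermFunctor E.toTermCat D.toTermCat) : Prop :=
  ∀ {Γ Δ : E.Ob} {A : Δ ⟶ Γ} (x : E.T A),
    (E.S x).comp (F.slice Γ) = (F.slice Δ).comp (D.S (F.tm x))

/-- Pre-weakening homomorphisms: `F/(Γ.A) ∘ W_A = W_{F(A)} ∘ F/Γ`. -/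
def PreservesWk (F : TermFunctor E.toTermCat D.toTermCat) : Prop :=
  ∀ {Γ Δ : E.Ob} (A : Δ ⟶ Γ), (E.W A).comp (F.slice Δ) = (F.slice Γ).comp (D.W (F.map A))

/-- The condition `F(idt A) = idt F(A)`; it is stated in the disjoint union of all sets of terms,
as the two sides belong to `T (F (W_A(A)))` and to `T (W_{F(A)}(F(A)))`. -/
def PreservesIdt (F : TermFunctor E.toTermCat D.toTermCat) : Prop :=
  ∀ {Γ Δ : E.Ob} (A : Δ ⟶ Γ),
    D.mkTerm _ (F.tm (E.idt A)) = D.mkTerm _ (D.idt (F.map A))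

/-- Pre-E-homomorphisms. -/
structure IsHom (F : TermFunctor E.toTermCat D.toTermCat) : Prop where
  root : F.obj E.root = D.root
  sub : PreservesSub F
  wk : PreservesWk F
  idt : PreservesIdt F

end PreESystem

open TermFunctor in
/-- An E-system: a pre-E-system in which all `S_x` and `W_A` are pre-E-homomorphisms, and which
satisfies `S_x ∘ W_A = id`, `S_x(idt A) = x` and `S_{idt A} ∘ W_A/A = id`. In the second equation,
`idt A ∈ T (W_A(A))` is regarded as a term of the morphism `W_A(A) ⟶ 1` of the slice over
`Γ.A`; in the third one, `(E/Γ)/A` is identified with `E/(Γ.A)`, and similarly for `W_A(A)`. -/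
structure ESystem extends PreESystem.{u} where
  S_isHom : ∀ {Γ Δ : Ob} {A : Δ ⟶ Γ} (x : T A), PreESystem.IsHom (E := toPreESystem.slice Δ)
    (D := toPreESystem.slice Γ) (S x)
  W_isHom : ∀ {Γ Δ : Ob} (A : Δ ⟶ Γ), PreESystem.IsHom (E := toPreESystem.slice Γ)
    (D := toPreESystem.slice Δ) (W A)
  W_comp_S : ∀ {Γ Δ : Ob} {A : Δ ⟶ Γ} (x : T A),
    (W A).comp (S x) = TermFunctor.id (toTermCat.slice Γ)
  S_idt : ∀ {Γ Δ : Ob} {A : Δ ⟶ Γ} (x : T A),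
    toTermCat.mkTerm _ ((S x).tm (X := (W A).obj (Over.mk A)) (Y := Over.mk (𝟙 Δ))
      (f := Over.homMk ((W A).obj (Over.mk A)).hom (Category.comp_id _)) (idt A)) =
        toTermCat.mkTerm A x
  W_slice_comp_S_idt : ∀ {Γ Δ : Ob} (A : Δ ⟶ Γ),
    (((sliceUp (C := toTermCat) (Over.mk A)).comp ((W A).slice (Over.mk A))).comp
      (sliceDown ((W A).obj (Over.mk A)))).comp (S (idt A)) = TermFunctor.id (toTermCat.slice Δ)

/-! ### Stratifications -/

/-- Finite composable sequences of arrows `X = X_m ⟶ ⋯ ⟶ X_1 ⟶ X_0 = Y` along which the length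
`ℓ` decreases by one in each step. -/
inductive IndividualChain {C : Type u} [SmallCategory C] (ℓ : C → ℕ) : C → C → Type u
  | nil (X : C) : IndividualChain ℓ X X
  | cons {X X' Y : C} (f : X ⟶ X') (h : ℓ X = ℓ X' + 1) (p : IndividualChain ℓ X' Y) :
      IndividualChain ℓ X Y

/-- The composite of a chain. -/
def IndividualChain.composite {C : Type u} [SmallCategory C] {ℓ : C → ℕ} {X Y : C} :
    IndividualChain ℓ X Y → (X ⟶ Y)
  | .nil X => 𝟙 X
  | .cons f _ p => f ≫ p.composite

/-- A stratification of a strict category with chosen terminal object `one`: a functor `L` to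
`(ℕ, ≥)` such that `L(X) = 0` if and only if `X = one`; for `f : X ⟶ Y`, `L(X) = L(Y)` if and only
if `f` is an identity; and every `f : X ⟶ Y` with `L(X) = n + m + 1` and `L(Y) = n` has a unique
factorization `X = X_{m+1} ⟶ ⋯ ⟶ X_0 = Y` with `L(X_i) = n + i`. -/
structure Stratification (C : Type u) [SmallCategory C] (one : C) where
  L : C ⥤ ℕᵒᵈ
  eq_zero_iff : ∀ X : C, OrderDual.ofDual (L.obj X) = 0 ↔ X = one
  eq_iff : ∀ {X Y : C} (f : X ⟶ Y),
    OrderDual.ofDual (L.obj X) = OrderDual.ofDual (L.obj Y) ↔ ∃ h : X = Y, f = eqToHom h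
  factor : ∀ {X Y : C} (f : X ⟶ Y) (n m : ℕ), OrderDual.ofDual (L.obj X) = n + m + 1 →
    OrderDual.ofDual (L.obj Y) = n →
      ∃! p : IndividualChain (fun Z => OrderDual.ofDual (L.obj Z)) X Y, p.composite = f

namespace Stratification

variable {C : Type u} [SmallCategory C] {one : C}

/-- The length of an object. -/
def len (s : Stratification C one) (X : C) : ℕ := OrderDual.ofDual (s.L.obj X)

/-- The length of an object of a slice, for the induced stratification. -/
def sliceLen (s : Stratification C one) {Γ : C} (P : Over Γ) : ℕ := s.len P.left - s.len Γ

end Stratification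

/-- A stratified E-system: its underlying category is stratified, and the functors underlying all
`W_A` and `S_x` are stratified for the induced stratifications of the slices. -/
structure StratESystem extends ESystem.{u} where
  strat : Stratification Ob root
  S_strat : ∀ {Γ Δ : Ob} {A : Δ ⟶ Γ} (x : T A) (P : Over Δ),
    strat.sliceLen ((S x).obj P) = strat.sliceLen P
  W_strat : ∀ {Γ Δ : Ob} (A : Δ ⟶ Γ) (P : Over Γ),
    strat.sliceLen ((W A).obj P) = strat.sliceLen P

namespace StratESystem

/-- Stratified E-homomorphisms. -/
@[ext]
structure Hom (E D : StratESystem.{u}) where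
  toTermFunctor : TermFunctor E.toTermCat D.toTermCat
  isHom : PreESystem.IsHom (E := E.toPreESystem) (D := D.toPreESystem) toTermFunctor
  strat : ∀ X : E.Ob, D.strat.len (toTermFunctor.obj X) = E.strat.len X

end StratESystem

namespace TermFunctor

variable {C D : TermCat.{u}}

/-- The action on the disjoint union of all sets of terms. -/
abbrev onTerm (F : TermFunctor C D) (x : C.Term) : D.Term := D.mkTerm (F.map x.1.hom) (F.tm x.2)

theorem slice_comp {E : TermCat.{u}} (F : TermFunctor C D) (G : TermFunctor D E) (Γ : C.Ob) :
    (F.comp G).slice Γ = (F.slice Γ).comp (G.slice (F.obj Γ)) := rfl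

theorem slice_id (C : TermCat.{u}) (Γ : C.Ob) :
    (TermFunctor.id C).slice Γ = TermFunctor.id (C.slice Γ) := rfl

end TermFunctor

namespace PreESystem

theorem isHom_id (E : PreESystem.{u}) :
    IsHom (E := E) (D := E) (TermFunctor.id E.toTermCat) where
  root := rfl
  sub _ := rfl
  wk _ := rfl
  idt _ := rfl

theorem IsHom.comp {E D K : PreESystem.{u}} {F : TermFunctor E.toTermCat D.toTermCat}
    {G : TermFunctor D.toTermCat K.toTermCat} (hF : IsHom F) (hG : IsHom G) :
    IsHom (E := E) (D := K) (F.comp G) where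
  root := (congrArg G.obj hF.root).trans hG.root
  sub {Γ Δ A} x := by
    have e1 := congrArg (fun H => TermFunctor.comp H (G.slice (F.obj Γ))) (hF.sub x)
    have e2 := congrArg (fun H => TermFunctor.comp (F.slice Δ) H) (hG.sub (F.tm x))
    exact e1.trans e2
  wk {Γ Δ} A := by
    have e1 := congrArg (fun H => TermFunctor.comp H (G.slice (F.obj Δ))) (hF.wk A)
    have e2 := congrArg (fun H => TermFunctor.comp (F.slice Γ) H) (hG.wk (F.map A))
    exact e1.trans e2
  idt {Γ Δ} A := by
    have e1 := congrArg G.onTerm (hF.idt A)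
    exact e1.trans (hG.idt (F.map A))

end PreESystem

namespace StratESystem

/-- The category of stratified E-systems and stratified E-homomorphisms. -/
instance : Category.{u} StratESystem.{u} where
  Hom := Hom
  id E := ⟨TermFunctor.id E.toTermCat, PreESystem.isHom_id E.toPreESystem, fun _ => rfl⟩
  comp f g := ⟨f.toTermFunctor.comp g.toTermFunctor, f.isHom.comp g.isHom,
    fun X => (g.strat _).trans (f.strat X)⟩

end StratESystem

/-! ## From B-systems to stratified E-systems -/

namespace BFrame

/-- The graph of the rooted tree underlying a B-frame: its vertices are the pairs `(n, X)` with
`X ∈ B_n`. -/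
def Tree (F : BFrame.{u}) : Type u := F.Ob

/-- There is one edge `(n + 1, X) ⟶ (n, ft(X))` for each `X ∈ B_{n+1}`. -/
inductive Edge (F : BFrame.{u}) : F.Tree → F.Tree → Type u
  | mk {n : ℕ} (X : F.B (n + 1)) : Edge F ⟨n + 1, X⟩ ⟨n, F.ft X⟩

instance (F : BFrame.{u}) : Quiver F.Tree := ⟨F.Edge⟩

/-- The strict category freely generated by the tree. -/
abbrev FreeCat (F : BFrame.{u}) : Type u := Paths F.Tree

/-- The length of an arrow of the free category. -/
def arrowLength {F : BFrame.{u}} {X Y : F.FreeCat} (p : X ⟶ Y) : ℕ := Quiver.Path.length p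

section

variable {F : BFrame.{u}}

/-- A vertex as an object of the free category. -/
abbrev toFree (X : F.Ob) : F.FreeCat := X
/-- An object of the free category as a vertex. -/
abbrev ofFree (X : F.FreeCat) : F.Ob := X

theorem edge_fst {X Y : F.Tree} (e : F.Edge X Y) : (show F.Ob from X).1 =
    (show F.Ob from Y).1 + 1 ∧ par (show F.Ob from X) = Y := by
  cases e; exact ⟨rfl, rfl⟩

instance (X Y : F.Tree) : Subsingleton (F.Edge X Y) := ⟨fun e e' => by
  cases e; cases e'; rfl⟩

theorem path_spec {X Y : F.Tree} (p : Quiver.Path X Y) : (show F.Ob from X).1 =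
    (show F.Ob from Y).1 + p.length ∧ par^[p.length] (show F.Ob from X) = Y := by
  induction p with
  | nil => exact ⟨rfl, rfl⟩
  | cons p e ih =>
    obtain ⟨h1, h2⟩ := edge_fst e
    rw [Quiver.Path.length_cons, Function.iterate_succ_apply', ih.2]
    exact ⟨by omega, h2⟩

theorem arrow_spec {X Y : F.FreeCat} (p : X ⟶ Y) : (ofFree X).1 = (ofFree Y).1 + arrowLength p ∧
    par^[arrowLength p] (ofFree X) = Y := path_spec p

theorem arrow_le {X Y : F.FreeCat} (p : X ⟶ Y) : arrowLength p ≤ (ofFree X).1 := by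
  have := (arrow_spec p).1; omega

theorem ov_of_arrow {X Y : F.FreeCat} (p : X ⟶ Y) : Ov (ofFree Y) (ofFree X) :=
  ov_iff.2 ⟨arrowLength p, arrow_le p, (arrow_spec p).2⟩

theorem root_ov (X : F.Ob) : Ov ⟨0, F.root⟩ X := by
  refine ov_iff.2 ⟨X.1, le_rfl, ?_⟩
  have : (par^[X.1] X).1 = 0 := by rw [par_iter_fst]; exact Nat.sub_self _
  generalize par^[X.1] X = V at this
  obtain ⟨n, V⟩ := V
  obtain rfl : n = 0 := this
  rw [F.eq_root V]

theorem exists_path (m : ℕ) (X : F.Ob) (h : m ≤ X.1) :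
    Nonempty (@Quiver.Path F.Tree _ X (par^[m] X)) := by
  induction m with
  | zero => exact ⟨.nil⟩
  | succ m ih =>
    obtain ⟨p⟩ := ih (by omega)
    rw [Function.iterate_succ_apply']
    have h2 : 0 < (par^[m] X).1 := by rw [par_iter_fst]; omega
    generalize par^[m] X = V at p h2
    obtain ⟨_ | n, V⟩ := V
    · exact absurd h2 (lt_irrefl 0)
    · exact ⟨p.cons (Edge.mk V)⟩

/-- The unique arrow from a node to a node over which it lies. -/
noncomputable def arrow {X Y : F.Ob} (h : Ov Y X) : toFree X ⟶ toFree Y :=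
  Classical.choice (by
    have := exists_path (X.1 - Y.1) X (Nat.sub_le _ _)
    rw [h.2] at this; exact this)

theorem path_thin {X Y : F.Tree} (p q : Quiver.Path X Y) : p = q := by
  induction p with
  | nil =>
    cases q with
    | nil => rfl
    | cons q e =>
      have := (path_spec (q.cons e)).1
      rw [Quiver.Path.length_cons] at this
      omega
  | @cons Y Z p e ih =>
    cases q with
    | nil =>
      have := (path_spec (p.cons e)).1
      rw [Quiver.Path.length_cons] at this
      omega
    | @cons Y' _ q e' =>
      have h : Y = Y' := by
        have h1 := path_spec p
        have h2 := path_spec q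
        have h3 := (edge_fst e).1
        have h4 := (edge_fst e').1
        rw [show p.length = q.length by omega] at h1
        exact h1.2.symm.trans h2.2
      subst h
      have he : e = e' := Subsingleton.elim (α := F.Edge Y Z) e e'
      rw [ih q, he]

instance arrow_thin (X Y : F.FreeCat) : Subsingleton (X ⟶ Y) := ⟨fun p q => path_thin p q⟩

end

end BFrame

/-- A presentation of a category with term structure as a thin category whose objects and terms are
determined by given invariants. -/
structure TermCat.Raw (D : TermCat.{u}) (O R : Type u) where
  ob : D.Ob → O
  tm : ∀ {X Y : D.Ob} {f : X ⟶ Y}, D.T f → R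
  ob_inj : Function.Injective ob
  tm_inj : ∀ {X Y : D.Ob} (f : X ⟶ Y), Function.Injective (tm (f := f))
  thin : ∀ X Y : D.Ob, Subsingleton (X ⟶ Y)

namespace TermCat.Raw

theorem mkTerm_ext {D : TermCat.{u}} {O R : Type u} (r : D.Raw O R) {X Y X' Y' : D.Ob} {f : X ⟶ Y}
    {f' : X' ⟶ Y'} {x : D.T f} {x' : D.T f'} (hX : r.ob X = r.ob X') (hY : r.ob Y = r.ob Y')
    (h : r.tm x = r.tm x') : D.mkTerm f x = D.mkTerm f' x' := by
  obtain rfl := r.ob_inj hX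
  obtain rfl := r.ob_inj hY
  obtain rfl := (r.thin X Y).elim f f'
  rw [r.tm_inj f h]

theorem functor_ext {C D : TermCat.{u}} {O R : Type u} (r : D.Raw O R) {F G : TermFunctor C D}
    (h : ∀ X : C.Ob, r.ob (F.obj X) = r.ob (G.obj X))
    (h' : ∀ {X Y : C.Ob} {f : X ⟶ Y} (x : C.T f), r.tm (F.tm x) = r.tm (G.tm x)) : F = G := by
  refine TermFunctor.ext_arrow (fun {X Y} f => ?_) (fun {X Y} f x => ?_)
  · have hX := r.ob_inj (h X)
    have hY := r.ob_inj (h Y)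
    refine (Arrow.mk_eq_mk_iff _ _).2 ⟨hX, hY, (r.thin _ _).elim _ _⟩
  · exact mkTerm_ext r (h X) (h Y) (h' x)

/-- The induced presentation of a slice. -/
def slice {D : TermCat.{u}} {O R : Type u} (r : D.Raw O R) (Γ : D.Ob) : (D.slice Γ).Raw O R where
  ob P := r.ob P.left
  tm {P Q f} x := r.tm (f := f.left) x
  ob_inj := by
    rintro P Q h
    obtain ⟨P, ⟨⟨⟩⟩, p⟩ := P
    obtain ⟨Q, ⟨⟨⟩⟩, q⟩ := Q
    obtain rfl : P = Q := r.ob_inj h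
    obtain rfl : p = q := (r.thin P Γ).elim p q
    rfl
  tm_inj {_ _} f x y h := r.tm_inj f.left h
  thin P Q := ⟨fun f g => Over.OverMorphism.ext ((r.thin P.left Q.left).elim _ _)⟩

end TermCat.Raw

namespace BSystem

open BFrame PreBSystem

/-- The term structure on the free category: `T(X, k)` for the arrow `(X, k)` of length `k` with
domain `X`. -/
abbrev termCat (B : BSystem.{u}) : TermCat.{u} where
  Ob := B.FreeCat
  T {X Y : B.FreeCat} (f : X ⟶ Y) := {t : List B.Tm // B.IsTm (ofFree X) (arrowLength f) t}

def raw (B : BSystem.{u}) : B.termCat.Raw B.Ob (List B.Tm) where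
  ob X := X
  tm x := x.1
  ob_inj _ _ h := h
  tm_inj _ _ _ h := Subtype.ext h
  thin X Y := arrow_thin X Y

section

variable {A B : BSystem.{u}} {X : A.Ob} {Y : B.Ob} {f : A.Ob → B.Ob} {g : A.Tm → B.Tm}

theorem arrowLength_eq {F : BFrame.{u}} {X Y : F.FreeCat} (p : X ⟶ Y) {k : ℕ}
    (h : (ofFree X).1 = (ofFree Y).1 + k) : arrowLength p = k := by
  have := (arrow_spec p).1; omega

theorem isTm_congr {P Q : B.FreeCat} {p : P ⟶ Q} {k : ℕ} {t : List B.Tm}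
    (h : (ofFree P).1 = (ofFree Q).1 + k) (ht : B.IsTm (ofFree P) k t) :
    B.IsTm (ofFree P) (arrowLength p) t := by
  rw [arrowLength_eq p h]; exact ht

/-- The functor with term structure between slices that is given by the map `f` on nodes and, on
terms, by the componentwise application of `g`. -/
noncomputable def opFunctor
    (h : IsOp (A := A.toPreBSystem) (B := B.toPreBSystem) X Y f g) :
    TermFunctor (A.termCat.slice (toFree X)) (B.termCat.slice (toFree Y)) where
  obj P := Over.mk (arrow (h.ov (ov_of_arrow P.hom)))
  map {P Q} φ := Over.homMk (arrow (h.ov_ov (ov_of_arrow Q.hom) (ov_of_arrow φ.left)))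
    (Subsingleton.elim _ _)
  map_id P := Over.OverMorphism.ext (Subsingleton.elim _ _)
  map_comp _ _ := Over.OverMorphism.ext (Subsingleton.elim _ _)
  tm {P Q φ} t := ⟨t.1.map g, by
    have e := (arrow_spec φ.left).1
    have e1 := h.lvl_lvl (ov_of_arrow Q.hom) ((ov_of_arrow Q.hom).trans (ov_of_arrow φ.left))
    have h1 := op_isTm h (arrow_le φ.left) t.2
      (by rw [(arrow_spec φ.left).2]; exact ov_of_arrow Q.hom)
    exact isTm_congr (by
      change (f (ofFree P.left)).1 = (f (ofFree Q.left)).1 + _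
      omega) h1⟩

/-- The functor with term structure that is given by the map `f` on nodes and, on terms, by the
componentwise application of `g`. -/
noncomputable def rootOpFunctor
    (h : IsOp (A := A.toPreBSystem) (B := B.toPreBSystem) ⟨0, A.root⟩ ⟨0, B.root⟩ f g) :
    TermFunctor A.termCat B.termCat where
  obj P := toFree (f (ofFree P))
  map {P Q} φ := arrow (h.ov_ov (root_ov (ofFree Q)) (ov_of_arrow φ))
  map_id P := Subsingleton.elim _ _
  map_comp _ _ := Subsingleton.elim _ _
  tm {P Q φ} t := ⟨t.1.map g, by
    have e := (arrow_spec φ).1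
    have e1 := h.lvl_lvl (root_ov (ofFree Q)) (root_ov (ofFree P))
    have h1 := op_isTm h (arrow_le φ) t.2 (root_ov _)
    exact isTm_congr (by
      change (f (ofFree P)).1 = (f (ofFree Q)).1 + _
      omega) h1⟩

end

section

variable (B : BSystem.{u})

variable {B} in
theorem isOp_arrow_subs {Γ Δ : B.FreeCat} {A : Δ ⟶ Γ} (t : B.termCat.T A) :
    IsOp (A := B.toPreBSystem) (B := B.toPreBSystem) (ofFree Δ) (ofFree Γ) (B.subs t.1)
      (B.subsT t.1) := by
  have := isOp_subs (arrow_le A) t.2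
  rwa [(arrow_spec A).2] at this

variable {B} in
theorem isOp_arrow_wks {Γ Δ : B.FreeCat} (A : Δ ⟶ Γ) :
    IsOp (A := B.toPreBSystem) (B := B.toPreBSystem) (ofFree Γ) (ofFree Δ)
      (B.wks (ofFree Δ) (arrowLength A)) (B.wksT (ofFree Δ) (arrowLength A)) := by
  have := isOp_wks (arrow_le A)
  rwa [(arrow_spec A).2] at this

theorem wks_add (X : B.Ob) (k l : ℕ) (Z : B.Ob) :
    B.wks X (k + l) Z = B.wks X k (B.wks (par^[k] X) l Z) := by
  induction k generalizing X with
  | zero => rw [Nat.zero_add]; rfl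
  | succ k ih =>
    rw [Nat.succ_add]
    exact congrArg (B.wk X) (ih (par X))

theorem wksT_add (X : B.Ob) (k l : ℕ) (z : B.Tm) :
    B.wksT X (k + l) z = B.wksT X k (B.wksT (par^[k] X) l z) := by
  induction k generalizing X with
  | zero => rw [Nat.zero_add]; rfl
  | succ k ih =>
    rw [Nat.succ_add]
    exact congrArg (B.wkT X) (ih (par X))

/-- The pre-E-system on the free category: the substitution structure consists of the functors
induced by the iterated substitutions `S_t`, the weakening structure of those induced by the
iterated weakenings `W_X^k`. -/
noncomputable abbrev preE : PreESystem.{u} where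
  toTermCat := B.termCat
  root := toFree ⟨0, B.root⟩
  root_isTerminal := ⟨Limits.IsTerminal.ofUniqueHom (fun X => arrow (root_ov (ofFree X)))
    (fun _ _ => Subsingleton.elim _ _)⟩
  S {Γ Δ A} t := opFunctor (isOp_arrow_subs t)
  S_id {Γ Δ A} t := (B.raw.slice Γ).ob_inj (isOp_arrow_subs t).base
  W {Γ Δ} A := opFunctor (isOp_arrow_wks A)
  W_one Γ := by
    have e : arrowLength (𝟙 Γ) = 0 := arrowLength_eq _ rfl
    refine (B.raw.slice Γ).functor_ext (fun P => ?_) (fun {P Q φ} x => ?_)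
    · change B.wks (ofFree Γ) (arrowLength (𝟙 Γ)) (ofFree P.left) = P.left
      rw [e]; rfl
    · change x.1.map (B.wksT (ofFree Γ) (arrowLength (𝟙 Γ))) = x.1
      rw [e]; exact List.map_id _
  W_comp {Γ Δ Θ} A P := by
    have e : arrowLength (P ≫ A) = arrowLength P + arrowLength A := Quiver.Path.length_comp _ _
    refine (B.raw.slice Θ).functor_ext (fun Q => ?_) (fun {Q R φ} x => ?_)
    · change B.wks (ofFree Θ) (arrowLength (P ≫ A)) (ofFree Q.left) =
        B.wks (ofFree Θ) (arrowLength P) (B.wks (ofFree Δ) (arrowLength A) (ofFree Q.left))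
      rw [e, wks_add, (arrow_spec P).2]
    · change x.1.map (B.wksT (ofFree Θ) (arrowLength (P ≫ A))) =
        (x.1.map (B.wksT (ofFree Δ) (arrowLength A))).map (B.wksT (ofFree Θ) (arrowLength P))
      rw [e, List.map_map]
      refine List.map_congr_left fun y _ => ?_
      rw [wksT_add, (arrow_spec P).2]; rfl
  W_id {Γ Δ} A := (B.raw.slice Δ).ob_inj (isOp_arrow_wks A).base
  idt {Γ Δ} A := ⟨B.gens (ofFree Δ) (arrowLength A), by
    have h1 := (gens_spec (B := B) (arrow_le A)).1
    have h2 := (isOp_arrow_wks A).lvl (ov_of_arrow A)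
    have h3 := (arrow_spec A).1
    exact isTm_congr (by
      change (B.wks (ofFree Δ) (arrowLength A) (ofFree Δ)).1 = (ofFree Δ).1 + arrowLength A
      omega) h1⟩

end

section

variable {A B : BSystem.{u}} {X : A.Ob} {Y : B.Ob} {f : A.Ob → B.Ob} {g : A.Tm → B.Tm}

theorem term_mem {P Q : B.FreeCat} {p : P ⟶ Q} (t : B.termCat.T p) {y : B.Tm} (hy : y ∈ t.1) :
    SOv (ofFree Q) (bdT y) := by
  have := t.2.mem (arrow_le p) y hy
  rwa [(arrow_spec p).2] at this

theorem opFunctor_isHom (h : IsOp (A := A.toPreBSystem) (B := B.toPreBSystem) X Y f g) :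
    PreESystem.IsHom (E := (preE A).slice (toFree X)) (D := (preE B).slice (toFree Y))
      (opFunctor h) where
  root := (B.raw.slice (toFree Y)).ob_inj h.base
  sub {P Q φ} x := by
    have hU : Ov X (par^[arrowLength φ.left] (ofFree Q.left)) := by
      rw [(arrow_spec φ.left).2]; exact ov_of_arrow P.hom
    refine ((B.raw.slice _).slice _).functor_ext (fun Z => ?_) (fun {Z V ψ} y => ?_)
    · exact op_subs h (arrow_le φ.left) x.2 hU (ov_of_arrow Z.hom.left)
    · change (y.1.map (A.subsT x.1)).map g = (y.1.map g).map (B.subsT (x.1.map g))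
      rw [List.map_map, List.map_map]
      refine List.map_congr_left fun z hz => ?_
      exact op_subsT h (arrow_le φ.left) x.2 hU
        (.trans (ov_of_arrow V.hom.left) (term_mem y hz))
  wk {P Q} φ := by
    have hU : Ov X (par^[arrowLength φ.left] (ofFree Q.left)) := by
      rw [(arrow_spec φ.left).2]; exact ov_of_arrow P.hom
    have e : arrowLength ((opFunctor h).map φ).left = arrowLength φ.left := by
      have e1 := h.lvl_lvl (ov_of_arrow P.hom) (ov_of_arrow Q.hom)
      have e2 := (arrow_spec φ.left).1
      exact arrowLength_eq _ (by
        change (f (ofFree Q.left)).1 = (f (ofFree P.left)).1 + _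
        omega)
    refine ((B.raw.slice _).slice _).functor_ext (fun Z => ?_) (fun {Z V ψ} y => ?_)
    · refine (op_wks h (arrow_le φ.left) hU (Z := ofFree Z.left.left) ?_).trans ?_
      · rw [(arrow_spec φ.left).2]; exact ov_of_arrow Z.hom.left
      · exact congrArg (fun k => B.wks (f (ofFree Q.left)) k (f (ofFree Z.left.left))) e.symm
    · change (y.1.map (A.wksT (ofFree Q.left) (arrowLength φ.left))).map g =
        (y.1.map g).map (B.wksT (f (ofFree Q.left)) (arrowLength ((opFunctor h).map φ).left))
      rw [List.map_map, List.map_map, e]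
      refine List.map_congr_left fun z hz => ?_
      refine op_wksT h (arrow_le φ.left) hU ?_
      rw [(arrow_spec φ.left).2]
      exact .trans (ov_of_arrow V.hom.left) (term_mem y hz)
  idt {P Q} φ := by
    have hU : Ov X (par^[arrowLength φ.left] (ofFree Q.left)) := by
      rw [(arrow_spec φ.left).2]; exact ov_of_arrow P.hom
    have e : arrowLength ((opFunctor h).map φ).left = arrowLength φ.left := by
      have e1 := h.lvl_lvl (ov_of_arrow P.hom) (ov_of_arrow Q.hom)
      have e2 := (arrow_spec φ.left).1
      exact arrowLength_eq _ (by
        change (f (ofFree Q.left)).1 = (f (ofFree P.left)).1 + _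
        omega)
    refine (B.raw.slice _).mkTerm_ext ?_ rfl ?_
    · refine (op_wks h (arrow_le φ.left) hU (Z := ofFree Q.left) ?_).trans ?_
      · rw [(arrow_spec φ.left).2]; exact ov_of_arrow φ.left
      · exact congrArg (fun k => B.wks (f (ofFree Q.left)) k (f (ofFree Q.left))) e.symm
    · refine (op_gens h (arrow_le φ.left) hU).trans ?_
      exact congrArg (fun k => B.gens (f (ofFree Q.left)) k) e.symm

theorem rootOpFunctor_isHom
    (h : IsOp (A := A.toPreBSystem) (B := B.toPreBSystem) ⟨0, A.root⟩ ⟨0, B.root⟩ f g) :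
    PreESystem.IsHom (E := preE A) (D := preE B) (rootOpFunctor h) where
  root := B.raw.ob_inj h.base
  sub {P Q φ} x := by
    refine (B.raw.slice _).functor_ext (fun Z => ?_) (fun {Z V ψ} y => ?_)
    · exact op_subs h (arrow_le φ) x.2 (root_ov _) (ov_of_arrow Z.hom)
    · change (y.1.map (A.subsT x.1)).map g = (y.1.map g).map (B.subsT (x.1.map g))
      rw [List.map_map, List.map_map]
      refine List.map_congr_left fun z hz => ?_
      exact op_subsT h (arrow_le φ) x.2 (root_ov _) (.trans (ov_of_arrow V.hom) (term_mem y hz))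
  wk {P Q} φ := by
    have e : arrowLength ((rootOpFunctor h).map φ) = arrowLength φ := by
      have e1 := h.lvl_lvl (root_ov (ofFree P)) (root_ov (ofFree Q))
      have e2 := (arrow_spec φ).1
      exact arrowLength_eq _ (by
        change (f (ofFree Q)).1 = (f (ofFree P)).1 + _
        omega)
    refine (B.raw.slice _).functor_ext (fun Z => ?_) (fun {Z V ψ} y => ?_)
    · refine (op_wks h (arrow_le φ) (root_ov _) (Z := ofFree Z.left) ?_).trans ?_
      · rw [(arrow_spec φ).2]; exact ov_of_arrow Z.hom
      · exact congrArg (fun k => B.wks (f (ofFree Q)) k (f (ofFree Z.left))) e.symm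
    · change (y.1.map (A.wksT (ofFree Q) (arrowLength φ))).map g =
        (y.1.map g).map (B.wksT (f (ofFree Q)) (arrowLength ((rootOpFunctor h).map φ)))
      rw [List.map_map, List.map_map, e]
      refine List.map_congr_left fun z hz => ?_
      refine op_wksT h (arrow_le φ) (root_ov _) ?_
      rw [(arrow_spec φ).2]
      exact .trans (ov_of_arrow V.hom) (term_mem y hz)
  idt {P Q} φ := by
    have e : arrowLength ((rootOpFunctor h).map φ) = arrowLength φ := by
      have e1 := h.lvl_lvl (root_ov (ofFree P)) (root_ov (ofFree Q))
      have e2 := (arrow_spec φ).1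
      exact arrowLength_eq _ (by
        change (f (ofFree Q)).1 = (f (ofFree P)).1 + _
        omega)
    refine B.raw.mkTerm_ext ?_ rfl ?_
    · refine (op_wks h (arrow_le φ) (root_ov _) (Z := ofFree Q) ?_).trans ?_
      · rw [(arrow_spec φ).2]; exact ov_of_arrow φ
      · exact congrArg (fun k => B.wks (f (ofFree Q)) k (f (ofFree Q))) e.symm
    · refine (op_gens h (arrow_le φ) (root_ov _)).trans ?_
      exact congrArg (fun k => B.gens (f (ofFree Q)) k) e.symm

end

end BSystem

namespace BSystem

open BFrame PreBSystem

/-- The E-system on the free category. -/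
noncomputable abbrev eSystem (B : BSystem.{u}) : ESystem.{u} where
  toPreESystem := preE B
  S_isHom {Γ Δ A} t := opFunctor_isHom (isOp_arrow_subs t)
  W_isHom {Γ Δ} A := opFunctor_isHom (isOp_arrow_wks A)
  W_comp_S {Γ Δ A} t := by
    refine (B.raw.slice _).functor_ext (fun Z => ?_) (fun {Z V ψ} y => ?_)
    · refine subs_wks (arrow_le A) t.2 (Z := ofFree Z.left) ?_
      rw [(arrow_spec A).2]; exact ov_of_arrow Z.hom
    · change (y.1.map (B.wksT (ofFree Δ) (arrowLength A))).map (B.subsT t.1) = y.1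
      rw [List.map_map]
      refine (List.map_congr_left fun z hz => ?_).trans (List.map_id _)
      refine subsT_wksT (arrow_le A) t.2 ?_
      rw [(arrow_spec A).2]
      exact .trans (ov_of_arrow V.hom) (term_mem y hz)
  S_idt {Γ Δ A} t := by
    refine B.raw.mkTerm_ext ?_ (isOp_arrow_subs t).base (subsT_gens (arrow_le A) t.2)
    refine subs_wks (arrow_le A) t.2 (Z := ofFree Δ) ?_
    rw [(arrow_spec A).2]; exact ov_of_arrow A
  W_slice_comp_S_idt {Γ Δ} A := by
    have h := gens_spec (B := B) (arrow_le A)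
    refine (B.raw.slice _).functor_ext (fun Z => ?_) (fun {Z V ψ} y => ?_)
    · exact h.2.1 (ov_of_arrow Z.hom)
    · change (y.1.map (B.wksT (ofFree Δ) (arrowLength A))).map
        (B.subsT (B.gens (ofFree Δ) (arrowLength A))) = y.1
      rw [List.map_map]
      refine (List.map_congr_left fun z hz => ?_).trans (List.map_id _)
      exact h.2.2 (.trans (ov_of_arrow V.hom) (term_mem y hz))

end BSystem

namespace BFrame

variable {F : BFrame.{u}}

/-- The level of a node. -/
def level (X : F.FreeCat) : ℕ := (ofFree X).1

theorem chain_le {X Y : F.FreeCat} (p : IndividualChain level X Y) : level Y ≤ level X := by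
  induction p with
  | nil => exact le_rfl
  | cons f h p ih => omega

theorem chain_unique {X Y : F.FreeCat} (p q : IndividualChain level X Y) : p = q := by
  induction p with
  | nil =>
    cases q with
    | nil => rfl
    | cons g h q => have := chain_le q; omega
  | @cons X X' Y f h p ih =>
    cases q with
    | nil => have := chain_le p; omega
    | @cons _ X'' _ g h' q =>
      obtain rfl : X' = X'' := by
        have h1 := arrow_spec f
        have h2 := arrow_spec g
        rw [BSystem.arrowLength_eq f h] at h1
        rw [BSystem.arrowLength_eq g h'] at h2
        exact h1.2.symm.trans h2.2
      obtain rfl : f = g := Subsingleton.elim _ _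
      rw [ih q]

theorem exists_chain (m : ℕ) {X Y : F.FreeCat} (h : Ov (ofFree Y) (ofFree X))
    (hm : level X = level Y + m) : Nonempty (IndividualChain level X Y) := by
  induction m generalizing X with
  | zero =>
    obtain rfl : X = Y := h.eq (by change level X ≤ level Y; omega)
    exact ⟨.nil X⟩
  | succ m ih =>
    have h0 : SOv (ofFree Y) (ofFree X) := h.sov (by change level Y < level X; omega)
    have h1 : (par (ofFree X)).1 = (ofFree X).1 - 1 := par_fst _
    have h2 : level X = (ofFree X).1 := rfl
    obtain ⟨p⟩ := ih (X := toFree (par (ofFree X))) h0.2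
      (by change (par (ofFree X)).1 = _; omega)
    exact ⟨.cons (arrow (ov_par (ofFree X) h0.1)) (by
      change (ofFree X).1 = (par (ofFree X)).1 + 1
      omega) p⟩

/-- The stratification of the free category by the levels of the nodes. -/
def stratification (F : BFrame.{u}) : Stratification F.FreeCat (toFree ⟨0, F.root⟩) where
  L :=
    { obj := fun X => OrderDual.toDual (level X)
      map := fun f => homOfLE (OrderDual.toDual_le_toDual.2 (ov_of_arrow f).1) }
  eq_zero_iff X := by
    constructor
    · obtain ⟨n, X⟩ := X
      intro h
      obtain rfl : n = 0 := h
      rw [F.eq_root X]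
    · rintro rfl; rfl
  eq_iff {X Y} f := by
    constructor
    · intro h
      have e : X = Y := (ov_of_arrow f).eq (le_of_eq h)
      exact ⟨e, Subsingleton.elim _ _⟩
    · rintro ⟨rfl, -⟩; rfl
  factor {X Y} f n m hX hY := by
    obtain ⟨p⟩ := exists_chain (m + 1) (ov_of_arrow f) (by
      change level X = n + m + 1 at hX
      change level Y = n at hY
      omega)
    exact ⟨p, Subsingleton.elim _ _, fun q _ => chain_unique _ _⟩

end BFrame

namespace PreBSystem

open BFrame

theorem isHom_id (B : PreBSystem.{u}) : IsHom (F := B) (G := B) (Hom.id B.toBFrame) where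
  sub _ := rfl
  wk _ := rfl
  gen _ := rfl

theorem IsHom.comp {A B C : PreBSystem.{u}} {H : Hom A.toBFrame B.toBFrame}
    {K : Hom B.toBFrame C.toBFrame} (hH : IsHom H) (hK : IsHom K) :
    IsHom (F := A) (G := C) (H.comp K) where
  sub {n} x := by
    have e1 := congrArg (fun L => (L.comp (K.slice _)).comp
      (C.sliceCongr ((K.ft_ob _).symm.trans (congrArg C.ft (K.bd_tm _).symm)))) (hH.sub x)
    have e2 := congrArg (fun L => ((H.slice (A.bd x)).comp
      (B.sliceCongr (H.bd_tm x).symm)).comp L) (hK.sub (H.tm x))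
    exact e2.trans e1
  wk {n} X := by
    have e1 := congrArg (fun L => Hom.comp L (K.slice _)) (hH.wk X)
    have e2 := congrArg (fun L => ((H.slice (A.ft X)).comp
      (B.sliceCongr (H.ft_ob X).symm)).comp L) (hK.wk (H.ob X))
    exact e2.trans e1
  gen {n} X := (congrArg K.tm (hH.gen X)).trans (hK.gen (H.ob X))

end PreBSystem

namespace BSystem

open BFrame PreBSystem

/-- B-homomorphisms, i.e. pre-B-homomorphisms between B-systems. -/
@[ext]
structure Hom (A B : BSystem.{u}) where
  toHom : BFrame.Hom A.toBFrame B.toBFrame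
  isHom : PreBSystem.IsHom (F := A.toPreBSystem) (G := B.toPreBSystem) toHom

/-- The category of B-systems. -/
instance : Category.{u} BSystem.{u} where
  Hom := Hom
  id B := ⟨BFrame.Hom.id B.toBFrame, PreBSystem.isHom_id B.toPreBSystem⟩
  comp f g := ⟨f.toHom.comp g.toHom, f.isHom.comp g.isHom⟩

/-- The stratified E-system associated with a B-system. -/
noncomputable abbrev stratE (B : BSystem.{u}) : StratESystem.{u} where
  toESystem := B.eSystem
  strat := B.toBFrame.stratification
  S_strat {Γ Δ A} t P := by
    have h1 := (isOp_arrow_subs t).lvl (ov_of_arrow P.hom)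
    have h2 := (ov_of_arrow P.hom).1
    change (B.subs t.1 (ofFree P.left)).1 - (ofFree Γ).1 = (ofFree P.left).1 - (ofFree Δ).1
    omega
  W_strat {Γ Δ} A P := by
    have h1 := (isOp_arrow_wks A).lvl (ov_of_arrow P.hom)
    have h2 := (ov_of_arrow P.hom).1
    change (B.wks (ofFree Δ) (arrowLength A) (ofFree P.left)).1 - (ofFree Δ).1 =
      (ofFree P.left).1 - (ofFree Γ).1
    omega

end BSystem

/-- The functor from B-systems to stratified E-systems. A B-system is sent to the free category on
its tree, with term structure `T(X, k)`, iterated substitutions, iterated weakenings and lists of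
generic elements; a homomorphism `H` acts as `H` on objects and as `H`, componentwise, on terms. -/
noncomputable def B2E : BSystem.{u} ⥤ StratESystem.{u} where
  obj B := B.stratE
  map H := ⟨BSystem.rootOpFunctor H.isHom.isOp, BSystem.rootOpFunctor_isHom H.isHom.isOp,
    fun _ => rfl⟩
  map_id B := StratESystem.Hom.ext (B.raw.functor_ext (fun _ => rfl) (fun x => List.map_id x.1))
  map_comp {_ _ C} H K := StratESystem.Hom.ext (C.raw.functor_ext (fun _ => rfl)
    (fun x => (List.map_map (f := H.toHom.totalT) (g := K.toHom.totalT) (l := x.1)).symm))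

/-! ## From stratified E-systems to B-systems -/

namespace Stratification

variable {C : Type u} [SmallCategory C] {one : C} (s : Stratification C one)

theorem len_le {X Y : C} (f : X ⟶ Y) : s.len Y ≤ s.len X := leOfHom (s.L.map f)

theorem exists_chain {X Y : C} (f : X ⟶ Y) :
    ∃ p : IndividualChain s.len X Y, p.composite = f := by
  by_cases h : s.len X = s.len Y
  · obtain ⟨rfl, rfl⟩ := (s.eq_iff f).1 h
    exact ⟨.nil X, rfl⟩
  · have h1 := s.len_le f
    obtain ⟨p, hp, -⟩ := s.factor f (s.len Y) (s.len X - s.len Y - 1) (by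
      change s.len X = _; omega) rfl
    exact ⟨p, hp⟩

/-- Two arrows with the same domain whose codomains have the same length are equal. -/
theorem arrow_eq (ht : Nonempty (Limits.IsTerminal one)) {X Y Y' : C} (f : X ⟶ Y) (g : X ⟶ Y')
    (h : s.len Y = s.len Y') : Arrow.mk f = Arrow.mk g := by
  obtain ⟨ht⟩ := ht
  have key : ∀ {X Y Y' : C} (f : X ⟶ Y) (g : X ⟶ Y'), s.len X = s.len Y + 1 →
      s.len X = s.len Y' + 1 → Arrow.mk f = Arrow.mk g := by
    intro X Y Y' f g hf hg
    obtain ⟨p, -⟩ := s.exists_chain (ht.from Y)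
    obtain ⟨q, -⟩ := s.exists_chain (ht.from Y')
    have h1 : s.len one = 0 := (s.eq_zero_iff one).2 rfl
    have h2 := s.factor (ht.from X) 0 (s.len Y) (by change s.len X = _; omega) h1
    have h3 : IndividualChain.cons f hf p = IndividualChain.cons g hg q :=
      h2.unique (ht.hom_ext _ _) (ht.hom_ext _ _)
    cases h3
    rfl
  generalize hm : s.len X - s.len Y = m
  induction m generalizing X with
  | zero =>
    have h1 := s.len_le f
    have h2 := s.len_le g
    obtain ⟨rfl, rfl⟩ := (s.eq_iff f).1 (show s.len X = s.len Y by omega)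
    obtain ⟨rfl, rfl⟩ := (s.eq_iff g).1 (show s.len X = s.len Y' by omega)
    rfl
  | succ m ih =>
    obtain ⟨p, rfl⟩ := s.exists_chain f
    obtain ⟨q, rfl⟩ := s.exists_chain g
    cases p with
    | nil => omega
    | @cons _ X1 _ f1 h1 p =>
      cases q with
      | nil => omega
      | @cons _ X2 _ g1 h2 q =>
        have e := key f1 g1 h1 h2
        obtain rfl : X1 = X2 := congrArg Comma.right e
        obtain rfl : f1 = g1 := Arrow.mk_injective _ _ e
        have e2 := ih p.composite q.composite (by omega)
        obtain rfl : Y = Y' := congrArg Comma.right e2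
        have e3 : p.composite = q.composite := Arrow.mk_injective _ _ e2
        exact congrArg (fun r => Arrow.mk (f1 ≫ r)) e3

theorem thin (s : Stratification C one) (ht : Nonempty (Limits.IsTerminal one)) {X Y : C} (f g : X ⟶ Y) : f = g :=
  Arrow.mk_injective _ _ (s.arrow_eq ht f g rfl)

theorem cod_eq (ht : Nonempty (Limits.IsTerminal one)) {X Y Y' : C} (f : X ⟶ Y) (g : X ⟶ Y')
    (h : s.len Y = s.len Y') : Y = Y' :=
  congrArg Comma.right (s.arrow_eq ht f g h)

/-- Every object of positive length is the domain of an individual arrow. -/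
theorem exists_individual (ht : Nonempty (Limits.IsTerminal one)) {X : C} {n : ℕ}
    (h : s.len X = n + 1) : ∃ f : Arrow C, f.left = X ∧ s.len f.right = n := by
  obtain ⟨ht⟩ := ht
  obtain ⟨p, -⟩ := s.exists_chain (ht.from X)
  have h1 : s.len one = 0 := (s.eq_zero_iff one).2 rfl
  cases p with
  | nil => omega
  | @cons _ X' _ f hf p => exact ⟨Arrow.mk f, rfl, by change s.len X' = n; omega⟩

end Stratification

namespace StratESystem

open BFrame

section

variable (E : StratESystem.{u})

/-- The individual arrow with domain `X`. -/
noncomputable def individual {n : ℕ} (X : {X : E.Ob // E.strat.len X = n + 1}) : Arrow E.Ob :=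
  (E.strat.exists_individual E.root_isTerminal X.2).choose

theorem individual_left {n : ℕ} (X : {X : E.Ob // E.strat.len X = n + 1}) :
    (E.individual X).left = X.1 :=
  (E.strat.exists_individual E.root_isTerminal X.2).choose_spec.1

theorem individual_right {n : ℕ} (X : {X : E.Ob // E.strat.len X = n + 1}) :
    E.strat.len (E.individual X).right = n :=
  (E.strat.exists_individual E.root_isTerminal X.2).choose_spec.2

theorem individual_eq {n : ℕ} (X : {X : E.Ob // E.strat.len X = n + 1}) {Y : E.Ob} (f : X.1 ⟶ Y)
    (hY : E.strat.len Y = n) : E.individual X = Arrow.mk f := by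
  have h1 := E.individual_left X
  have h2 := E.individual_right X
  generalize E.individual X = a at h1 h2
  obtain ⟨A, B, a⟩ := a
  obtain ⟨X, hX⟩ := X
  dsimp only at h1
  subst h1
  exact E.strat.arrow_eq E.root_isTerminal a f (h2.trans hY.symm)

/-- The B-frame of a stratified category with term structure: `B_n` is the set of objects of length
`n`, and `ft(X)` is the codomain of the individual arrow with domain `X`. The set `B̃_{n+1}` is the
disjoint union of the sets of terms of the individual arrows with domain of length `n + 1` (which
correspond to the objects of length `n + 1`), and `bd` sends a term to the domain of its arrow. -/
noncomputable abbrev frame : BFrame.{u} where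
  B n := {X : E.Ob // E.strat.len X = n}
  Bt n := {x : E.Term // E.strat.len x.1.left = n + 1 ∧ E.strat.len x.1.right = n}
  ft X := ⟨(E.individual X).right, E.individual_right X⟩
  bd x := ⟨x.1.1.left, x.2.1⟩
  root := ⟨E.root, (E.strat.eq_zero_iff _).2 rfl⟩
  eq_root X := Subtype.ext ((E.strat.eq_zero_iff _).1 X.2)

end

section

variable {E : StratESystem.{u}}

theorem exists_arrow_ft {n : ℕ} (Y : E.frame.B (n + 1)) : Nonempty (Y.1 ⟶ (E.frame.ft Y).1) := by
  have h1 := E.individual_left Y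
  change Nonempty (Y.1 ⟶ (E.individual Y).right)
  generalize E.individual Y = a at h1
  obtain ⟨A, B, a⟩ := a
  obtain ⟨Y, hY⟩ := Y
  dsimp only at h1
  subst h1
  exact ⟨a⟩

theorem exists_arrow_ftn {n : ℕ} (m : ℕ) (Y : E.frame.B (n + m)) :
    Nonempty (Y.1 ⟶ (E.frame.ftn m Y).1) := by
  induction m with
  | zero => exact ⟨𝟙 _⟩
  | succ m ih =>
    obtain ⟨f⟩ := exists_arrow_ft (E := E) (n := n + m) Y
    obtain ⟨g⟩ := ih (E.frame.ft Y)
    exact ⟨f ≫ g⟩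

theorem ftn_eq_of_arrow {n m : ℕ} {X : E.frame.B n} {Y : E.frame.B (n + m)} (f : Y.1 ⟶ X.1) :
    E.frame.ftn m Y = X := by
  obtain ⟨g⟩ := exists_arrow_ftn m Y
  exact Subtype.ext (E.strat.cod_eq E.root_isTerminal g f
    ((E.frame.ftn m Y).2.trans X.2.symm))

theorem ft_bd {n : ℕ} (x : E.frame.Bt n) : (E.frame.ft (E.frame.bd x)).1 = x.1.1.right :=
  congrArg Comma.right (E.individual_eq (E.frame.bd x) x.1.1.hom x.2.2)

/-- An object of the slice of the frame over `X`, as an object of the slice category. -/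
noncomputable abbrev liftO {n m : ℕ} {X : E.frame.B n} (Y : (E.frame.slice X).B m) : Over X.1 :=
  Over.mk (Classical.choice (exists_arrow_ftn m Y.1) ≫ eqToHom (congrArg Subtype.val Y.2))

theorem exists_arrow_right {n m : ℕ} {X : E.frame.B n} (y : (E.frame.slice X).Bt m) :
    Nonempty (y.1.1.1.right ⟶ X.1) := by
  obtain ⟨f⟩ := exists_arrow_ftn m (E.frame.ft (E.frame.bd y.1))
  exact ⟨eqToHom (ft_bd y.1).symm ≫ f ≫ eqToHom (congrArg Subtype.val y.2)⟩

/-- A term of the slice of the frame over `X`, as a term of the slice category. -/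
noncomputable abbrev liftT {n m : ℕ} {X : E.frame.B n} (y : (E.frame.slice X).Bt m) :
    (E.toTermCat.slice X.1).Term :=
  (E.toTermCat.slice X.1).mkTerm
    (X := Over.mk (y.1.1.1.hom ≫ Classical.choice (exists_arrow_right y)))
    (Y := Over.mk (Classical.choice (exists_arrow_right y))) (Over.homMk y.1.1.1.hom rfl) y.1.1.2

end

end StratESystem

/-- The term of a category underlying a term of a slice. -/
abbrev TermCat.forget {C : TermCat.{u}} {Γ : C.Ob} (x : (C.slice Γ).Term) : C.Term :=
  C.mkTerm x.1.hom.left x.2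

namespace StratESystem

open BFrame

section

variable {E : StratESystem.{u}}

theorem over_ext {Γ : E.Ob} {P Q : Over Γ} (h : P.left = Q.left) : P = Q := by
  obtain ⟨P, ⟨⟨⟩⟩, p⟩ := P
  obtain ⟨Q, ⟨⟨⟩⟩, q⟩ := Q
  obtain rfl : P = Q := h
  have e : p = q := E.strat.thin E.root_isTerminal (X := P) (Y := Γ) p q
  rw [e]

theorem forget_injective {Γ : E.Ob} {x y : (E.toTermCat.slice Γ).Term}
    (h : TermCat.forget x = TermCat.forget y) : x = y := by
  obtain ⟨⟨P, Q, f⟩, x⟩ := x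
  obtain ⟨⟨P', Q', f'⟩, y⟩ := y
  have h1 : P = P' := over_ext (congrArg (fun z => z.1.left) h)
  have h2 : Q = Q' := over_ext (congrArg (fun z => z.1.right) h)
  subst h1
  subst h2
  obtain rfl : f = f' := Over.OverMorphism.ext (E.strat.thin E.root_isTerminal _ _)
  have h3 := eq_of_heq (Sigma.mk.inj h).2
  exact congrArg (Sigma.mk _) h3

/-- A functor with term structure between slices is stratified. -/
def IsStrat {X Y : E.Ob} (F : TermFunctor (E.toTermCat.slice X) (E.toTermCat.slice Y)) : Prop :=
  ∀ P : Over X, E.strat.sliceLen (F.obj P) = E.strat.sliceLen P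

theorem IsStrat.len {n k : ℕ} {X : E.frame.B n} {Y : E.frame.B k}
    {F : TermFunctor (E.toTermCat.slice X.1) (E.toTermCat.slice Y.1)} (hF : IsStrat F)
    (P : Over X.1) {m : ℕ} (hP : E.strat.len P.left = n + m) :
    E.strat.len (F.obj P).left = k + m := by
  have h1 := hF P
  have h2 := E.strat.len_le P.hom
  have h3 := E.strat.len_le (F.obj P).hom
  have h4 := X.2
  have h5 := Y.2
  change E.strat.len _ - E.strat.len _ = E.strat.len _ - E.strat.len _ at h1
  change E.strat.len X.1 ≤ _ at h2
  change E.strat.len Y.1 ≤ _ at h3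
  omega

/-- The homomorphism between slices of the B-frame that is induced by a stratified functor with
term structure between the slices of the category. -/
noncomputable def sliceHom {n k : ℕ} {X : E.frame.B n} {Y : E.frame.B k}
    (F : TermFunctor (E.toTermCat.slice X.1) (E.toTermCat.slice Y.1)) (hF : IsStrat F) :
    BFrame.Hom (E.frame.slice X) (E.frame.slice Y) where
  ob {m} Z := ⟨⟨(F.obj (liftO Z)).left, hF.len (X := X) (Y := Y) (liftO Z) Z.1.2⟩,
    ftn_eq_of_arrow (F.obj (liftO Z)).hom⟩
  tm {m} z := ⟨⟨TermCat.forget (F.onTerm (liftT z)),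
      hF.len (X := X) (Y := Y) (m := m + 1) (liftT z).1.left z.1.2.1,
      hF.len (X := X) (Y := Y) (liftT z).1.right z.1.2.2⟩,
    ftn_eq_of_arrow (m := m + 1) (F.obj (liftT z).1.left).hom⟩
  ft_ob {m} Z := by
    obtain ⟨f⟩ := exists_arrow_ft (E := E) (n := n + m) Z.1
    have w : f ≫ (liftO ((E.frame.slice X).ft Z)).hom = (liftO Z).hom :=
      E.strat.thin E.root_isTerminal (X := Z.1.1) (Y := X.1) _ _
    exact Subtype.ext (ftn_eq_of_arrow (n := k + m) (m := 1)
      (F.map (Over.homMk f w : liftO Z ⟶ liftO ((E.frame.slice X).ft Z))).left)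
  bd_tm {m} z := by
    have e : (liftT z).1.left = liftO ((E.frame.slice X).bd z) := over_ext rfl
    exact Subtype.ext (Subtype.ext (congrArg (fun P => (F.obj P).left) e))

/-- The object underlying a node of the frame. -/
abbrev val (Z : E.frame.Ob) : E.Ob := Z.2.1

/-- The term underlying a term of the frame. -/
abbrev valT (z : E.frame.Tm) : E.Term := z.2.1

theorem val_injective : Function.Injective (val (E := E)) := by
  rintro ⟨n, X, hX⟩ ⟨m, Y, hY⟩ h
  obtain rfl : X = Y := h
  obtain rfl : n = m := hX.symm.trans hY
  rfl

theorem valT_injective : Function.Injective (valT (E := E)) := by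
  rintro ⟨n, X, hX⟩ ⟨m, Y, hY⟩ h
  obtain rfl : X = Y := h
  obtain rfl : n = m := hX.2.symm.trans hY.2
  rfl

section

variable {n k : ℕ} {X : E.frame.B n} {Y : E.frame.B k}
  {F : TermFunctor (E.toTermCat.slice X.1) (E.toTermCat.slice Y.1)} (hF : IsStrat F)

theorem val_sliceHom (Z : (E.frame.slice X).Ob) {P : Over X.1} (hP : P.left = val (inc Z)) :
    val (inc ((sliceHom F hF).total Z)) = (F.obj P).left := by
  obtain rfl : P = liftO Z.2 := over_ext hP
  rfl

theorem valT_sliceHom (z : (E.frame.slice X).Tm) {x : (E.toTermCat.slice X.1).Term}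
    (hx : TermCat.forget x = valT (incT z)) :
    valT (incT ((sliceHom F hF).totalT z)) = TermCat.forget (F.onTerm x) := by
  obtain rfl : x = liftT z.2 := forget_injective hx
  rfl

end

end

section

variable (E : StratESystem.{u})

/-- The pre-B-system of a stratified E-system: `S_{(X, t)}` is induced by `S_t`, the homomorphism
`W_X` by `W_A` for the individual arrow `A` with domain `X`, and `δ(X)` is `idt A`. -/
noncomputable abbrev preB : PreBSystem.{u} where
  toBFrame := E.frame
  S {n} x := (sliceHom (E := E) (X := E.frame.bd x)
    (Y := (⟨x.1.1.right, x.2.2⟩ : E.frame.B n)) (E.S x.1.2) (E.S_strat x.1.2)).comp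
      (E.frame.sliceCongr (Subtype.ext (ft_bd x).symm))
  W {n} X := (sliceHom (E := E) (X := E.frame.ft X)
    (Y := (⟨(E.individual X).left, (congrArg E.strat.len (E.individual_left X)).trans X.2⟩ :
      E.frame.B (n + 1))) (E.W (E.individual X).hom) (E.W_strat (E.individual X).hom)).comp
      (E.frame.sliceCongr (Subtype.ext (E.individual_left X)))
  δ {n} X := ⟨E.mkTerm ((E.W (E.individual X).hom).obj (Over.mk (E.individual X).hom)).hom
      (E.idt (E.individual X).hom),
    IsStrat.len (E := E) (X := E.frame.ft X)
      (Y := (⟨(E.individual X).left, (congrArg E.strat.len (E.individual_left X)).trans X.2⟩ :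
        E.frame.B (n + 1))) (E.W_strat (E.individual X).hom) (m := 1)
        (Over.mk (E.individual X).hom) ((congrArg E.strat.len (E.individual_left X)).trans X.2),
    (congrArg E.strat.len (E.individual_left X)).trans X.2⟩
  bd_δ {n} X := Subtype.ext (val_sliceHom (E := E) (X := E.frame.ft X)
    (Y := (⟨(E.individual X).left, (congrArg E.strat.len (E.individual_left X)).trans X.2⟩ :
      E.frame.B (n + 1))) (E.W_strat (E.individual X).hom) ⟨1, ⟨X, rfl⟩⟩
      (P := Over.mk (E.individual X).hom) (E.individual_left X)).symm

end

section

variable {E : StratESystem.{u}}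

theorem ov_of_hom {X Z : E.frame.Ob} (f : val Z ⟶ val X) : Ov X Z := by
  obtain ⟨n, X⟩ := X
  obtain ⟨k, Z⟩ := Z
  have h := E.strat.len_le f
  change E.strat.len X.1 ≤ E.strat.len Z.1 at h
  rw [X.2, Z.2] at h
  obtain ⟨m, rfl⟩ := Nat.exists_eq_add_of_le h
  refine ov_iff.2 ⟨m, Nat.le_add_left _ _, ?_⟩
  rw [par_iter_mk]
  exact congrArg (Sigma.mk n) (ftn_eq_of_arrow f)

theorem val_par_bdT (z : E.frame.Tm) : val (par (bdT z)) = (valT z).1.right := ft_bd z.2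

theorem sov_of_term {X : E.frame.Ob} {z : E.frame.Tm} (x : (E.toTermCat.slice (val X)).Term)
    (hx : TermCat.forget x = valT z) : SOv X (bdT z) := by
  refine ⟨Nat.succ_pos _, ov_of_hom (eqToHom ?_ ≫ x.1.right.hom)⟩
  rw [val_par_bdT, ← hx]; rfl

theorem val_sub {x : E.frame.Tm} {Γ Δ : E.Ob} {A : Δ ⟶ Γ} {t : E.T A}
    (hx : valT x = E.mkTerm A t) {Z : E.frame.Ob} {P : Over Δ} (hP : P.left = val Z) :
    val (E.preB.sub x Z) = ((E.S t).obj P).left := by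
  obtain ⟨n, ⟨x, hn⟩⟩ := x
  obtain rfl : x = E.mkTerm A t := hx
  obtain ⟨Z', rfl⟩ : ∃ Z' : (E.frame.slice (⟨Δ, hn.1⟩ : E.frame.B (n + 1))).Ob, inc Z' = Z :=
    exists_inc (ov_of_hom (eqToHom hP.symm ≫ P.hom))
  refine (congrArg val (PreBSystem.sub_inc (B := E.preB) (⟨E.mkTerm A t, hn⟩ : E.frame.Bt n) Z')).trans ?_
  exact val_sliceHom (E := E) (X := (⟨Δ, hn.1⟩ : E.frame.B (n + 1)))
    (Y := (⟨Γ, hn.2⟩ : E.frame.B n)) (E.S_strat t) Z' hP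

theorem valT_subT {x : E.frame.Tm} {Γ Δ : E.Ob} {A : Δ ⟶ Γ} {t : E.T A}
    (hx : valT x = E.mkTerm A t) {z : E.frame.Tm} {w : (E.toTermCat.slice Δ).Term}
    (hw : TermCat.forget w = valT z) :
    valT (E.preB.subT x z) = TermCat.forget ((E.S t).onTerm w) := by
  obtain ⟨n, ⟨x, hn⟩⟩ := x
  obtain rfl : x = E.mkTerm A t := hx
  obtain ⟨z', rfl⟩ : ∃ z' : (E.frame.slice (⟨Δ, hn.1⟩ : E.frame.B (n + 1))).Tm, incT z' = z :=
    exists_incT (sov_of_term w hw)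
  refine (congrArg valT (PreBSystem.subT_incT (B := E.preB) (⟨E.mkTerm A t, hn⟩ : E.frame.Bt n) z')).trans ?_
  exact valT_sliceHom (E := E) (X := (⟨Δ, hn.1⟩ : E.frame.B (n + 1)))
    (Y := (⟨Γ, hn.2⟩ : E.frame.B n)) (E.S_strat t) z' hw

theorem val_wk {Γ Δ : E.Ob} (A : Δ ⟶ Γ) (hA : E.strat.len Δ = E.strat.len Γ + 1)
    {U : E.frame.Ob} (hU : val U = Δ) {Z : E.frame.Ob} {P : Over Γ} (hP : P.left = val Z) :
    val (E.preB.wk U Z) = ((E.W A).obj P).left := by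
  obtain ⟨n, U, hn⟩ := U
  obtain rfl : U = Δ := hU
  obtain rfl : n = E.strat.len Γ + 1 := hn.symm.trans hA
  have e := E.individual_eq ⟨U, hn⟩ A rfl
  obtain ⟨Z', rfl⟩ : ∃ Z' : (E.frame.slice (E.frame.ft ⟨U, hn⟩)).Ob, inc Z' = Z :=
    exists_inc (ov_of_hom (eqToHom hP.symm ≫ P.hom ≫ eqToHom (congrArg Comma.right e).symm))
  refine (congrArg val (PreBSystem.wk_inc (B := E.preB) (⟨U, hn⟩ : E.frame.B _) Z')).trans ?_
  have key : ∀ (a : Arrow E.Ob) (ha : a = Arrow.mk A) (Q : Over a.right), Q.left = P.left →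
      ((E.W a.hom).obj Q).left = ((E.W A).obj P).left := by
    rintro a rfl Q hQ
    rw [over_ext hQ]
    rfl
  refine Eq.trans ?_ (key _ e (liftO Z'.2) hP.symm)
  rfl

theorem valT_wkT {Γ Δ : E.Ob} (A : Δ ⟶ Γ) (hA : E.strat.len Δ = E.strat.len Γ + 1)
    {U : E.frame.Ob} (hU : val U = Δ) {z : E.frame.Tm} {w : (E.toTermCat.slice Γ).Term}
    (hw : TermCat.forget w = valT z) :
    valT (E.preB.wkT U z) = TermCat.forget ((E.W A).onTerm w) := by
  obtain ⟨n, U, hn⟩ := U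
  obtain rfl : U = Δ := hU
  obtain rfl : n = E.strat.len Γ + 1 := hn.symm.trans hA
  have e := E.individual_eq ⟨U, hn⟩ A rfl
  obtain ⟨z', rfl⟩ : ∃ z' : (E.frame.slice (E.frame.ft ⟨U, hn⟩)).Tm, incT z' = z := by
    refine exists_incT ⟨Nat.succ_pos _, ov_of_hom (eqToHom ?_ ≫ w.1.right.hom ≫
      eqToHom (congrArg Comma.right e).symm)⟩
    rw [val_par_bdT, ← hw]; rfl
  refine (congrArg valT (PreBSystem.wkT_incT (B := E.preB) (⟨U, hn⟩ : E.frame.B _) z')).trans ?_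
  have key : ∀ (a : Arrow E.Ob) (ha : a = Arrow.mk A) (v : (E.toTermCat.slice a.right).Term),
      TermCat.forget v = TermCat.forget w →
      TermCat.forget ((E.W a.hom).onTerm v) = TermCat.forget ((E.W A).onTerm w) := by
    rintro a rfl v hv
    rw [forget_injective hv]
    rfl
  refine Eq.trans ?_ (key _ e (liftT z'.2) hw.symm)
  rfl

theorem valT_gen {Γ Δ : E.Ob} (A : Δ ⟶ Γ) (hA : E.strat.len Δ = E.strat.len Γ + 1)
    {U : E.frame.Ob} (hU : val U = Δ) (h : 0 < U.1) :
    valT (E.preB.gen U h) = E.mkTerm ((E.W A).obj (Over.mk A)).hom (E.idt A) := by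
  obtain ⟨n, U, hn⟩ := U
  obtain rfl : U = Δ := hU
  obtain rfl : n = E.strat.len Γ + 1 := hn.symm.trans hA
  have e := E.individual_eq ⟨U, hn⟩ A rfl
  exact congrArg (fun a : Arrow E.Ob =>
    E.mkTerm ((E.W a.hom).obj (Over.mk a.hom)).hom (E.idt a.hom)) e

end

end StratESystem

namespace StratESystem

open BFrame PreBSystem TermFunctor

section

variable {E : StratESystem.{u}}

theorem exists_liftO {X Z : E.frame.Ob} (h : Ov X Z) : ∃ P : Over (val X), P.left = val Z := by
  obtain ⟨Z', rfl⟩ := exists_inc (X := X.2) h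
  exact ⟨liftO Z'.2, rfl⟩

theorem exists_liftT {X : E.frame.Ob} {z : E.frame.Tm} (h : SOv X (bdT z)) :
    ∃ w : (E.toTermCat.slice (val X)).Term, TermCat.forget w = valT z := by
  obtain ⟨z', rfl⟩ := exists_incT (X := X.2) h
  exact ⟨liftT z'.2, rfl⟩

/-- An object of a slice of a slice. -/
theorem exists_liftO_liftO {X : E.frame.Ob} {U Z : E.frame.Ob} (P : Over (val X))
    (hP : P.left = val U) (h : Ov U Z) : ∃ Q : Over P, Q.left.left = val Z := by
  obtain ⟨R, hR⟩ := exists_liftO h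
  exact ⟨(Over.iteratedSliceBackward P).obj (Over.mk (R.hom ≫ eqToHom hP.symm)), hR⟩

theorem exists_liftT_liftT {X : E.frame.Ob} {U : E.frame.Ob} {z : E.frame.Tm} (P : Over (val X))
    (hP : P.left = val U) (h : SOv U (bdT z)) :
    ∃ w : ((E.toTermCat.slice (val X)).slice P).Term,
      TermCat.forget (TermCat.forget w) = valT z := by
  obtain ⟨P, ⟨⟨⟩⟩, p⟩ := P
  obtain rfl : P = val U := hP
  obtain ⟨w, hw⟩ := exists_liftT h
  exact ⟨(sliceUp (Over.mk p)).onTerm w, hw⟩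

theorem ov_inc_inc {F : BFrame.{u}} {n m : ℕ} {X : F.B n} {Y : (F.slice X).B m}
    (Z : ((F.slice X).slice Y).Ob) : Ov (inc (⟨m, Y⟩ : (F.slice X).Ob)) (inc (inc Z)) := by
  rw [← inc_sliceDown]; exact ov_inc _

theorem sov_incT_incT {F : BFrame.{u}} {n m : ℕ} {X : F.B n} {Y : (F.slice X).B m}
    (z : ((F.slice X).slice Y).Tm) :
    SOv (inc (⟨m, Y⟩ : (F.slice X).Ob)) (bdT (incT (incT z))) := by
  rw [← incT_sliceDown]; exact sov_incT _

/-- Stratified homomorphisms between slices induce pre-B-homomorphisms. -/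
theorem isHom_sliceHom {n k : ℕ} {X : E.frame.B n} {Y : E.frame.B k}
    {F : TermFunctor (E.toTermCat.slice X.1) (E.toTermCat.slice Y.1)} (hF : IsStrat F)
    (h : PreESystem.IsHom (E := E.toPreESystem.slice X.1) (D := E.toPreESystem.slice Y.1) F) :
    PreBSystem.IsHom (F := E.preB.slice X) (G := E.preB.slice Y) (sliceHom F hF) where
  sub {m} x := by
    let φ : (liftT x).1.left ⟶ (liftT x).1.right := (liftT x).1.hom
    let t : (E.toTermCat.slice X.1).T φ := (liftT x).2
    let H := sliceHom F hF
    have ex : valT (incT (⟨m, x⟩ : (E.frame.slice X).Tm)) = E.mkTerm φ.left t := rfl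
    have ex' : valT (incT (⟨m, H.tm x⟩ : (E.frame.slice Y).Tm)) =
      E.mkTerm (F.map φ).left (F.tm t) := rfl
    refine Hom.ext_total (fun Z => ?_) (fun z => ?_)
    · refine inc_injective (inc_injective (val_injective ?_))
      obtain ⟨Q, hQ⟩ := exists_liftO_liftO (X := ⟨n, X⟩) (liftT x).1.left rfl (ov_inc_inc Z)
      have e := congrArg (fun K => (K.obj Q).left.left) (h.sub t)
      refine Eq.trans ?_ (e.symm.trans ?_)
      · refine (congrArg val (slice_sub (B := E.preB) (H.tm x) (((H.slice _).comp
          ((E.frame.slice Y).sliceCongr (H.bd_tm x).symm)).total Z))).trans ?_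
        exact val_sub ex' (P := Over.mk (F.map Q.hom).left)
          (val_sliceHom hF (inc Z) (P := Q.left) hQ).symm
      · refine (val_sliceHom hF (inc (((E.preB.slice X).S x).total Z)) ?_).symm
        refine Eq.trans ?_ (congrArg val (slice_sub (B := E.preB) x Z)).symm
        exact (val_sub ex (P := Over.mk Q.hom.left) hQ).symm
    · refine incT_injective (incT_injective (valT_injective ?_))
      obtain ⟨w, hw⟩ := exists_liftT_liftT (X := ⟨n, X⟩) (liftT x).1.left rfl (sov_incT_incT z)
      have e := congrArg (fun K => TermCat.forget (TermCat.forget (K.onTerm w))) (h.sub t)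
      refine Eq.trans ?_ (e.symm.trans ?_)
      · refine (congrArg valT (slice_subT (B := E.preB) (H.tm x) (((H.slice _).comp
          ((E.frame.slice Y).sliceCongr (H.bd_tm x).symm)).totalT z))).trans ?_
        exact valT_subT ex' (w := (sliceDown (F.obj (liftT x).1.left)).onTerm
          ((F.slice (liftT x).1.left).onTerm w))
          (valT_sliceHom hF (incT z) (x := TermCat.forget w) hw).symm
      · refine (valT_sliceHom hF (incT (((E.preB.slice X).S x).totalT z))
          (x := TermCat.forget (((E.toPreESystem.slice X.1).S t).onTerm w)) ?_).symm
        refine Eq.trans ?_ (congrArg valT (slice_subT (B := E.preB) x z)).symm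
        exact (valT_subT ex (w := (sliceDown (liftT x).1.left).onTerm w) hw).symm
  wk {m} U := by
    obtain ⟨f⟩ := exists_arrow_ft (E := E) (n := n + m) U.1
    let φ : liftO U ⟶ liftO ((E.frame.slice X).ft U) :=
      Over.homMk f (E.strat.thin E.root_isTerminal (X := U.1.1) (Y := X.1) _ _)
    let H := sliceHom F hF
    have hA : E.strat.len (liftO U).left = E.strat.len (liftO ((E.frame.slice X).ft U)).left + 1 :=
      U.1.2.trans (congrArg (· + 1) (E.frame.ft U.1).2).symm
    have hA' : E.strat.len (F.obj (liftO U)).left =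
        E.strat.len (F.obj (liftO ((E.frame.slice X).ft U))).left + 1 :=
      (H.ob U).1.2.trans (congrArg (· + 1) (H.ob ((E.frame.slice X).ft U)).1.2).symm
    refine Hom.ext_total (fun Z => ?_) (fun z => ?_)
    · refine inc_injective (inc_injective (val_injective ?_))
      obtain ⟨Q, hQ⟩ := exists_liftO_liftO (X := ⟨n, X⟩) (liftO ((E.frame.slice X).ft U)) rfl
        (ov_inc_inc Z)
      have e := congrArg (fun K => (K.obj Q).left.left) (h.wk φ)
      refine Eq.trans ?_ (e.symm.trans ?_)
      · refine (congrArg val (slice_wk (B := E.preB) (H.ob U) (((H.slice _).comp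
          ((E.frame.slice Y).sliceCongr (H.ft_ob U).symm)).total Z))).trans ?_
        exact val_wk (F.map φ).left hA' rfl (P := Over.mk (F.map Q.hom).left)
          (val_sliceHom hF (inc Z) (P := Q.left) hQ).symm
      · refine (val_sliceHom hF (inc (((E.preB.slice X).W U).total Z)) ?_).symm
        refine Eq.trans ?_ (congrArg val (slice_wk (B := E.preB) U Z)).symm
        exact (val_wk φ.left hA rfl (P := Over.mk Q.hom.left) hQ).symm
    · refine incT_injective (incT_injective (valT_injective ?_))
      obtain ⟨w, hw⟩ := exists_liftT_liftT (X := ⟨n, X⟩) (liftO ((E.frame.slice X).ft U)) rfl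
        (sov_incT_incT z)
      have e := congrArg (fun K => TermCat.forget (TermCat.forget (K.onTerm w))) (h.wk φ)
      refine Eq.trans ?_ (e.symm.trans ?_)
      · refine (congrArg valT (slice_wkT (B := E.preB) (H.ob U) (((H.slice _).comp
          ((E.frame.slice Y).sliceCongr (H.ft_ob U).symm)).totalT z))).trans ?_
        exact valT_wkT (F.map φ).left hA' rfl
          (w := (sliceDown (F.obj (liftO ((E.frame.slice X).ft U)))).onTerm
            ((F.slice (liftO ((E.frame.slice X).ft U))).onTerm w))
          (valT_sliceHom hF (incT z) (x := TermCat.forget w) hw).symm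
      · refine (valT_sliceHom hF (incT (((E.preB.slice X).W U).totalT z))
          (x := TermCat.forget (((E.toPreESystem.slice X.1).W φ).onTerm w)) ?_).symm
        refine Eq.trans ?_ (congrArg valT (slice_wkT (B := E.preB) U z)).symm
        exact (valT_wkT φ.left hA rfl
          (w := (sliceDown (liftO ((E.frame.slice X).ft U))).onTerm w) hw).symm
  gen {m} U := by
    obtain ⟨f⟩ := exists_arrow_ft (E := E) (n := n + m) U.1
    let φ : liftO U ⟶ liftO ((E.frame.slice X).ft U) :=
      Over.homMk f (E.strat.thin E.root_isTerminal (X := U.1.1) (Y := X.1) _ _)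
    let H := sliceHom F hF
    have hA : E.strat.len (liftO U).left = E.strat.len (liftO ((E.frame.slice X).ft U)).left + 1 :=
      U.1.2.trans (congrArg (· + 1) (E.frame.ft U.1).2).symm
    have hA' : E.strat.len (F.obj (liftO U)).left =
        E.strat.len (F.obj (liftO ((E.frame.slice X).ft U))).left + 1 :=
      (H.ob U).1.2.trans (congrArg (· + 1) (H.ob ((E.frame.slice X).ft U)).1.2).symm
    refine sigma_mk_injective (incT_injective (valT_injective ?_))
    have e := congrArg TermCat.forget (h.idt φ)
    refine Eq.trans ?_ (e.trans ?_)
    · refine valT_sliceHom hF (⟨m + 1, (E.preB.slice X).δ U⟩ : (E.frame.slice X).Tm)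
        (x := (E.toTermCat.slice X.1).mkTerm _ ((E.toPreESystem.slice X.1).idt φ)) ?_
      exact (valT_gen φ.left hA (U := inc (⟨m + 1, U⟩ : (E.frame.slice X).Ob)) rfl
        (Nat.succ_pos _)).symm
    · exact (valT_gen (F.map φ).left hA' (U := inc (⟨m + 1, H.ob U⟩ : (E.frame.slice Y).Ob)) rfl
        (Nat.succ_pos _)).symm

end

end StratESystem

namespace StratESystem

open BFrame PreBSystem TermFunctor

theorem isHom_congr {A B : PreBSystem.{u}} {n k : ℕ} {X : A.B n} {Y Y' : B.B k} (h : Y = Y')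
    {H : BFrame.Hom (A.toBFrame.slice X) (B.toBFrame.slice Y)}
    (hH : PreBSystem.IsHom (F := A.slice X) (G := B.slice Y) H) :
    PreBSystem.IsHom (F := A.slice X) (G := B.slice Y') (H.comp (B.toBFrame.sliceCongr h)) := by
  subst h
  exact hH

/-- The B-system of a stratified E-system. -/
noncomputable abbrev bSystem (E : StratESystem.{u}) : BSystem.{u} where
  toPreBSystem := E.preB
  S_isHom {n} x := isHom_congr (A := E.preB) (B := E.preB) (Subtype.ext (ft_bd x).symm)
    (isHom_sliceHom (X := E.frame.bd x) (Y := (⟨x.1.1.right, x.2.2⟩ : E.frame.B n))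
      (E.S_strat x.1.2) (E.S_isHom x.1.2))
  W_isHom {n} X := isHom_congr (A := E.preB) (B := E.preB) (Subtype.ext (E.individual_left X))
    (isHom_sliceHom (X := E.frame.ft X)
      (Y := (⟨(E.individual X).left, (congrArg E.strat.len (E.individual_left X)).trans X.2⟩ :
        E.frame.B (n + 1))) (E.W_strat (E.individual X).hom) (E.W_isHom (E.individual X).hom))
  W_comp_S {n} x := by
    have hA : E.strat.len x.1.1.left = E.strat.len x.1.1.right + 1 :=
      x.2.1.trans (congrArg (· + 1) x.2.2).symm
    have hr : (⟨n, E.frame.ft (E.frame.bd x)⟩ : E.frame.Ob) = ⟨n, ⟨x.1.1.right, x.2.2⟩⟩ :=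
      congrArg (Sigma.mk n) (Subtype.ext (ft_bd x))
    refine Hom.ext_total (fun Z => inc_injective (val_injective ?_))
      (fun z => incT_injective (valT_injective ?_))
    · have hZ := ov_inc (F := E.frame) Z
      rw [hr] at hZ
      obtain ⟨P, hP⟩ := exists_liftO hZ
      have e := congrArg (fun K => (K.obj P).left) (E.W_comp_S x.1.2)
      refine Eq.trans ?_ (e.trans hP)
      refine (congrArg val (sub_inc (B := E.preB) x
        ((E.preB.W (E.preB.bd x)).total Z))).symm.trans ?_
      refine val_sub (x := ⟨n, x⟩) rfl ?_
      refine Eq.trans ?_ (congrArg val (wk_inc (B := E.preB) (E.preB.bd x) Z))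
      exact (val_wk x.1.1.hom hA rfl hP).symm
    · have hz := sov_incT (F := E.frame) z
      rw [hr] at hz
      obtain ⟨w, hw⟩ := exists_liftT hz
      have e := congrArg (fun K => TermCat.forget (K.onTerm w)) (E.W_comp_S x.1.2)
      refine Eq.trans ?_ (e.trans hw)
      refine (congrArg valT (subT_incT (B := E.preB) x
        ((E.preB.W (E.preB.bd x)).totalT z))).symm.trans ?_
      refine valT_subT (x := ⟨n, x⟩) rfl (w := (E.W x.1.1.hom).onTerm w) ?_
      refine Eq.trans ?_ (congrArg valT (wkT_incT (B := E.preB) (E.preB.bd x) z))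
      exact (valT_wkT x.1.1.hom hA rfl hw).symm
  S_δ {n} x := by
    have hA : E.strat.len x.1.1.left = E.strat.len x.1.1.right + 1 :=
      x.2.1.trans (congrArg (· + 1) x.2.2).symm
    refine sigma_mk_injective (valT_injective ?_)
    refine (congrArg valT (subT_incT (B := E.preB) x
      ⟨0, ⟨E.preB.δ (E.preB.bd x), E.preB.ft_bd_δ _⟩⟩)).symm.trans ?_
    refine (valT_subT (x := ⟨n, x⟩) rfl (w := (E.toTermCat.slice x.1.1.left).mkTerm
      (X := (E.W x.1.1.hom).obj (Over.mk x.1.1.hom)) (Y := Over.mk (𝟙 x.1.1.left))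
      (Over.homMk ((E.W x.1.1.hom).obj (Over.mk x.1.1.hom)).hom (Category.comp_id _))
      (E.idt x.1.1.hom)) ?_).trans (E.S_idt x.1.2)
    exact (valT_gen x.1.1.hom hA (U := ⟨n + 1, E.frame.bd x⟩) rfl (Nat.succ_pos _)).symm
  W_slice_comp_S_δ {n} X := by
    obtain ⟨f⟩ := exists_arrow_ft X
    have hA : E.strat.len X.1 = E.strat.len (E.frame.ft X).1 + 1 :=
      X.2.trans (congrArg (· + 1) (E.frame.ft X).2).symm
    have hg : valT ⟨n + 1, E.preB.δ X⟩ = E.mkTerm ((E.W f).obj (Over.mk f)).hom (E.idt f) :=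
      valT_gen f hA (U := ⟨n + 1, X⟩) rfl (Nat.succ_pos _)
    let Y : (E.frame.slice (E.frame.ft X)).B 1 := ⟨X, rfl⟩
    refine Hom.ext_total (fun Z => inc_injective (val_injective ?_))
      (fun z => incT_injective (valT_injective ?_))
    · obtain ⟨P, hP⟩ := exists_liftO (ov_inc (F := E.frame) Z)
      have e := congrArg (fun K => (K.obj P).left) (E.W_slice_comp_S_idt f)
      refine Eq.trans ?_ (e.trans hP)
      let Z1 := (((E.preB.W X).slice (n := 1) Y)).total ((E.frame.sliceUp Y).total Z)
      let Z2 := (E.frame.sliceCongr (E.preB.bd_δ X).symm).total ((E.frame.sliceDown _).total Z1)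
      refine (congrArg val (sub_inc (B := E.preB) (E.preB.δ X) Z2)).symm.trans ?_
      have e1 : inc Z2 = inc (inc Z1) := inc_sliceDown _ _
      refine val_sub hg (P := ((sliceUp (C := E.toTermCat) (Over.mk f)).comp
        (((E.W f).slice (Over.mk f)).comp (sliceDown _))).obj P) ?_
      rw [e1]
      refine Eq.trans ?_ (congrArg val (wk_inc (B := E.preB) X (inc ((E.frame.sliceUp Y).total Z))))
      exact (val_wk f hA (U := ⟨n + 1, X⟩) rfl (P := Over.mk (P.hom ≫ f))
        (hP.trans (congrArg val (inc_sliceUp Y Z).symm))).symm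
    · obtain ⟨w, hw⟩ := exists_liftT (sov_incT (F := E.frame) z)
      have e := congrArg (fun K => TermCat.forget (K.onTerm w)) (E.W_slice_comp_S_idt f)
      refine Eq.trans ?_ (e.trans hw)
      let Z1 := (((E.preB.W X).slice (n := 1) Y)).totalT ((E.frame.sliceUp Y).totalT z)
      let Z2 := (E.frame.sliceCongr (E.preB.bd_δ X).symm).totalT ((E.frame.sliceDown _).totalT Z1)
      refine (congrArg valT (subT_incT (B := E.preB) (E.preB.δ X) Z2)).symm.trans ?_
      have e1 : incT Z2 = incT (incT Z1) := incT_sliceDown _ _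
      refine valT_subT hg (w := ((sliceUp (C := E.toTermCat) (Over.mk f)).comp
        (((E.W f).slice (Over.mk f)).comp (sliceDown _))).onTerm w) ?_
      rw [e1]
      refine Eq.trans ?_
        (congrArg valT (wkT_incT (B := E.preB) X (incT ((E.frame.sliceUp Y).totalT z))))
      exact (valT_wkT f hA (U := ⟨n + 1, X⟩) rfl
        (w := TermCat.forget ((sliceUp (C := E.toTermCat) (Over.mk f)).onTerm w))
        (hw.trans (congrArg valT (incT_sliceUp Y z).symm))).symm

section

variable {E D : StratESystem.{u}}

/-- The homomorphism of B-frames induced by a stratified functor with term structure. -/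
noncomputable def frameHom (F : TermFunctor E.toTermCat D.toTermCat)
    (hF : ∀ X : E.Ob, D.strat.len (F.obj X) = E.strat.len X) : BFrame.Hom E.frame D.frame where
  ob X := ⟨F.obj X.1, (hF X.1).trans X.2⟩
  tm x := ⟨F.onTerm x.1, (hF _).trans x.2.1, (hF _).trans x.2.2⟩
  ft_ob {n} X := by
    obtain ⟨f⟩ := exists_arrow_ft X
    exact ftn_eq_of_arrow (n := n) (m := 1) (F.map f)
  bd_tm x := rfl

theorem isHom_frameHom {F : TermFunctor E.toTermCat D.toTermCat}
    (hF : ∀ X : E.Ob, D.strat.len (F.obj X) = E.strat.len X)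
    (h : PreESystem.IsHom (E := E.toPreESystem) (D := D.toPreESystem) F) :
    PreBSystem.IsHom (F := E.preB) (G := D.preB) (frameHom F hF) where
  sub {m} x := by
    let H := frameHom F hF
    have ex' : valT (⟨m, H.tm x⟩ : D.frame.Tm) = D.mkTerm (F.map x.1.1.hom) (F.tm x.1.2) := rfl
    refine Hom.ext_total (fun Z => ?_) (fun z => ?_)
    · refine inc_injective (val_injective ?_)
      obtain ⟨Q, hQ⟩ := exists_liftO (ov_inc (F := E.frame) Z)
      have e := congrArg (fun K => (K.obj Q).left) (h.sub x.1.2)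
      refine Eq.trans ?_ (e.symm.trans ?_)
      · refine (congrArg val (sub_inc (B := D.preB) (H.tm x) (((H.slice _).comp
          (D.frame.sliceCongr (H.bd_tm x).symm)).total Z))).symm.trans ?_
        exact val_sub ex' (P := Over.mk (F.map Q.hom)) (congrArg F.obj hQ)
      · refine congrArg F.obj ?_
        refine Eq.trans ?_ (congrArg val (sub_inc (B := E.preB) x Z))
        exact (val_sub (x := ⟨m, x⟩) rfl hQ).symm
    · refine incT_injective (valT_injective ?_)
      obtain ⟨w, hw⟩ := exists_liftT (sov_incT (F := E.frame) z)
      have e := congrArg (fun K => TermCat.forget (K.onTerm w)) (h.sub x.1.2)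
      refine Eq.trans ?_ (e.symm.trans ?_)
      · refine (congrArg valT (subT_incT (B := D.preB) (H.tm x) (((H.slice _).comp
          (D.frame.sliceCongr (H.bd_tm x).symm)).totalT z))).symm.trans ?_
        exact valT_subT ex' (w := (F.slice _).onTerm w) (congrArg F.onTerm hw)
      · refine congrArg (a₁ := TermCat.forget ((E.S x.1.2).onTerm w))
          (a₂ := valT (incT ((E.preB.S x).totalT z))) F.onTerm ?_
        refine Eq.trans ?_ (congrArg valT (subT_incT (B := E.preB) x z))
        exact (valT_subT (x := ⟨m, x⟩) rfl hw).symm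
  wk {m} U := by
    obtain ⟨f⟩ := exists_arrow_ft U
    let H := frameHom F hF
    have hA : E.strat.len U.1 = E.strat.len (E.frame.ft U).1 + 1 :=
      U.2.trans (congrArg (· + 1) (E.frame.ft U).2).symm
    have hA' : D.strat.len (F.obj U.1) = D.strat.len (F.obj (E.frame.ft U).1) + 1 :=
      (H.ob U).2.trans (congrArg (· + 1) (H.ob (E.frame.ft U)).2).symm
    refine Hom.ext_total (fun Z => ?_) (fun z => ?_)
    · refine inc_injective (val_injective ?_)
      obtain ⟨Q, hQ⟩ := exists_liftO (ov_inc (F := E.frame) Z)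
      have e := congrArg (fun K => (K.obj Q).left) (h.wk f)
      refine Eq.trans ?_ (e.symm.trans ?_)
      · refine (congrArg val (wk_inc (B := D.preB) (H.ob U) (((H.slice _).comp
          (D.frame.sliceCongr (H.ft_ob U).symm)).total Z))).symm.trans ?_
        exact val_wk (F.map f) hA' rfl (P := Over.mk (F.map Q.hom)) (congrArg F.obj hQ)
      · refine congrArg F.obj ?_
        refine Eq.trans ?_ (congrArg val (wk_inc (B := E.preB) U Z))
        exact (val_wk f hA rfl hQ).symm
    · refine incT_injective (valT_injective ?_)
      obtain ⟨w, hw⟩ := exists_liftT (sov_incT (F := E.frame) z)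
      have e := congrArg (fun K => TermCat.forget (K.onTerm w)) (h.wk f)
      refine Eq.trans ?_ (e.symm.trans ?_)
      · refine (congrArg valT (wkT_incT (B := D.preB) (H.ob U) (((H.slice _).comp
          (D.frame.sliceCongr (H.ft_ob U).symm)).totalT z))).symm.trans ?_
        exact valT_wkT (F.map f) hA' rfl (w := (F.slice _).onTerm w) (congrArg F.onTerm hw)
      · refine congrArg (a₁ := TermCat.forget ((E.W f).onTerm w))
          (a₂ := valT (incT ((E.preB.W U).totalT z))) F.onTerm ?_
        refine Eq.trans ?_ (congrArg valT (wkT_incT (B := E.preB) U z))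
        exact (valT_wkT f hA rfl hw).symm
  gen {m} U := by
    obtain ⟨f⟩ := exists_arrow_ft U
    let H := frameHom F hF
    have hA : E.strat.len U.1 = E.strat.len (E.frame.ft U).1 + 1 :=
      U.2.trans (congrArg (· + 1) (E.frame.ft U).2).symm
    have hA' : D.strat.len (F.obj U.1) = D.strat.len (F.obj (E.frame.ft U).1) + 1 :=
      (H.ob U).2.trans (congrArg (· + 1) (H.ob (E.frame.ft U)).2).symm
    refine sigma_mk_injective (valT_injective ?_)
    refine Eq.trans (congrArg (a₂ := E.mkTerm ((E.W f).obj (Over.mk f)).hom (E.idt f))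
      F.onTerm ?_) ((h.idt f).trans ?_)
    · exact valT_gen f hA (U := ⟨m + 1, U⟩) rfl (Nat.succ_pos _)
    · exact (valT_gen (F.map f) hA' (U := ⟨m + 1, H.ob U⟩) rfl (Nat.succ_pos _)).symm

end

end StratESystem

/-- The functor from stratified E-systems to B-systems. It sends a stratified E-system to its sets
of objects of length `n` and its sets of terms of individual arrows; a homomorphism acts as its
underlying functor with term structure. -/
noncomputable def E2B : StratESystem.{u} ⥤ BSystem.{u} where
  obj E := E.bSystem
  map F := ⟨StratESystem.frameHom F.toTermFunctor F.strat,
    StratESystem.isHom_frameHom F.strat F.isHom⟩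

/-!
Natural isomorphisms `𝟭 ≅ B2E ⋙ E2B` and `𝟭 ≅ E2B ⋙ B2E` make `B2E` and `E2B` mutually inverse
equivalences, and an equivalence is full and faithful. Both isomorphisms have explicit components.

For a B-system `B`, the map that sends `z` to the one-element list `[z]`, a term of the individual
arrow with domain `∂z`, is a bijective homomorphism from `B` to the B-system of `B2E(B)`
(`BSystem.toSingle_isHom`, `BSystem.singleIso`), because iterated substitution and weakening of
length one are substitution and weakening. The inverse of a bijective homomorphism is a
homomorphism.

For a stratified E-system `E`, a term `x ∈ T(A)` of an arrow `A : Δ ⟶ Γ` that is not individual has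
to be decomposed into terms of individual arrows. In a B-system as in an E-system, a homomorphism
`H` from the slice over `Δ` to the slice over `Γ` with `H ∘ W_A = id` is substitution of the value
of `H` at the generic element: applying `H` to `S_{idt A} ∘ W_A/A = id` gives
`H = S_{H(idt A)} ∘ (H ∘ W_A)/A = S_{H(idt A)}`. The homomorphism `S_x` restricts to the B-system
of `E`, where it is therefore the iterated substitution of the list `comps x` of its values at the
iterated generic elements (`BSystem.section_eq_subs`, `StratESystem.comps_spec`).

The map `comps` from `T(A)` to the iterated terms is injective: iterated substitution of the generic
elements also undoes weakening for terms of arbitrary arrows (`subsTm_gens_wk`), so that `S_x`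
agrees on arbitrary terms with iterated substitution of `comps x` (`subTm_eq_subsTm_comps`), and
`x = S_x(idt A)`. It is surjective: the iterated term `t` is the list of components of the term
`S_t(idt A)` (`exists_comps_eq`). As homomorphisms preserve the iterated generic elements, they
commute with taking components (`comps_actTm`, `comps_onTerm`); this makes `comps` a homomorphism of
pre-E-systems, natural in `E`.
-/

/-! ### Functors between slices, elementwise -/

namespace StratESystem

open BFrame PreBSystem TermFunctor

section

variable {E : StratESystem.{u}} {X Y Z : E.Ob}

open Classical in
/-- The action on objects of a functor between slices, extended by the identity to the objects
that do not lie over `X`. -/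
noncomputable def actOb (F : TermFunctor (E.toTermCat.slice X) (E.toTermCat.slice Y))
    (Q : E.Ob) : E.Ob :=
  if h : ∃ P : Over X, P.left = Q then (F.obj h.choose).left else Q

open Classical in
/-- The action on terms of a functor between slices, extended by the identity to the terms that
do not lie over `X`. -/
noncomputable def actTm (F : TermFunctor (E.toTermCat.slice X) (E.toTermCat.slice Y))
    (v : E.Term) : E.Term :=
  if h : ∃ w : (E.toTermCat.slice X).Term, TermCat.forget w = v then
    TermCat.forget (F.onTerm h.choose) else v

theorem actOb_left (F : TermFunctor (E.toTermCat.slice X) (E.toTermCat.slice Y)) (P : Over X) :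
    actOb F P.left = (F.obj P).left := by
  have h : ∃ Q : Over X, Q.left = P.left := ⟨P, rfl⟩
  rw [actOb, dif_pos h, over_ext h.choose_spec]

theorem actTm_forget (F : TermFunctor (E.toTermCat.slice X) (E.toTermCat.slice Y))
    (w : (E.toTermCat.slice X).Term) :
    actTm F (TermCat.forget w) = TermCat.forget (F.onTerm w) := by
  have h : ∃ w' : (E.toTermCat.slice X).Term, TermCat.forget w' = TermCat.forget w := ⟨w, rfl⟩
  rw [actTm, dif_pos h, forget_injective h.choose_spec]

/-- An object with an arrow to `X`, as an object of the slice. -/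
theorem exists_over {Q : E.Ob} (f : Q ⟶ X) : ∃ P : Over X, P.left = Q := ⟨Over.mk f, rfl⟩

/-- A term whose codomain has an arrow to `X`, as a term of the slice. -/
theorem exists_forget {v : E.Term} (f : v.1.right ⟶ X) :
    ∃ w : (E.toTermCat.slice X).Term, TermCat.forget w = v :=
  ⟨(E.toTermCat.slice X).mkTerm (X := Over.mk (v.1.hom ≫ f)) (Y := Over.mk f)
    (Over.homMk v.1.hom rfl) v.2, rfl⟩

theorem actOb_comp (F : TermFunctor (E.toTermCat.slice X) (E.toTermCat.slice Y))
    (G : TermFunctor (E.toTermCat.slice Y) (E.toTermCat.slice Z)) {Q : E.Ob} (f : Q ⟶ X) :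
    actOb (F.comp G) Q = actOb G (actOb F Q) := by
  obtain ⟨P, rfl⟩ := exists_over f
  rw [actOb_left, actOb_left, actOb_left]
  rfl

theorem actTm_comp (F : TermFunctor (E.toTermCat.slice X) (E.toTermCat.slice Y))
    (G : TermFunctor (E.toTermCat.slice Y) (E.toTermCat.slice Z)) {v : E.Term}
    (f : v.1.right ⟶ X) : actTm (F.comp G) v = actTm G (actTm F v) := by
  obtain ⟨w, rfl⟩ := exists_forget f
  rw [actTm_forget, actTm_forget]
  exact (actTm_forget G (F.onTerm w)).symm

theorem actOb_id {Q : E.Ob} (f : Q ⟶ X) :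
    actOb (TermFunctor.id (E.toTermCat.slice X)) Q = Q := by
  obtain ⟨P, rfl⟩ := exists_over f
  exact actOb_left _ _

theorem actTm_id {v : E.Term} (f : v.1.right ⟶ X) :
    actTm (TermFunctor.id (E.toTermCat.slice X)) v = v := by
  obtain ⟨w, rfl⟩ := exists_forget f
  exact actTm_forget _ _

/-- The domain of `F(v)`. -/
theorem actTm_left (F : TermFunctor (E.toTermCat.slice X) (E.toTermCat.slice Y)) {v : E.Term}
    (f : v.1.right ⟶ X) : (actTm F v).1.left = actOb F v.1.left := by
  obtain ⟨w, rfl⟩ := exists_forget f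
  rw [actTm_forget]
  exact (actOb_left F w.1.left).symm

/-- The codomain of `F(v)`. -/
theorem actTm_right (F : TermFunctor (E.toTermCat.slice X) (E.toTermCat.slice Y)) {v : E.Term}
    (f : v.1.right ⟶ X) : (actTm F v).1.right = actOb F v.1.right := by
  obtain ⟨w, rfl⟩ := exists_forget f
  rw [actTm_forget]
  exact (actOb_left F w.1.right).symm

/-- Substitution of the term `x` in terms; meaningful on the terms over the domain of `x`. -/
noncomputable def subTm (x v : E.Term) : E.Term := actTm (E.S x.2) v

/-- Substitution of the term `x` in objects; meaningful on the objects over the domain of `x`. -/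
noncomputable def subOb (x : E.Term) (Q : E.Ob) : E.Ob := actOb (E.S x.2) Q

/-- Homomorphisms between slices preserve substitution in arbitrary terms. -/
theorem actTm_subTm {F : TermFunctor (E.toTermCat.slice X) (E.toTermCat.slice Y)}
    (hF : PreESystem.IsHom (E := E.toPreESystem.slice X) (D := E.toPreESystem.slice Y) F)
    {x v : E.Term} (f : x.1.right ⟶ X) (g : v.1.right ⟶ x.1.left) :
    actTm F (subTm x v) = subTm (actTm F x) (actTm F v) := by
  obtain ⟨x, rfl⟩ := exists_forget f
  obtain ⟨v, rfl⟩ := exists_forget g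
  have e := congrArg (fun K => TermCat.forget (TermCat.forget
    (K.onTerm ((sliceUp x.1.left).onTerm v)))) (hF.sub x.2)
  refine Eq.trans ?_ (e.trans ?_)
  · rw [subTm, actTm_forget]
    exact actTm_forget F (TermCat.forget ((sliceUp x.1.right).onTerm ((E.S x.2).onTerm v)))
  · rw [actTm_forget]
    have e1 := actTm_forget F (TermCat.forget ((sliceUp x.1.left).onTerm v))
    refine Eq.trans ?_ (congrArg (subTm _) e1).symm
    exact (actTm_forget (E.S (F.tm x.2)) ((sliceDown (F.obj x.1.left)).onTerm
      ((F.slice x.1.left).onTerm ((sliceUp x.1.left).onTerm v)))).symm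

end

end StratESystem

/-! ### Sections of weakening and the action on the B-frame -/

namespace BSystem

open BFrame PreBSystem

/-- A section of iterated weakening is iterated substitution: its components are its values at the
generic elements. -/
theorem section_eq_subs {B : BSystem.{u}} {X : B.Ob} {k : ℕ} (hk : k ≤ X.1) {f : B.Ob → B.Ob}
    {g : B.Tm → B.Tm}
    (h : IsOp (A := B.toPreBSystem) (B := B.toPreBSystem) X (par^[k] X) f g)
    (hf : ∀ {Z}, Ov (par^[k] X) Z → f (B.wks X k Z) = Z)
    (hg : ∀ {z}, SOv (par^[k] X) (bdT z) → g (B.wksT X k z) = z) :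
    B.IsTm X k ((B.gens X k).map g) ∧
      (∀ {Z}, Ov X Z → B.subs ((B.gens X k).map g) Z = f Z) ∧
      (∀ {z}, SOv X (bdT z) → B.subsT ((B.gens X k).map g) z = g z) := by
  have hX : Ov (par^[k] X) X := ov_iff.2 ⟨k, hk, rfl⟩
  have hw := isOp_wks hk
  have hkW : k ≤ (B.wks X k X).1 := hk.trans (hw.ov hX).1
  have hit : Ov X (par^[k] (B.wks X k X)) := by rw [par_iter_wks hk]; exact ov_refl _
  obtain ⟨h1, h2, h3⟩ := gens_spec hk
  refine ⟨?_, fun {Z} hZ => ?_, fun {z} hz => ?_⟩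
  · have := op_isTm h hkW h1 hit
    rwa [hf hX] at this
  · have := op_subs h hkW h1 hit (hw.ov_ov hX hZ)
    rw [h2 hZ, hf (hX.trans hZ)] at this
    exact this.symm
  · have hz' : SOv (par^[k] X) (bdT z) := .trans hX hz
    have := op_subsT h hkW h1 hit (z := B.wksT X k z)
      (by rw [hw.bd hz']; exact hw.sov_sov hX hz)
    rw [h3 hz, hg hz'] at this
    exact this.symm

/-- The generic elements of `(X, k)` lie over `X`. -/
theorem sov_of_mem_gens {B : BSystem.{u}} {X : B.Ob} {k : ℕ} (hk : k ≤ X.1) {z : B.Tm}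
    (hz : z ∈ B.gens X k) : SOv X (bdT z) := by
  have hX : Ov (par^[k] X) X := ov_iff.2 ⟨k, hk, rfl⟩
  have := (gens_spec hk).1.mem (hk.trans ((isOp_wks hk).ov hX).1) z hz
  rwa [par_iter_wks hk] at this

end BSystem

namespace StratESystem

open BFrame PreBSystem TermFunctor

section

variable {E : StratESystem.{u}} {X Y : E.Ob}

/-- An object of `E`, as a node of its B-frame. -/
def node (X : E.Ob) : E.frame.Ob := ⟨E.strat.len X, ⟨X, rfl⟩⟩

theorem node_val (Z : E.frame.Ob) : node (val Z) = Z := val_injective rfl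

theorem hom_of_ov {V Z : E.frame.Ob} (h : Ov V Z) : Nonempty (val Z ⟶ val V) := by
  obtain ⟨P, hP⟩ := exists_liftO h
  exact ⟨eqToHom hP.symm ≫ P.hom⟩

theorem hom_of_sov {V : E.frame.Ob} {z : E.frame.Tm} (h : SOv V (bdT z)) :
    Nonempty ((valT z).1.right ⟶ val V) := by
  obtain ⟨w, hw⟩ := exists_liftT h
  rw [← hw]
  exact ⟨w.1.right.hom⟩

theorem sov_of_hom {V : E.frame.Ob} {z : E.frame.Tm} (f : (valT z).1.right ⟶ val V) :
    SOv V (bdT z) := by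
  obtain ⟨w, hw⟩ := exists_forget f
  exact sov_of_term w hw

theorem par_iter_node (f : X ⟶ Y) : par^[E.strat.len X - E.strat.len Y] (node X) = node Y :=
  (ov_of_hom (X := node Y) (Z := node X) f).2

/-- The action on the nodes of the B-frame of a stratified functor between slices. -/
noncomputable def nodeMap (F : TermFunctor (E.toTermCat.slice X) (E.toTermCat.slice Y))
    (hF : IsStrat F) : E.frame.Ob → E.frame.Ob :=
  act (sliceHom (X := (node X).2) (Y := (node Y).2) F hF)

/-- The action on the terms of the B-frame, that is on the terms of individual arrows, of a
stratified functor between slices. -/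
noncomputable def termMap (F : TermFunctor (E.toTermCat.slice X) (E.toTermCat.slice Y))
    (hF : IsStrat F) : E.frame.Tm → E.frame.Tm :=
  actT (sliceHom (X := (node X).2) (Y := (node Y).2) F hF)

theorem isOp_nodeMap {F : TermFunctor (E.toTermCat.slice X) (E.toTermCat.slice Y)}
    (hF : IsStrat F)
    (h : PreESystem.IsHom (E := E.toPreESystem.slice X) (D := E.toPreESystem.slice Y) F) :
    IsOp (A := E.bSystem.toPreBSystem) (B := E.bSystem.toPreBSystem) (node X) (node Y)
      (nodeMap F hF) (termMap F hF) :=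
  (isHom_sliceHom (X := (node X).2) (Y := (node Y).2) hF h).isOp_slice
    (fun Z => act_inc _ Z) (fun z => actT_incT _ z)

theorem val_nodeMap {F : TermFunctor (E.toTermCat.slice X) (E.toTermCat.slice Y)}
    (hF : IsStrat F) {Z : E.frame.Ob} (h : Ov (node X) Z) :
    val (nodeMap F hF Z) = actOb F (val Z) := by
  obtain ⟨Z, rfl⟩ := exists_inc (X := (node X).2) h
  refine (congrArg val (act_inc _ Z)).trans ?_
  refine (val_sliceHom (X := (node X).2) (Y := (node Y).2) hF Z (P := liftO Z.2) rfl).trans ?_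
  exact (actOb_left F (liftO Z.2)).symm

theorem valT_termMap {F : TermFunctor (E.toTermCat.slice X) (E.toTermCat.slice Y)}
    (hF : IsStrat F) {z : E.frame.Tm} (h : SOv (node X) (bdT z)) :
    valT (termMap F hF z) = actTm F (valT z) := by
  obtain ⟨z, rfl⟩ := exists_incT (X := (node X).2) h
  refine (congrArg valT (actT_incT _ z)).trans ?_
  refine (valT_sliceHom (X := (node X).2) (Y := (node Y).2) hF z (x := liftT z.2) rfl).trans ?_
  exact (actTm_forget F (liftT z.2)).symm

theorem valT_subT_eq {x z : E.frame.Tm} (h : SOv (bdT x) (bdT z)) :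
    valT (E.bSystem.subT x z) = subTm (valT x) (valT z) := by
  obtain ⟨f⟩ := hom_of_sov h
  obtain ⟨w, hw⟩ := exists_forget (X := (valT x).1.left) f
  refine (valT_subT (E := E) (x := x) (t := (valT x).2) rfl hw).trans ?_
  rw [← hw, subTm, actTm_forget]

theorem val_sub_eq {x : E.frame.Tm} {Z : E.frame.Ob} (h : Ov (bdT x) Z) :
    val (E.bSystem.sub x Z) = subOb (valT x) (val Z) := by
  obtain ⟨f⟩ := hom_of_ov h
  refine (val_sub (E := E) (x := x) (t := (valT x).2) rfl (P := Over.mk f) rfl).trans ?_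
  exact (actOb_left _ (Over.mk f)).symm

/-- The iterated weakenings of the associated B-system are given by the functors `W_A`. -/
theorem val_wks {k : ℕ} (A : X ⟶ Y) (hk : E.strat.len X = E.strat.len Y + k) {Z : E.frame.Ob}
    {P : Over Y} (hP : P.left = val Z) :
    val (E.bSystem.wks (node X) k Z) = ((E.W A).obj P).left := by
  induction k generalizing X with
  | zero =>
    obtain ⟨rfl, rfl⟩ := (E.strat.eq_iff A).1 hk
    have e := congrArg (fun K => (K.obj P).left) (E.W_one X)
    exact hP.symm.trans e.symm
  | succ k ih =>
    obtain ⟨p, rfl⟩ := E.strat.exists_chain A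
    cases p with
    | nil => omega
    | @cons _ X' _ f hf p =>
      have e := congrArg (fun K => (K.obj P).left) (E.W_comp p.composite f)
      refine Eq.trans ?_ e.symm
      have hpar : par (node X) = node X' := by
        have := par_iter_node f
        rwa [show E.strat.len X - E.strat.len X' = 1 by omega] at this
      have e1 := ih p.composite (by omega)
      exact val_wk f hf (U := node X) rfl (P := (E.W p.composite).obj P)
        ((congrArg (fun V => val (E.bSystem.wks V k Z)) hpar).trans e1).symm

theorem valT_wksT {k : ℕ} (A : X ⟶ Y) (hk : E.strat.len X = E.strat.len Y + k) {z : E.frame.Tm}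
    {w : (E.toTermCat.slice Y).Term} (hw : TermCat.forget w = valT z) :
    valT (E.bSystem.wksT (node X) k z) = TermCat.forget ((E.W A).onTerm w) := by
  induction k generalizing X with
  | zero =>
    obtain ⟨rfl, rfl⟩ := (E.strat.eq_iff A).1 hk
    have e := congrArg (fun K => TermCat.forget (K.onTerm w)) (E.W_one X)
    exact hw.symm.trans e.symm
  | succ k ih =>
    obtain ⟨p, rfl⟩ := E.strat.exists_chain A
    cases p with
    | nil => omega
    | @cons _ X' _ f hf p =>
      have e := congrArg (fun K => TermCat.forget (K.onTerm w)) (E.W_comp p.composite f)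
      refine Eq.trans ?_ e.symm
      have hpar : par (node X) = node X' := by
        have := par_iter_node f
        rwa [show E.strat.len X - E.strat.len X' = 1 by omega] at this
      have e1 := ih p.composite (by omega)
      exact valT_wkT f hf (U := node X) rfl (w := (E.W p.composite).onTerm w)
        ((congrArg (fun V => valT (E.bSystem.wksT V k z)) hpar).trans e1).symm

end

end StratESystem

/-! ### Components of terms -/

namespace StratESystem

open BFrame PreBSystem TermFunctor BSystem

section

variable {E : StratESystem.{u}} {X Y : E.Ob}

theorem val_wks_eq (A : X ⟶ Y) {Z : E.frame.Ob} (h : Ov (node Y) Z) :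
    val (E.bSystem.wks (node X) (E.strat.len X - E.strat.len Y) Z) = actOb (E.W A) (val Z) := by
  obtain ⟨f⟩ := hom_of_ov h
  refine (val_wks A (by have := E.strat.len_le A; omega) (P := Over.mk f) rfl).trans ?_
  exact (actOb_left _ (Over.mk f)).symm

theorem valT_wksT_eq (A : X ⟶ Y) {z : E.frame.Tm} (h : SOv (node Y) (bdT z)) :
    valT (E.bSystem.wksT (node X) (E.strat.len X - E.strat.len Y) z) =
      actTm (E.W A) (valT z) := by
  obtain ⟨f⟩ := hom_of_sov h
  obtain ⟨w, hw⟩ := exists_forget (X := Y) f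
  refine (valT_wksT A (by have := E.strat.len_le A; omega) hw).trans ?_
  rw [← hw, actTm_forget]

/-- The axiom `S_x ∘ W_A = id` on objects. -/
theorem subOb_wk (x : E.Term) {Q : E.Ob} (f : Q ⟶ x.1.right) :
    subOb x (actOb (E.W x.1.hom) Q) = Q := by
  rw [subOb, ← actOb_comp _ _ f, E.W_comp_S]
  exact actOb_id f

/-- The axiom `S_x ∘ W_A = id` on terms. -/
theorem subTm_wk (x : E.Term) {v : E.Term} (f : v.1.right ⟶ x.1.right) :
    subTm x (actTm (E.W x.1.hom) v) = v := by
  rw [subTm, ← actTm_comp _ _ f, E.W_comp_S]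
  exact actTm_id f

theorem isStrat_S (x : E.Term) : IsStrat (E.S x.2) := E.S_strat x.2

theorem isStrat_W (A : X ⟶ Y) : IsStrat (E.W A) := E.W_strat A

/-- The generic term `idt A`, as an element of the disjoint union of all sets of terms. -/
abbrev idTm (A : X ⟶ Y) : E.Term := E.mkTerm ((E.W A).obj (Over.mk A)).hom (E.idt A)

/-- The axiom `S_{idt A} ∘ W_A/A = id` on terms. -/
theorem subTm_idTm_wk (A : X ⟶ Y) {v : E.Term} (f : v.1.right ⟶ X) :
    subTm (idTm A) (actTm (E.W A) v) = v := by
  obtain ⟨w, rfl⟩ := exists_forget f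
  have e := congrArg (fun K => TermCat.forget (K.onTerm w)) (E.W_slice_comp_S_idt A)
  refine Eq.trans ?_ e
  have e1 := actTm_forget (E.W A) (TermCat.forget ((sliceUp (C := E.toTermCat)
    (Over.mk A)).onTerm w))
  refine (congrArg (subTm (idTm A)) e1).trans ?_
  exact actTm_forget (E.S (E.idt A)) ((((sliceUp (C := E.toTermCat) (Over.mk A)).comp
    ((E.W A).slice (Over.mk A))).comp (sliceDown ((E.W A).obj (Over.mk A)))).onTerm w)

/-- The axiom `S_x(idt A) = x`. -/
theorem subTm_idTm (x : E.Term) : subTm x (idTm x.1.hom) = x :=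
  (actTm_forget (E.S x.2) ((E.toTermCat.slice x.1.left).mkTerm
    (X := (E.W x.1.hom).obj (Over.mk x.1.hom)) (Y := Over.mk (𝟙 x.1.left))
      (Over.homMk ((E.W x.1.hom).obj (Over.mk x.1.hom)).hom (Category.comp_id _))
      (E.idt x.1.hom))).trans (E.S_idt x.2)

theorem len_actOb {F : TermFunctor (E.toTermCat.slice X) (E.toTermCat.slice Y)} (hF : IsStrat F)
    {Q : E.Ob} (f : Q ⟶ X) :
    E.strat.len (actOb F Q) + E.strat.len X = E.strat.len Q + E.strat.len Y := by
  obtain ⟨P, rfl⟩ := exists_over f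
  rw [actOb_left]
  have h1 := hF P
  have h2 := E.strat.len_le P.hom
  have h3 := E.strat.len_le (F.obj P).hom
  change E.strat.len _ - E.strat.len _ = E.strat.len _ - E.strat.len _ at h1
  change E.strat.len X ≤ _ at h2
  change E.strat.len Y ≤ _ at h3
  omega

/-- The components of a term `x` of an arrow `Δ ⟶ Γ`: the values of the functor `S_x` at the generic
elements of the associated B-system that belong to the steps from `Δ` down to `Γ`. -/
noncomputable def comps (x : E.Term) : List E.frame.Tm :=
  (E.bSystem.gens (node x.1.left) (E.strat.len x.1.left - E.strat.len x.1.right)).map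
    (termMap (E.S x.2) (isStrat_S x))

/-- The list of components of `x` is an iterated term of the associated B-system, and iterated
substitution of it agrees with `S_x`. -/
theorem comps_spec (x : E.Term) :
    E.bSystem.IsTm (node x.1.left) (E.strat.len x.1.left - E.strat.len x.1.right) (comps x) ∧
      (∀ {Z}, Ov (node x.1.left) Z → val (E.bSystem.subs (comps x) Z) = subOb x (val Z)) ∧
      (∀ {z}, SOv (node x.1.left) (bdT z) →
        valT (E.bSystem.subsT (comps x) z) = subTm x (valT z)) := by
  have hk : E.strat.len x.1.left - E.strat.len x.1.right ≤ (node x.1.left).1 := Nat.sub_le _ _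
  have hp := par_iter_node x.1.hom
  have h := isOp_nodeMap (isStrat_S x) (E.S_isHom x.2)
  have hw := isOp_wks (B := E.bSystem) hk
  have hX : Ov (node x.1.right) (node x.1.left) := ov_of_hom (Z := node x.1.left) x.1.hom
  rw [hp] at hw
  obtain ⟨h1, h2, h3⟩ := section_eq_subs (B := E.bSystem) hk (by rw [hp]; exact h)
    (fun {Z} hZ => by
      rw [hp] at hZ
      obtain ⟨f⟩ := hom_of_ov hZ
      refine val_injective ((val_nodeMap _ (hw.ov hZ)).trans ?_)
      rw [val_wks_eq x.1.hom hZ]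
      exact subOb_wk x f)
    (fun {z} hz => by
      rw [hp] at hz
      obtain ⟨f⟩ := hom_of_sov hz
      refine valT_injective ((valT_termMap _ (hw.sov' hz)).trans ?_)
      rw [valT_wksT_eq x.1.hom hz]
      exact subTm_wk x f)
  refine ⟨h1, fun {Z} hZ => ?_, fun {z} hz => ?_⟩
  · exact (congrArg val (h2 hZ)).trans (val_nodeMap _ hZ)
  · exact (congrArg valT (h3 hz)).trans (valT_termMap _ hz)

theorem hom_of_mem_gens {z : E.frame.Tm}
    (hz : z ∈ E.bSystem.gens (node X) (E.strat.len X - E.strat.len Y)) :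
    Nonempty ((valT z).1.right ⟶ X) :=
  hom_of_sov (sov_of_mem_gens (B := E.bSystem) (X := node X) (Nat.sub_le _ _) hz)

theorem node_actOb {F : TermFunctor (E.toTermCat.slice X) (E.toTermCat.slice Y)} (hF : IsStrat F)
    {Q : E.Ob} (f : Q ⟶ X) : node (actOb F Q) = nodeMap F hF (node Q) :=
  val_injective (val_nodeMap hF (ov_of_hom (X := node X) (Z := node Q) f)).symm

/-- Homomorphisms between slices preserve the iterated generic elements. -/
theorem gens_actOb {F : TermFunctor (E.toTermCat.slice X) (E.toTermCat.slice Y)} (hF : IsStrat F)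
    (h : PreESystem.IsHom (E := E.toPreESystem.slice X) (D := E.toPreESystem.slice Y) F)
    {P Q : E.Ob} (g : P ⟶ Q) (f : Q ⟶ X) :
    E.bSystem.gens (node (actOb F P)) (E.strat.len (actOb F P) - E.strat.len (actOb F Q)) =
      (E.bSystem.gens (node P) (E.strat.len P - E.strat.len Q)).map (termMap F hF) := by
  have e : E.strat.len (actOb F P) - E.strat.len (actOb F Q) =
      E.strat.len P - E.strat.len Q := by
    have h1 := len_actOb hF f
    have h2 := len_actOb hF (g ≫ f)
    omega
  rw [e, node_actOb hF (g ≫ f)]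
  refine (op_gens (A := E.bSystem) (B := E.bSystem) (isOp_nodeMap hF h) (U := node P)
    (Nat.sub_le _ _) ?_).symm
  exact (par_iter_node g).symm ▸ ov_of_hom (X := node X) (Z := node Q) f

/-- Homomorphisms between slices act on the components of terms. -/
theorem comps_actTm {F : TermFunctor (E.toTermCat.slice X) (E.toTermCat.slice Y)} (hF : IsStrat F)
    (h : PreESystem.IsHom (E := E.toPreESystem.slice X) (D := E.toPreESystem.slice Y) F)
    {x : E.Term} (f : x.1.right ⟶ X) :
    comps (actTm F x) = (comps x).map (termMap F hF) := by
  have e : E.bSystem.gens (node (actTm F x).1.left)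
      (E.strat.len (actTm F x).1.left - E.strat.len (actTm F x).1.right) =
      (E.bSystem.gens (node x.1.left) (E.strat.len x.1.left - E.strat.len x.1.right)).map
        (termMap F hF) := by
    rw [actTm_left F f, actTm_right F f]
    exact gens_actOb hF h x.1.hom f
  have ho := isOp_nodeMap hF h
  have hs := isOp_nodeMap (isStrat_S x) (E.S_isHom x.2)
  rw [comps, e, comps, List.map_map, List.map_map]
  refine List.map_congr_left fun z hz => valT_injective ?_
  obtain ⟨g⟩ := hom_of_mem_gens hz
  have hz1 : SOv (node x.1.left) (bdT z) := sov_of_hom g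
  have hz2 : SOv (node X) (bdT z) := sov_of_hom (V := node X) (g ≫ x.1.hom ≫ f)
  have hz3 : SOv (node X) (bdT (termMap (E.S x.2) (isStrat_S x) z)) :=
    .trans (ov_of_hom (X := node X) (Z := node x.1.right) f) (hs.sov' hz1)
  have hz4 : SOv (node (actTm F x).1.left) (bdT (termMap F hF z)) := by
    rw [actTm_left F f, node_actOb hF (x.1.hom ≫ f), ho.bd hz2]
    exact ho.sov_sov (ov_of_hom (X := node X) (Z := node x.1.left) (x.1.hom ≫ f)) hz1
  refine (valT_termMap _ hz4).trans ?_
  rw [valT_termMap hF hz2]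
  refine Eq.trans ?_ (valT_termMap hF hz3).symm
  rw [valT_termMap _ hz1]
  exact (actTm_subTm h f g).symm

/-- The components of `idt A` are the iterated generic elements. -/
theorem comps_idTm (A : X ⟶ Y) :
    comps (idTm A) = E.bSystem.gens (node X) (E.strat.len X - E.strat.len Y) := by
  have e1 : ((E.W A).obj (Over.mk A)).left = actOb (E.W A) X := (actOb_left _ (Over.mk A)).symm
  have e2 : X = actOb (E.W A) Y :=
    (congrArg (fun P => P.left) (E.W_id A)).symm.trans (actOb_left _ (Over.mk (𝟙 Y))).symm
  have e3 : E.strat.len ((E.W A).obj (Over.mk A)).left - E.strat.len X =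
      E.strat.len (actOb (E.W A) X) - E.strat.len (actOb (E.W A) Y) := by rw [← e1, ← e2]
  have ho := isOp_nodeMap (isStrat_W A) (E.W_isHom A)
  refine (congrArg (List.map _) ((congrArg₂ (fun Q k => E.bSystem.gens (node Q) k) e1 e3).trans
    (gens_actOb (isStrat_W A) (E.W_isHom A) A (𝟙 Y)))).trans ?_
  rw [List.map_map]
  refine (List.map_congr_left fun z hz => valT_injective ?_).trans (List.map_id _)
  obtain ⟨g⟩ := hom_of_mem_gens hz
  have hz1 : SOv (node X) (bdT z) := sov_of_hom (V := node X) g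
  have hz2 : SOv (node Y) (bdT z) := sov_of_hom (V := node Y) (g ≫ A)
  have hz3 : SOv (node (idTm A).1.left) (bdT (termMap (E.W A) (isStrat_W A) z)) := by
    change SOv (node ((E.W A).obj (Over.mk A)).left) _
    rw [e1, node_actOb (isStrat_W A) A, ho.bd hz2]
    exact ho.sov_sov (ov_of_hom (X := node Y) (Z := node X) A) hz1
  refine (valT_termMap _ hz3).trans ?_
  rw [valT_termMap _ hz2]
  exact subTm_idTm_wk A g

end

end StratESystem

/-! ### Terms are determined by, and exist for, every list of components -/

namespace StratESystem

open BFrame PreBSystem TermFunctor BSystem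

section

variable {E : StratESystem.{u}} {X Y : E.Ob}

/-- Iterated substitution of terms of individual arrows in arbitrary terms. -/
noncomputable def subsTm : List E.frame.Tm → E.Term → E.Term
  | [], v => v
  | x :: t, v => subTm (valT x) (subsTm t v)

theorem hom_par {Q : E.Ob} {V : E.frame.Ob} (h : 0 < V.1) (f : Q ⟶ val V) :
    Nonempty (Q ⟶ val (par V)) := by
  obtain ⟨g⟩ := hom_of_ov (ov_par V h)
  exact ⟨f ≫ g⟩

/-- The domain and the codomain of an iterated substitution in a term over `V`. -/
theorem node_subsTm {V : E.frame.Ob} {k : ℕ} (hk : k ≤ V.1) {t : List E.frame.Tm}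
    (ht : E.bSystem.IsTm V k t) {v : E.Term} (f : v.1.right ⟶ val V) :
    node (subsTm t v).1.left = E.bSystem.subs t (node v.1.left) ∧
      node (subsTm t v).1.right = E.bSystem.subs t (node v.1.right) := by
  induction k generalizing V t with
  | zero => obtain rfl : t = [] := ht; exact ⟨rfl, rfl⟩
  | succ k ih =>
    obtain ⟨x, t, rfl, ht', hx⟩ := ht
    have hV : 0 < V.1 := by omega
    have hk' : k ≤ (par V).1 := by rw [par_fst]; omega
    obtain ⟨f'⟩ := hom_par hV f
    obtain ⟨i1, i2⟩ := ih hk' ht' f'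
    have h1 := isOp_subs hk' ht'
    have o2 : Ov (bdT x) (node (subsTm t v).1.right) := by
      rw [hx, i2]
      exact h1.ov_ov (ov_par V hV) (ov_of_hom (Z := node v.1.right) f)
    have o1 : Ov (bdT x) (node (subsTm t v).1.left) :=
      o2.trans (ov_of_hom (X := node _) (Z := node _) (subsTm t v).1.hom)
    obtain ⟨g⟩ := hom_of_ov o2
    constructor
    · refine val_injective (Eq.trans ?_ (congrArg (fun Q => val (E.bSystem.sub x Q)) i1))
      exact (actTm_left (E.S (valT x).2) g).trans (val_sub_eq o1).symm
    · refine val_injective (Eq.trans ?_ (congrArg (fun Q => val (E.bSystem.sub x Q)) i2))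
      exact (actTm_right (E.S (valT x).2) g).trans (val_sub_eq o2).symm

/-- The situation of an iterated term `x :: t` of `V`: after substitution of `t`, a term over `V` lies
over the domain of `x`, so that `x` can be substituted in it. -/
theorem hom_subsTm {V : E.frame.Ob} {k : ℕ} (hk : k < V.1) {t : List E.frame.Tm}
    (ht : E.bSystem.IsTm (par V) k t) {x : E.frame.Tm} (hx : bdT x = E.bSystem.subs t V)
    {v : E.Term} (f : v.1.right ⟶ val V) :
    Nonempty ((subsTm t v).1.right ⟶ (valT x).1.left) := by
  have hV : 0 < V.1 := by omega
  have hk' : k ≤ (par V).1 := by rw [par_fst]; omega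
  obtain ⟨f'⟩ := hom_par hV f
  refine hom_of_ov (V := bdT x) (Z := node (subsTm t v).1.right) ?_
  rw [hx, (node_subsTm hk' ht f').2]
  exact (isOp_subs hk' ht).ov_ov (ov_par V hV) (ov_of_hom (Z := node v.1.right) f)

/-- On terms of individual arrows, iterated substitution is that of the associated B-system. -/
theorem subsTm_valT {V : E.frame.Ob} {k : ℕ} (hk : k ≤ V.1) {t : List E.frame.Tm}
    (ht : E.bSystem.IsTm V k t) {z : E.frame.Tm} (hz : SOv V (bdT z)) :
    subsTm t (valT z) = valT (E.bSystem.subsT t z) := by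
  induction k generalizing V t with
  | zero => obtain rfl : t = [] := ht; rfl
  | succ k ih =>
    obtain ⟨x, t, rfl, ht', hx⟩ := ht
    have hV : 0 < V.1 := by omega
    have hk' : k ≤ (par V).1 := by rw [par_fst]; omega
    have h1 := isOp_subs hk' ht'
    have hz' : SOv (par V) (bdT z) := .trans (ov_par V hV) hz
    refine Eq.trans (congrArg (subTm (valT x)) (ih hk' ht' hz')) (valT_subT_eq ?_).symm
    rw [hx, h1.bd hz']
    exact h1.sov_sov (ov_par V hV) hz

/-- Homomorphisms between slices preserve iterated substitution in arbitrary terms. -/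
theorem actTm_subsTm {F : TermFunctor (E.toTermCat.slice X) (E.toTermCat.slice Y)}
    (hF : IsStrat F)
    (h : PreESystem.IsHom (E := E.toPreESystem.slice X) (D := E.toPreESystem.slice Y) F)
    {V : E.frame.Ob} {k : ℕ} (hk : k ≤ V.1) {t : List E.frame.Tm} (ht : E.bSystem.IsTm V k t)
    (hV : Ov (node X) (par^[k] V)) {v : E.Term} (f : v.1.right ⟶ val V) :
    actTm F (subsTm t v) = subsTm (t.map (termMap F hF)) (actTm F v) := by
  induction k generalizing V t with
  | zero => obtain rfl : t = [] := ht; rfl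
  | succ k ih =>
    have hm := ht.mem hk
    obtain ⟨x, t, rfl, ht', hx⟩ := ht
    have hk' : k ≤ (par V).1 := by rw [par_fst]; omega
    obtain ⟨f'⟩ := hom_par (by omega) f
    obtain ⟨g⟩ := hom_subsTm hk ht' hx f
    have hx' : SOv (node X) (bdT x) := .trans hV (hm x (by simp))
    obtain ⟨g'⟩ := hom_of_sov hx'
    refine (actTm_subTm h g' g).trans ?_
    exact congrArg₂ subTm (valT_termMap hF hx').symm (ih hk' ht' hV f')

/-- Iterated substitution distributes over substitution, in arbitrary terms. -/
theorem subsTm_subTm {V : E.frame.Ob} {k : ℕ} (hk : k ≤ V.1) {t : List E.frame.Tm}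
    (ht : E.bSystem.IsTm V k t) {x v : E.Term} (f : x.1.right ⟶ val V)
    (g : v.1.right ⟶ x.1.left) :
    subsTm t (subTm x v) = subTm (subsTm t x) (subsTm t v) := by
  induction k generalizing V t with
  | zero => obtain rfl : t = [] := ht; rfl
  | succ k ih =>
    obtain ⟨y, t, rfl, ht', hy⟩ := ht
    have hV : 0 < V.1 := by omega
    have hk' : k ≤ (par V).1 := by rw [par_fst]; omega
    obtain ⟨f'⟩ := hom_par hV f
    obtain ⟨f1⟩ := hom_subsTm hk ht' hy f
    have g1 : Nonempty ((subsTm t v).1.right ⟶ (subsTm t x).1.left) := by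
      refine hom_of_ov (V := node (subsTm t x).1.left) (Z := node (subsTm t v).1.right) ?_
      rw [(node_subsTm hk' ht' f').1, (node_subsTm hk' ht' (g ≫ x.1.hom ≫ f')).2]
      exact (isOp_subs hk' ht').ov_ov (ov_of_hom (Z := node x.1.left) (x.1.hom ≫ f'))
        (ov_of_hom (X := node x.1.left) (Z := node v.1.right) g)
    obtain ⟨g1⟩ := g1
    exact (congrArg (subTm (valT y)) (ih hk' ht' f')).trans
      (actTm_subTm (E.S_isHom (valT y).2) f1 g1)

/-- Iterated substitution of the generic elements undoes weakening, for arbitrary terms. -/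
theorem subsTm_gens_wk {k : ℕ} (A : X ⟶ Y) (hk : E.strat.len X = E.strat.len Y + k) {v : E.Term}
    (f : v.1.right ⟶ X) :
    subsTm (E.bSystem.gens (node X) k) (actTm (E.W A) v) = v := by
  induction k generalizing X with
  | zero =>
    obtain ⟨rfl, rfl⟩ := (E.strat.eq_iff A).1 hk
    change actTm (E.W (𝟙 X)) v = v
    rw [E.W_one]
    exact actTm_id f
  | succ k ih =>
    obtain ⟨p, rfl⟩ := E.strat.exists_chain A
    cases p with
    | nil => omega
    | @cons _ X' _ a ha p =>
      have hpar : par (node X) = node X' := by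
        have := par_iter_node a
        rwa [show E.strat.len X - E.strat.len X' = 1 by omega] at this
      have h0 : 0 < (node X).1 := by change 0 < E.strat.len X; omega
      have hk' : k ≤ (node X').1 := by change k ≤ E.strat.len X'; omega
      have e0 : E.W (IndividualChain.cons a ha p).composite =
        (E.W p.composite).comp (E.W a) := E.W_comp p.composite a
      have hpY : Ov (node Y) (node X') := ov_of_hom (Z := node X') p.composite
      have hpk : par^[k] (node X') = node Y := by
        have := par_iter_node p.composite
        rwa [show E.strat.len X' - E.strat.len Y = k by omega] at this
      have hg := gens_spec (B := E.bSystem) hk'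
      have hw := isOp_wks (B := E.bSystem) hk'
      rw [hpk] at hw
      have hX' : Ov (node X') (E.bSystem.wks (node X') k (node X')) := hw.ov hpY
      have ew : val (E.bSystem.wks (node X') k (node X')) = actOb (E.W p.composite) X' := by
        have := val_wks_eq (Z := node X') p.composite hpY
        rwa [show E.strat.len X' - E.strat.len Y = k by omega] at this
      -- The weakened generic elements are the images of generic elements under the homomorphism
      -- `W_a`, which can thus be moved out of the iterated substitution.
      have e1 : (E.bSystem.gens (node X') k).map (E.bSystem.wkT (node X)) =
          (E.bSystem.gens (node X') k).map (termMap (E.W a) (isStrat_W a)) := by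
        refine List.map_congr_left fun z hz => valT_injective ?_
        have hz1 : SOv (node X') (bdT z) := sov_of_mem_gens (B := E.bSystem) hk' hz
        obtain ⟨b⟩ := hom_of_sov hz1
        obtain ⟨w, hw⟩ := exists_forget (X := X') b
        refine (valT_wkT a ha (U := node X) rfl hw).trans ?_
        rw [valT_termMap _ hz1, ← hw, actTm_forget]
      obtain ⟨c⟩ : Nonempty ((actTm (E.W p.composite) v).1.right ⟶
          val (E.bSystem.wks (node X') k (node X'))) := by
        rw [ew, actTm_right _ (f ≫ a ≫ p.composite)]
        have := (isOp_nodeMap (isStrat_W p.composite) (E.W_isHom p.composite)).ov_ov hpY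
          (ov_of_hom (X := node X') (Z := node v.1.right) (f ≫ a))
        rw [← node_actOb _ (f ≫ a ≫ p.composite), ← node_actOb _ p.composite] at this
        exact hom_of_ov this
      rw [e0, actTm_comp _ _ (f ≫ a ≫ p.composite), E.bSystem.gens_succ (node X) h0, hpar, e1]
      change subTm (valT (E.bSystem.gen (node X) h0)) _ = v
      rw [← actTm_subsTm (isStrat_W a) (E.W_isHom a) (hk'.trans hX'.1) hg.1
        (by rw [par_iter_wks (B := E.bSystem) hk']; exact ov_refl _) c, ih p.composite (by omega) (f ≫ a)]
      exact (congrArg (fun x => subTm x _) (valT_gen a ha (U := node X) rfl h0)).trans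
        (subTm_idTm_wk a f)

/-- Substitution of a term is iterated substitution of its components. -/
theorem subTm_eq_subsTm_comps (x : E.Term) {v : E.Term} (f : v.1.right ⟶ x.1.left) :
    subTm x v = subsTm (comps x) v := by
  have hl := E.strat.len_le x.1.hom
  have hk : E.strat.len x.1.left - E.strat.len x.1.right ≤ (node x.1.left).1 := Nat.sub_le _ _
  have hp := par_iter_node x.1.hom
  have hX : Ov (node x.1.right) (node x.1.left) := ov_of_hom (Z := node x.1.left) x.1.hom
  have hw := isOp_wks (B := E.bSystem) hk
  rw [hp] at hw
  obtain ⟨c⟩ : Nonempty ((actTm (E.W x.1.hom) v).1.right ⟶ val (E.bSystem.wks (node x.1.left)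
      (E.strat.len x.1.left - E.strat.len x.1.right) (node x.1.left))) := by
    rw [val_wks_eq x.1.hom hX, actTm_right _ (f ≫ x.1.hom)]
    have := (isOp_nodeMap (isStrat_W x.1.hom) (E.W_isHom x.1.hom)).ov_ov hX
      (ov_of_hom (X := node x.1.left) (Z := node v.1.right) f)
    rw [← node_actOb _ (f ≫ x.1.hom), ← node_actOb _ x.1.hom] at this
    exact hom_of_ov this
  have e := actTm_subsTm (isStrat_S x) (E.S_isHom x.2) (hk.trans (hw.ov hX).1)
    (gens_spec (B := E.bSystem) hk).1 (by rw [par_iter_wks (B := E.bSystem) hk]; exact ov_refl _) c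
  rw [subsTm_gens_wk x.1.hom (by omega) f] at e
  exact e.trans (congrArg (subsTm (comps x)) (subTm_wk x (f ≫ x.1.hom)))

/-- A term is determined by its components, as `x = S_x(idt A)` and `S_x` is determined by them. -/
theorem comps_injective {A : X ⟶ Y} {x y : E.T A}
    (h : comps (E.mkTerm A x) = comps (E.mkTerm A y)) : x = y := by
  have e : E.mkTerm A x = E.mkTerm A y := by
    have h1 := subTm_idTm (E.mkTerm A x)
    have h2 := subTm_idTm (E.mkTerm A y)
    rw [subTm_eq_subsTm_comps _ (𝟙 X)] at h1 h2
    rw [← h1, ← h2, h]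
  exact eq_of_heq (Sigma.mk.inj e).2

/-- Every iterated term is the list of components of a term, which is obtained by substitution in
the generic term `idt A`. -/
theorem exists_comps_eq (A : X ⟶ Y) {t : List E.frame.Tm}
    (ht : E.bSystem.IsTm (node X) (E.strat.len X - E.strat.len Y) t) :
    ∃ x : E.T A, comps (E.mkTerm A x) = t := by
  have hk : E.strat.len X - E.strat.len Y ≤ (node X).1 := Nat.sub_le _ _
  have hp := par_iter_node A
  have hX : Ov (node Y) (node X) := ov_of_hom (Z := node X) A
  have hs := isOp_subs hk ht
  have hw := isOp_wks (B := E.bSystem) hk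
  rw [hp] at hs hw
  have ew : node (idTm A).1.left =
      E.bSystem.wks (node X) (E.strat.len X - E.strat.len Y) (node X) :=
    val_injective ((actOb_left _ (Over.mk A)).symm.trans (val_wks_eq A hX).symm)
  obtain ⟨h1, h2⟩ := node_subsTm hk ht (v := idTm A) (𝟙 X)
  rw [ew, subs_wks hk ht (by rw [hp]; exact hX)] at h1
  have h2' : node (subsTm t (idTm A)).1.right = node Y := h2.trans hs.base
  -- `S_t(idt A)` is a term of `A`, as `S_t ∘ W_A = id` and there is at most one arrow `X ⟶ Y`.
  have e : ∃ x : E.T A, E.mkTerm A x = subsTm t (idTm A) := by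
    generalize subsTm t (idTm A) = w at h1 h2'
    obtain ⟨⟨P, Q, a⟩, w⟩ := w
    obtain rfl : P = X := congrArg val h1
    obtain rfl : Q = Y := congrArg val h2'
    obtain rfl : a = A := E.strat.thin E.root_isTerminal _ _
    exact ⟨w, rfl⟩
  obtain ⟨x, hx⟩ := e
  refine ⟨x, Eq.trans (List.map_congr_left fun z hz => valT_injective ?_) (subsT_gens hk ht)⟩
  have hz1 : SOv (node X) (bdT z) := sov_of_mem_gens (B := E.bSystem) hk hz
  have hz2 : SOv (node Y) (bdT z) := .trans hX hz1
  obtain ⟨f⟩ := hom_of_sov hz1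
  have hz3 : SOv (node (idTm A).1.left)
      (bdT (E.bSystem.wksT (node X) (E.strat.len X - E.strat.len Y) z)) := by
    rw [ew, hw.bd hz2]; exact hw.sov_sov hX hz1
  obtain ⟨g⟩ := hom_of_sov hz3
  refine (valT_termMap _ hz1).trans ?_
  change subTm (E.mkTerm A x) (valT z) = _
  have e3 := subsTm_valT hk ht (hw.sov' hz2)
  rw [subsT_wksT hk ht (by rw [hp]; exact hz2)] at e3
  -- `S_x(z) = S_x(S_t(W_A(z))) = S_t(S_{idt A}(W_A(z))) = S_t(z)`
  rw [hx, ← subsTm_valT hk ht hz1, ← e3, ← subsTm_subTm hk ht (𝟙 X) g, e3,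
    valT_wksT_eq A hz2, subTm_idTm_wk A f]

end

end StratESystem

/-! ### Every stratified E-system comes from its B-system -/

namespace TermFunctor

variable {C D : TermCat.{u}}

/-- Composition with the slice of a functor that equals the identity is injective; it is stated for
a variable `K`, since the two slices are over objects that are not definitionally equal. -/
theorem eq_of_comp_slice_eq {K : TermFunctor D D} (hK : K = TermFunctor.id D) {Γ : D.Ob}
    {L M : TermFunctor C (D.slice Γ)} (h : L.comp (K.slice Γ) = M.comp (K.slice Γ)) : L = M := by
  subst hK; exact h

theorem onTerm_id {K : TermFunctor D D} (hK : K = TermFunctor.id D) (x : D.Term) :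
    K.onTerm x = x := by
  subst hK; rfl

end TermFunctor

namespace PreESystem

variable {E D : PreESystem.{u}}

/-- A functor with term structure that is inverse to a homomorphism of pre-E-systems is itself a
homomorphism. -/
theorem IsHom.inverse {F : TermFunctor E.toTermCat D.toTermCat}
    {G : TermFunctor D.toTermCat E.toTermCat} (hF : IsHom (E := E) (D := D) F)
    (h1 : F.comp G = TermFunctor.id E.toTermCat) (h2 : G.comp F = TermFunctor.id D.toTermCat) :
    IsHom (E := D) (D := E) G where
  root := (congrArg G.obj hF.root).symm.trans (congrArg (fun K => K.obj E.root) h1)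
  sub {Γ Δ A} x := by
    refine TermFunctor.eq_of_comp_slice_eq h1 ?_
    -- The claim holds trivially for the identity; `K` is a variable so that it can be replaced.
    have key : ∀ K : TermFunctor D.toTermCat D.toTermCat, K = TermFunctor.id D.toTermCat →
        (D.S x).comp (K.slice Γ) = (K.slice Δ).comp (D.S (K.tm x)) := by
      rintro _ rfl; rfl
    have e := (key _ h2).trans
      (congrArg (fun H => TermFunctor.comp (G.slice Δ) H) (hF.sub (G.tm x))).symm
    exact congrArg (fun H => TermFunctor.comp H (G.slice _)) e
  wk {Γ Δ} A := by
    refine TermFunctor.eq_of_comp_slice_eq h1 ?_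
    have key : ∀ K : TermFunctor D.toTermCat D.toTermCat, K = TermFunctor.id D.toTermCat →
        (D.W A).comp (K.slice Δ) = (K.slice Γ).comp (D.W (K.map A)) := by
      rintro _ rfl; rfl
    have e := (key _ h2).trans
      (congrArg (fun H => TermFunctor.comp (G.slice Γ) H) (hF.wk (G.map A))).symm
    exact congrArg (fun H => TermFunctor.comp H (G.slice _)) e
  idt {Γ Δ} A := by
    have key : ∀ K : TermFunctor D.toTermCat D.toTermCat, K = TermFunctor.id D.toTermCat →
        D.mkTerm _ (K.tm (D.idt A)) = D.mkTerm _ (D.idt (K.map A)) := by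
      rintro _ rfl; rfl
    have e := (key _ h2).trans (hF.idt (G.map A)).symm
    exact (TermFunctor.onTerm_id h1 (G.onTerm (D.mkTerm _ (D.idt A)))).symm.trans
      ((congrArg G.onTerm e).trans (TermFunctor.onTerm_id h1 (E.mkTerm _ (E.idt (G.map A)))))

end PreESystem

namespace StratESystem

open BFrame PreBSystem TermFunctor BSystem

section

variable {E D : StratESystem.{u}} {X Y : E.Ob}

theorem termMap_S_eq (x : E.Term) {z : E.frame.Tm} (hz : SOv (node x.1.left) (bdT z)) :
    termMap (E.S x.2) (isStrat_S x) z = E.bSystem.subsT (comps x) z :=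
  valT_injective ((valT_termMap _ hz).trans ((comps_spec x).2.2 hz).symm)

theorem termMap_W_eq (A : X ⟶ Y) {z : E.frame.Tm} (hz : SOv (node Y) (bdT z)) :
    termMap (E.W A) (isStrat_W A) z =
      E.bSystem.wksT (node X) (E.strat.len X - E.strat.len Y) z :=
  valT_injective ((valT_termMap _ hz).trans (valT_wksT_eq A hz).symm)

theorem sov_of_mem_comps {x : E.Term} {z : E.frame.Tm} (hz : z ∈ comps x) :
    SOv (node x.1.right) (bdT z) := by
  have := (comps_spec x).1.mem (Nat.sub_le _ _) z hz
  rwa [← par_iter_node x.1.hom]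

variable (E) in
/-- The comparison functor from a stratified E-system to the one that is generated by its
B-system: it is bijective on objects and sends a term to the list of its components. -/
noncomputable def toComps : TermFunctor E.toTermCat E.bSystem.termCat where
  obj X := toFree (node X)
  map {X Y} f := arrow (F := E.frame) (ov_of_hom (X := node Y) (Z := node X) f)
  map_id _ := Subsingleton.elim _ _
  map_comp _ _ := Subsingleton.elim _ _
  tm {X Y f} x := ⟨comps (E.mkTerm f x), isTm_congr (k := E.strat.len X - E.strat.len Y)
    (by change E.strat.len X = E.strat.len Y + _; have := E.strat.len_le f; omega)
    (comps_spec (E.mkTerm f x)).1⟩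

variable (E) in
theorem toComps_isHom :
    PreESystem.IsHom (E := E.toPreESystem) (D := E.bSystem.preE) (toComps E) where
  root := E.bSystem.raw.ob_inj (val_injective rfl)
  sub {Γ Δ A} x := by
    refine (E.bSystem.raw.slice _).functor_ext (fun P => ?_) (fun {P Q f} y => ?_)
    · refine val_injective ?_
      exact (actOb_left (E.S x) P).symm.trans ((comps_spec (E.mkTerm A x)).2.1
        (ov_of_hom (X := node Δ) (Z := node P.left) P.hom)).symm
    · refine (congrArg comps (actTm_forget (E.S x)
        ((E.toTermCat.slice Δ).mkTerm f y)).symm).trans ?_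
      refine (comps_actTm (isStrat_S (E.mkTerm A x)) (E.S_isHom x) Q.hom).trans ?_
      refine List.map_congr_left fun z hz => termMap_S_eq (E.mkTerm A x) ?_
      exact .trans (ov_of_hom (X := node Δ) (Z := node Q.left) Q.hom) (sov_of_mem_comps hz)
  wk {Γ Δ} A := by
    have hl : arrowLength ((toComps E).map A) = E.strat.len Δ - E.strat.len Γ :=
      arrowLength_eq _ (by
        change E.strat.len Δ = E.strat.len Γ + _; have := E.strat.len_le A; omega)
    refine (E.bSystem.raw.slice _).functor_ext (fun P => ?_) (fun {P Q f} y => ?_)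
    · refine val_injective ?_
      refine (actOb_left (E.W A) P).symm.trans ?_
      refine (val_wks_eq A (ov_of_hom (X := node Γ) (Z := node P.left) P.hom)).symm.trans ?_
      exact congrArg (fun k => val (E.bSystem.wks (node Δ) k (node P.left))) hl.symm
    · refine (congrArg comps (actTm_forget (E.W A)
        ((E.toTermCat.slice Γ).mkTerm f y)).symm).trans ?_
      refine (comps_actTm (isStrat_W A) (E.W_isHom A) Q.hom).trans ?_
      refine (List.map_congr_left fun z hz => termMap_W_eq A ?_).trans
        (congrArg (fun k => (comps _).map (E.bSystem.wksT (node Δ) k)) hl.symm)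
      exact .trans (ov_of_hom (X := node Γ) (Z := node Q.left) Q.hom) (sov_of_mem_comps hz)
  idt {Γ Δ} A := by
    have hl : arrowLength ((toComps E).map A) = E.strat.len Δ - E.strat.len Γ :=
      arrowLength_eq _ (by
        change E.strat.len Δ = E.strat.len Γ + _; have := E.strat.len_le A; omega)
    refine E.bSystem.raw.mkTerm_ext ?_ rfl ?_
    · refine val_injective ?_
      refine (actOb_left (E.W A) (Over.mk A)).symm.trans ?_
      refine (val_wks_eq A (ov_of_hom (X := node Γ) (Z := node Δ) A)).symm.trans ?_
      exact congrArg (fun k => val (E.bSystem.wks (node Δ) k (node Δ))) hl.symm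
    · refine (comps_idTm A).trans ?_
      exact congrArg (fun k => E.bSystem.gens (node Δ) k) hl.symm

variable (E) in
/-- The inverse of the comparison functor: the term with a given list of components. -/
noncomputable def ofComps : TermFunctor E.bSystem.termCat E.toTermCat where
  obj Z := val (ofFree Z)
  map f := Classical.choice (hom_of_ov (ov_of_arrow f))
  map_id _ := E.strat.thin E.root_isTerminal _ _
  map_comp _ _ := E.strat.thin E.root_isTerminal _ _
  tm {X Y f} t := (exists_comps_eq (Classical.choice (hom_of_ov (ov_of_arrow f))) (t := t.1) (by
    have h : arrowLength f = (ofFree X).1 - (ofFree Y).1 := arrowLength_eq f (by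
      have := (ov_of_arrow f).1; omega)
    rw [node_val, (ofFree X).2.2, (ofFree Y).2.2, ← h]
    exact t.2)).choose

theorem comps_ofComps {X Y : E.bSystem.FreeCat} {f : X ⟶ Y} (t : E.bSystem.termCat.T f) :
    comps (E.mkTerm _ ((ofComps E).tm t)) = t.1 :=
  Exists.choose_spec (p := fun x => comps (E.mkTerm _ x) = t.1) _

theorem ofComps_comp_toComps :
    (ofComps E).comp (toComps E) = TermFunctor.id E.bSystem.termCat :=
  E.bSystem.raw.functor_ext (fun _ => node_val _) (fun t => comps_ofComps t)

theorem toComps_comp_ofComps :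
    (toComps E).comp (ofComps E) = TermFunctor.id E.toTermCat := by
  have hA : ∀ {X Y : E.Ob} (f : X ⟶ Y), ((toComps E).comp (ofComps E)).map f = f :=
    fun f => E.strat.thin E.root_isTerminal _ _
  refine TermFunctor.ext_arrow (fun f => congrArg Arrow.mk (hA f)) (fun {X Y} f x => ?_)
  have key : ∀ (g : X ⟶ Y) (y : E.T g), comps (E.mkTerm g y) = comps (E.mkTerm f x) →
      E.mkTerm g y = E.mkTerm f x := by
    intro g y h
    obtain rfl : g = f := E.strat.thin E.root_isTerminal _ _
    rw [comps_injective h]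
  exact key _ _ (comps_ofComps _)

variable (E) in
/-- A stratified E-system is isomorphic to the one generated by its B-system. -/
noncomputable def compsIso : E ≅ B2E.obj (E2B.obj E) where
  hom := ⟨toComps E, toComps_isHom E, fun _ => rfl⟩
  inv := ⟨ofComps E, (toComps_isHom E).inverse toComps_comp_ofComps ofComps_comp_toComps,
    fun Z => (ofFree (F := E.frame) Z).2.2⟩
  hom_inv_id := Hom.ext toComps_comp_ofComps
  inv_hom_id := Hom.ext ofComps_comp_toComps

/-- Homomorphisms of stratified E-systems act on the components of terms. -/
theorem comps_onTerm {F : TermFunctor E.toTermCat D.toTermCat}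
    (hF : ∀ X : E.Ob, D.strat.len (F.obj X) = E.strat.len X)
    (h : PreESystem.IsHom (E := E.toPreESystem) (D := D.toPreESystem) F) (x : E.Term) :
    comps (F.onTerm x) = (comps x).map (frameHom F hF).totalT := by
  have ho := (isHom_frameHom hF h).isOp
  have en : ∀ P : E.Ob, node (F.obj P) = (frameHom F hF).total (node P) :=
    fun P => val_injective rfl
  have e : D.bSystem.gens (node (F.obj x.1.left))
      (D.strat.len (F.obj x.1.left) - D.strat.len (F.obj x.1.right)) =
      (E.bSystem.gens (node x.1.left) (E.strat.len x.1.left - E.strat.len x.1.right)).map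
        (frameHom F hF).totalT := by
    rw [hF, hF, en]
    exact (op_gens (A := E.bSystem) (B := D.bSystem) ho (U := node x.1.left)
      (Nat.sub_le _ _) (root_ov _)).symm
  refine (congrArg (List.map _) e).trans ?_
  rw [comps, List.map_map, List.map_map]
  refine List.map_congr_left fun z hz => valT_injective ?_
  obtain ⟨g⟩ := hom_of_mem_gens hz
  have hz1 : SOv (node x.1.left) (bdT z) := sov_of_hom g
  have hz2 : SOv (node (F.obj x.1.left)) (bdT ((frameHom F hF).totalT z)) :=
    sov_of_hom (V := node (F.obj x.1.left)) (F.map g)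
  obtain ⟨w, hw⟩ := exists_forget (X := x.1.left) g
  have e1 := congrArg (fun K => TermCat.forget (K.onTerm w)) (h.sub x.2)
  refine (valT_termMap (isStrat_S (F.onTerm x)) hz2).trans ?_
  refine Eq.trans ?_ (congrArg F.onTerm (valT_termMap (isStrat_S x) hz1)).symm
  rw [← hw, actTm_forget]
  refine Eq.trans ?_ e1.symm
  refine Eq.trans (congrArg (actTm _) ?_)
    (actTm_forget (D.S (F.tm x.2)) ((F.slice x.1.left).onTerm w))
  exact congrArg F.onTerm hw.symm

end

end StratESystem

/-- The natural isomorphism `B2E ∘ E2B ≅ id`. -/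
noncomputable def compsNatIso : 𝟭 StratESystem.{u} ≅ E2B.{u} ⋙ B2E.{u} :=
  NatIso.ofComponents StratESystem.compsIso (fun {E D} F => by
    refine StratESystem.Hom.ext (D.bSystem.raw.functor_ext (fun X => ?_) (fun {X Y f} x => ?_))
    · exact StratESystem.val_injective rfl
    · exact StratESystem.comps_onTerm (E := E) (D := D) F.strat F.isHom (E.mkTerm f x))

/-! ### Every B-system comes from its stratified E-system -/

namespace BFrame

variable {F G : BFrame.{u}}

/-- The inverse of a bijective homomorphism of B-frames. -/
noncomputable def Hom.inverse (H : Hom F G) (h : ∀ n, Function.Bijective (H.ob (n := n)))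
    (h' : ∀ n, Function.Bijective (H.tm (n := n))) : Hom G F where
  ob {n} := (Equiv.ofBijective _ (h n)).symm
  tm {n} := (Equiv.ofBijective _ (h' n)).symm
  ft_ob {n} X := by
    obtain ⟨X, rfl⟩ := (Equiv.ofBijective _ (h (n + 1))).surjective X
    rw [Equiv.symm_apply_apply]
    exact ((Equiv.symm_apply_eq _).2 (H.ft_ob X)).symm
  bd_tm {n} x := by
    obtain ⟨x, rfl⟩ := (Equiv.ofBijective _ (h' n)).surjective x
    rw [Equiv.symm_apply_apply]
    exact ((Equiv.symm_apply_eq _).2 (H.bd_tm x)).symm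

theorem Hom.comp_inverse (H : Hom F G) (h : ∀ n, Function.Bijective (H.ob (n := n)))
    (h' : ∀ n, Function.Bijective (H.tm (n := n))) : H.comp (H.inverse h h') = Hom.id F :=
  Hom.ext_total
    (fun Z => congrArg (Sigma.mk Z.1) (Equiv.symm_apply_apply (Equiv.ofBijective _ (h Z.1)) Z.2))
    (fun z => congrArg (Sigma.mk z.1) (Equiv.symm_apply_apply (Equiv.ofBijective _ (h' z.1)) z.2))

theorem Hom.inverse_comp (H : Hom F G) (h : ∀ n, Function.Bijective (H.ob (n := n)))
    (h' : ∀ n, Function.Bijective (H.tm (n := n))) : (H.inverse h h').comp H = Hom.id G :=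
  Hom.ext_total
    (fun Z => congrArg (Sigma.mk Z.1) (Equiv.apply_symm_apply (Equiv.ofBijective _ (h Z.1)) Z.2))
    (fun z => congrArg (Sigma.mk z.1) (Equiv.apply_symm_apply (Equiv.ofBijective _ (h' z.1)) z.2))

theorem par_iter_total (H : Hom F G) (m : ℕ) (Z : F.Ob) :
    par^[m] (H.total Z) = H.total (par^[m] Z) := by
  induction m generalizing Z with
  | zero => rfl
  | succ m ih =>
    rw [Function.iterate_succ_apply, Function.iterate_succ_apply, ← total_par, ih]

theorem ov_total (H : Hom F G) {X Z : F.Ob} (h : Ov X Z) : Ov (H.total X) (H.total Z) :=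
  ⟨h.1, (par_iter_total H _ Z).trans (congrArg H.total h.2)⟩

theorem sov_total (H : Hom F G) {X Z : F.Ob} (h : SOv X Z) : SOv (H.total X) (H.total Z) :=
  (ov_total H h.ov).sov h.lt

end BFrame

namespace PreBSystem

open BFrame

variable {A B : PreBSystem.{u}}

/-- The elementwise conditions imply that a homomorphism of B-frames is a
pre-B-homomorphism. -/
theorem IsHom.of_total {H : Hom A.toBFrame B.toBFrame}
    (hs : ∀ {x Z}, Ov (bdT x) Z → H.total (A.sub x Z) = B.sub (H.totalT x) (H.total Z))
    (hs' : ∀ {x z}, SOv (bdT x) (bdT z) →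
      H.totalT (A.subT x z) = B.subT (H.totalT x) (H.totalT z))
    (hw : ∀ {U Z}, 0 < U.1 → Ov (BFrame.par U) Z →
      H.total (A.wk U Z) = B.wk (H.total U) (H.total Z))
    (hw' : ∀ {U z}, 0 < U.1 → SOv (BFrame.par U) (bdT z) →
      H.totalT (A.wkT U z) = B.wkT (H.total U) (H.totalT z))
    (hg : ∀ {U} (h : 0 < U.1), H.totalT (A.gen U h) = B.gen (H.total U) h) : IsHom H where
  sub {n} x := by
    refine Hom.ext_total (fun Z => inc_injective ?_) (fun z => incT_injective ?_)
    · refine (sub_inc (H.tm x) (((H.slice _).comp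
        (B.sliceCongr (H.bd_tm x).symm)).total Z)).symm.trans ?_
      exact (hs (x := ⟨n, x⟩) (ov_inc Z)).symm.trans (congrArg H.total (sub_inc x Z))
    · refine (subT_incT (H.tm x) (((H.slice _).comp
        (B.sliceCongr (H.bd_tm x).symm)).totalT z)).symm.trans ?_
      exact (hs' (x := ⟨n, x⟩) (sov_incT z)).symm.trans (congrArg H.totalT (subT_incT x z))
  wk {n} X := by
    refine Hom.ext_total (fun Z => inc_injective ?_) (fun z => incT_injective ?_)
    · refine (wk_inc (H.ob X) (((H.slice _).comp
        (B.sliceCongr (H.ft_ob X).symm)).total Z)).symm.trans ?_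
      exact (hw (U := ⟨n + 1, X⟩) n.succ_pos (ov_inc Z)).symm.trans
        (congrArg H.total (wk_inc X Z))
    · refine (wkT_incT (H.ob X) (((H.slice _).comp
        (B.sliceCongr (H.ft_ob X).symm)).totalT z)).symm.trans ?_
      exact (hw' (U := ⟨n + 1, X⟩) n.succ_pos (sov_incT z)).symm.trans
        (congrArg H.totalT (wkT_incT X z))
  gen {n} X := eq_of_heq (Sigma.mk.inj (hg (U := ⟨n + 1, X⟩) n.succ_pos)).2

/-- A homomorphism of B-frames that is inverse to a pre-B-homomorphism is itself a
pre-B-homomorphism. -/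
theorem IsHom.inverse {H : Hom A.toBFrame B.toBFrame} {K : Hom B.toBFrame A.toBFrame}
    (hH : IsHom H) (h1 : H.comp K = Hom.id A.toBFrame) (h2 : K.comp H = Hom.id B.toBFrame) :
    IsHom K := by
  have e1 : ∀ Z, K.total (H.total Z) = Z := fun Z => congrArg (fun L => L.total Z) h1
  have e1' : ∀ z, K.totalT (H.totalT z) = z := fun z => congrArg (fun L => L.totalT z) h1
  have e2 : ∀ Z, H.total (K.total Z) = Z := fun Z => congrArg (fun L => L.total Z) h2
  have e2' : ∀ z, H.totalT (K.totalT z) = z := fun z => congrArg (fun L => L.totalT z) h2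
  have o := hH.isOp
  have r : ∀ {U : A.Ob}, 0 < U.1 → SOv ⟨0, A.root⟩ U := fun h => (root_ov _).sov h
  refine of_total (fun {x Z} h => ?_) (fun {x z} h => ?_) (fun {U Z} h0 h => ?_)
    (fun {U z} h0 h => ?_) (fun {U} h0 => ?_)
  · have := o.sub (x := K.totalT x) (Z := K.total Z) (r (Nat.succ_pos _))
      (by rw [← total_bdT]; exact ov_total K h)
    rw [e2, e2'] at this
    rw [← this, e1]
  · have := o.subT (x := K.totalT x) (z := K.totalT z) (r (Nat.succ_pos _))
      (by rw [← total_bdT, ← total_bdT]; exact sov_total K h)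
    rw [e2', e2'] at this
    rw [← this, e1']
  · have := o.wk (U := K.total U) (Z := K.total Z) (r h0)
      (by rw [← total_par]; exact ov_total K h)
    rw [e2, e2] at this
    rw [← this, e1]
  · have := o.wkT (U := K.total U) (z := K.totalT z) (r h0)
      (by rw [← total_par, ← total_bdT]; exact sov_total K h)
    rw [e2, e2'] at this
    rw [← this, e1']
  · have := o.gen (U := K.total U) (r h0) h0
    have e3 : B.gen (H.total (K.total U)) h0 = B.gen U h0 := by congr 1; exact e2 U
    rw [← e3, ← this, e1']

end PreBSystem

namespace BSystem

open BFrame PreBSystem StratESystem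

/-- A bijective homomorphism of B-systems is an isomorphism. -/
noncomputable def isoOfBijective {A B : BSystem.{u}} (H : A ⟶ B)
    (h : ∀ n, Function.Bijective ((Hom.toHom H).ob (n := n)))
    (h' : ∀ n, Function.Bijective ((Hom.toHom H).tm (n := n))) : A ≅ B where
  hom := H
  inv := ⟨(Hom.toHom H).inverse h h', (Hom.isHom H).inverse
    ((Hom.toHom H).comp_inverse h h') ((Hom.toHom H).inverse_comp h h')⟩
  hom_inv_id := Hom.ext ((Hom.toHom H).comp_inverse h h')
  inv_hom_id := Hom.ext ((Hom.toHom H).inverse_comp h h')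

variable (B : BSystem.{u})

theorem isTm_singleton (z : B.Tm) : B.IsTm (bdT z) 1 [z] := ⟨z, [], rfl, rfl, rfl⟩

/-- A term `z` of a B-system, as a one-element list over the individual arrow whose domain is the
boundary of `z`. -/
noncomputable def single (z : B.Tm) : B.stratE.Term :=
  B.termCat.mkTerm (arrow (ov_par (bdT z) (Nat.succ_pos _)))
    ⟨[z], isTm_congr (k := 1) rfl (B.isTm_singleton z)⟩

/-- The comparison homomorphism from the frame of a B-system to the frame of the B-system of the
stratified E-system that it generates. -/
noncomputable def toSingle : BFrame.Hom B.toBFrame B.stratE.frame where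
  ob {n} X := ⟨toFree ⟨n, X⟩, rfl⟩
  tm {n} z := ⟨B.single ⟨n, z⟩, rfl, rfl⟩
  ft_ob {n} X := ftn_eq_of_arrow (E := B.stratE) (n := n) (m := 1)
    (arrow (F := B.toBFrame) (ov_par ⟨n + 1, X⟩ n.succ_pos))
  bd_tm _ := rfl

/-- A term of the generated E-system is determined by its domain, its codomain and its list. -/
theorem term_ext {x y : B.stratE.Term} (h1 : x.1.left = y.1.left) (h2 : x.1.right = y.1.right)
    (h : x.2.1 = y.2.1) : x = y :=
  B.raw.mkTerm_ext h1 h2 h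

theorem toSingle_isHom : PreBSystem.IsHom (F := B.toPreBSystem) (G := B.stratE.preB)
    B.toSingle := by
  have hl : ∀ {U : B.Ob} (h0 : 0 < U.1), arrowLength (arrow (ov_par U h0)) = 1 := fun {U} h0 =>
    arrowLength_eq _ (by change U.1 = (par U).1 + 1; rw [par_fst]; omega)
  have hA : ∀ {U : B.Ob}, 0 < U.1 → U.1 = (par U).1 + 1 := fun {U} h0 => by
    rw [par_fst]; omega
  refine .of_total (fun {x Z} h => ?_) (fun {x z} h => ?_) (fun {U Z} h0 h => ?_)
    (fun {U z} h0 h => ?_) (fun {U} h0 => ?_)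
  · refine val_injective ?_
    exact (val_sub (E := B.stratE) (x := B.toSingle.totalT x) rfl (Z := B.toSingle.total Z)
      (P := Over.mk (arrow h)) rfl).symm
  · have o := B.isOp_sub x
    refine valT_injective (Eq.trans ?_ (valT_subT (E := B.stratE) (x := B.toSingle.totalT x) rfl
      (z := B.toSingle.totalT z) (w := (B.termCat.slice (toFree (bdT x))).mkTerm
        (X := Over.mk ((B.single z).1.hom ≫ arrow h.2)) (Y := Over.mk (arrow h.2))
        (Over.homMk (B.single z).1.hom rfl) (B.single z).2) rfl).symm)
    exact B.term_ext (o.bd h) ((congrArg par (o.bd h)).trans (o.par h).symm) rfl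
  · refine val_injective (Eq.trans ?_ (val_wk (E := B.stratE) (arrow (ov_par U h0)) (hA h0)
      (U := B.toSingle.total U) rfl (Z := B.toSingle.total Z) (P := Over.mk (arrow h)) rfl).symm)
    exact congrArg (fun k => B.wks U k Z) (hl h0).symm
  · have o := B.isOp_wk U h0
    refine valT_injective (Eq.trans ?_ (valT_wkT (E := B.stratE) (arrow (ov_par U h0)) (hA h0)
      (U := B.toSingle.total U) rfl (z := B.toSingle.totalT z)
      (w := (B.termCat.slice (toFree (par U))).mkTerm
        (X := Over.mk ((B.single z).1.hom ≫ arrow h.2)) (Y := Over.mk (arrow h.2))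
        (Over.homMk (B.single z).1.hom rfl) (B.single z).2) rfl).symm)
    refine B.term_ext ((o.bd h).trans ?_)
      (((congrArg par (o.bd h)).trans (o.par h).symm).trans ?_) ?_
    · exact congrArg (fun k => B.wks U k (bdT z)) (hl h0).symm
    · exact congrArg (fun k => B.wks U k (par (bdT z))) (hl h0).symm
    · exact congrArg (fun k => [z].map (B.wksT U k)) (hl h0).symm
  · refine valT_injective (Eq.trans ?_ (valT_gen (E := B.stratE) (arrow (ov_par U h0)) (hA h0)
      (U := B.toSingle.total U) rfl h0).symm)
    refine B.term_ext ((B.bdT_gen U h0).trans ?_) (B.par_bdT_gen U h0) ?_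
    · exact congrArg (fun k => B.wks U k U) (hl h0).symm
    · exact (B.gens_succ U h0 0).symm.trans (congrArg (fun k => B.gens U k) (hl h0).symm)

/-- A B-system is isomorphic to the B-system of the stratified E-system that it generates. -/
noncomputable def singleIso : B ≅ E2B.obj (B2E.obj B) :=
  isoOfBijective (⟨B.toSingle, B.toSingle_isHom⟩ : Hom B (E2B.obj (B2E.obj B)))
    (fun n => ⟨fun X Y h => by
        have := congrArg (fun Z => ofFree Z.1) h
        exact eq_of_heq (Sigma.mk.inj this).2,
      fun Z => by
        obtain ⟨⟨k, X⟩, hX⟩ := Z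
        obtain rfl : k = n := hX
        exact ⟨X, rfl⟩⟩)
    (fun n => ⟨fun x y h => by
        have h1 : [(⟨n, x⟩ : B.Tm)] = [⟨n, y⟩] := congrArg (fun z => z.1.2.1) h
        exact eq_of_heq (Sigma.mk.inj (List.cons.inj h1).1).2,
      fun z => by
        obtain ⟨⟨⟨P, Q, f⟩, t, ht⟩, h1, h2⟩ := z
        have hP : (ofFree P).1 = n + 1 := h1
        have hQ : (ofFree Q).1 = n := h2
        have hf : arrowLength f = 1 := arrowLength_eq f (hP.trans (congrArg (· + 1) hQ).symm)
        have hp : par (ofFree P) = Q := by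
          have := (arrow_spec f).2
          rwa [hf] at this
        rw [hf] at ht
        obtain ⟨⟨m, x⟩, t, rfl, rfl, hx⟩ := ht
        have hx' : bdT ⟨m, x⟩ = ofFree P := hx
        obtain rfl : m = n := by
          have := congrArg Sigma.fst hx'
          change m + 1 = (ofFree P).1 at this
          omega
        exact ⟨x, Subtype.ext (B.term_ext hx' ((congrArg par hx').trans hp) rfl)⟩⟩)

end BSystem

/-- The natural isomorphism `E2B ∘ B2E ≅ id`. -/
noncomputable def singleNatIso : 𝟭 BSystem.{u} ≅ B2E.{u} ⋙ E2B.{u} :=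
  NatIso.ofComponents BSystem.singleIso (fun {A B} F => by
    refine BSystem.Hom.ext (BFrame.Hom.ext_total (fun Z => rfl) (fun z => ?_))
    refine StratESystem.valT_injective (BSystem.term_ext _ ?_ ?_ rfl)
    · exact (BFrame.total_bdT (BSystem.Hom.toHom F) z).symm
    · exact ((BFrame.total_par _ _).trans
        (congrArg BFrame.par (BFrame.total_bdT (BSystem.Hom.toHom F) z))).symm)

theorem mainTheorem3 :
    B2E.{u}.Full ∧ B2E.{u}.Faithful ∧ Nonempty (E2B.{u} ⋙ B2E.{u} ≅ 𝟭 StratESystem.{u}) ∧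
      ∃ e : BSystem.{u} ≌ StratESystem.{u}, e.functor = B2E.{u} ∧ e.inverse = E2B.{u} := by
  let e : BSystem.{u} ≌ StratESystem.{u} :=
    CategoryTheory.Equivalence.mk B2E E2B singleNatIso compsNatIso.symm
  exact ⟨inferInstanceAs e.functor.Full, inferInstanceAs e.functor.Faithful, ⟨compsNatIso.symm⟩,
    e, rfl, rfl⟩
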